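/- **Conventions.** Fix $q\in\mathbb C$ with $|q|>1$ and a determination of $\log q$; put $q^\alpha=e^{\alpha\log q}$, $(\sigma_q y)(z)=y(qz)$, and $\Theta_p(z)=\sum_{\ell\in\mathbb Z}p^{-\ell(\ell+1)/2}z^\ell$ for $|p|>1$. Let $\mathcal M(\mathbb C^*)$ (resp. $\mathcal M(\mathbb C^*,0)$) be the field of functions meromorphic on $\mathbb C^*$ (resp. on some punctured neighbourhood of $0$). Let $\mu\in\mathbb Q_{>0}$, $K\in\mathbb N^*$ with $K/\mu\in\mathbb N^*$, and $\lambda\in\mathbb C^*/q^{K^{-1}\mathbb Z}$. * $\hat{\mathcal B}_\mu\big(\sum_\ell a_\ell z^\ell\big)=\sum_\ell a_\ell q^{-\ell(\ell-1)/(2\mu)}\zeta^\ell$. * $f\in\mathcal M(\mathbb C^*,0)$ belongs to $\mathbb H^{[\lambda]}_{\mu,K}$ if for some $\varepsilon>0$ it can be continued to an analytic function on a connected domain $\Omega\subset\mathbb C$ containing all discs $\{|z-\lambda q^\ell|<\varepsilon|\lambda q^\ell|\}$, $\ell\in K^{-1}\mathbb Z$, with $|f(z)|<L\,|\Theta_{|q|^{1/\mu}}(M|z|)|$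 on $\Omega\setminus\{0\}$ for some constants $L,M>0$. A power series belongs to $\mathbb H^{[\lambda]}_{\mu,K}$ if it converges near $0$ and its sum does. * $\mathcal L^{[\lambda]}_{\mu,K}(f)(z)=\frac{\mu}{K}\sum_{\ell\in K^{-1}\mathbb Z}\dfrac{f(q^\ell\lambda)}{\Theta_{q^{1/\mu}}\big(q^{1/\mu+\ell}\lambda/z\big)}$, which is *defined* for $f\in\mathbb H^{[\lambda]}_{\mu,K}$ if the values $f(q^\ell\lambda)$ of the continuation do not depend on the choice of $\Omega$, the series converges for $z$ close to $0$ off the spiral $-\lambda q^{K^{-1}\mathbb Z}$, and the sum is in $\mathcal M(\mathbb C^*,0)$. * For $\mu\in\mathbb Q_{>0}$, $K\in\mathbb N^*$ (without the condition $K/\mu\in\mathbb N^*$), $f\sim^{[\lambda]}_{\mu,K}\sum_i\hat f_iz^i$ means: for all sufficiently small $\varepsilon,R>0$ there are $L,M>0$ such that $\big|f(z)-\sum_{i<k}\hat f_iz^i\big|<LM^k|q|^{k(k-1)/(2\mu)}|z|^k$ for all $k\in\mathbb N$ and all $z$ with $0<|z|<R$ and $|z+q^\ell\lambda|\ge\varepsilon|q^\ell\lambda|$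 for every $\ell\in K^{-1}\mathbb Z$. * The Newton polygon of an operator $P=\sum_i b_i\sigma_q^i\neq0$ (finite sum over $i\in\mathbb Z$, $b_i\in\mathbb C[z]$) is the convex hull of $\bigcup_{b_i\ne0}\{(i,j): j\ge v_0(b_i)\}$, where $v_0$ is the $z$-adic valuation; the positive slopes of $P$, and of any equation $P(h)=a$ with $a\in\mathbb C[z]$, are the positive slopes of the segments of the lower part of its boundary. **Theorem.** Let $A\in\mathrm{GL}_m(\mathbb C(z))$ and let $\hat Y=(\hat Y_j)_{j\le m}\in\mathbb C[[z]]^m$ satisfy $\sigma_q\hat Y=A\hat Y$. Let $\{\mu_1<\dots<\mu_r\}\subset\mathbb Q_{>0}$ be minimal for inclusion among the finite sets of positive rationals such that each entry $\hat Y_j$ satisfies a linear $q$-difference equation with coefficients in $\mathbb C[z]$ whose positive slopes lie in this set, and assume $r\ge1$. Put $\mu_{r+1}=+\infty$ and $\kappa_i^{-1}=\mu_i^{-1}-\mu_{i+1}^{-1}$. Let $K\in\mathbb N^*$ be minimal with $K/\kappa_i\in\mathbb N^*$ for all $i\in\{1,\dots,r\}$, and $n\in\mathbb N^*$ minimal with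 $n/\kappa_r\in\mathbb N^*$; then $n\mid K$, and a class $\lambda\in\mathbb C^*/q^{n^{-1}\mathbb Z}$ also defines a class in $\mathbb C^*/q^{K^{-1}\mathbb Z}$. There is a finite set $\Sigma\subset\mathbb C^*/q^{n^{-1}\mathbb Z}$ such that for every $\lambda\in(\mathbb C^*/q^{n^{-1}\mathbb Z})\setminus\Sigma$ and every $j\le m$: 1. $\hat{\mathcal B}_{\kappa_1}\circ\cdots\circ\hat{\mathcal B}_{\kappa_r}(\hat Y_j)\in\mathbb H^{[\lambda]}_{\kappa_1,K}$; 2. for $i=1,\dots,r-1$ successively, $\mathcal L^{[\lambda]}_{\kappa_i,K}\circ\cdots\circ\mathcal L^{[\lambda]}_{\kappa_1,K}\circ\hat{\mathcal B}_{\kappa_1}\circ\cdots\circ\hat{\mathcal B}_{\kappa_r}(\hat Y_j)$ is defined and belongs to $\mathbb H^{[\lambda]}_{\kappa_{i+1},K}$; 3. the function $$S_q^{[\lambda]}(\hat Y)_j:=\mathcal L^{[\lambda]}_{\kappa_r,n}\circ\mathcal L^{[\lambda]}_{\kappa_{r-1},K}\circ\cdots\circ\mathcal L^{[\lambda]}_{\kappa_1,K}\circ\hat{\mathcal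 B}_{\kappa_1}\circ\cdots\circ\hat{\mathcal B}_{\kappa_r}(\hat Y_j)$$ is defined and extends to an element of $\mathcal M(\mathbb C^*)$. Moreover the vector $S_q^{[\lambda]}(\hat Y)=(S_q^{[\lambda]}(\hat Y)_j)_{j\le m}\in\mathcal M(\mathbb C^*)^m$ satisfies $\sigma_qS_q^{[\lambda]}(\hat Y)=A\,S_q^{[\lambda]}(\hat Y)$, and $S_q^{[\lambda]}(\hat Y)_j\sim^{[\lambda]}_{\mu_1,n}\hat Y_j$ for every $j\le m$. -/

import Mathlib

open Filter Topology Polynomial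

noncomputable section

namespace QDiff

/-! Throughout, `τ` is the chosen determination of `log q`, so that `q = exp τ`. -/

/-- `q ^ α := exp (α log q)`. -/
def qPow (τ α : ℂ) : ℂ := Complex.exp (α * τ)

/-- `q ^ α` as an element of the multiplicative group `ℂ*`. -/
def qPowUnit (τ α : ℂ) : ℂˣ := Units.mk0 (qPow τ α) (Complex.exp_ne_zero _)

/-- The quotient group `ℂ* / q ^ (K⁻¹ ℤ)`. -/
abbrev SpiralSpace (τ : ℂ) (K : ℕ) : Type :=
  ℂˣ ⧸ Subgroup.zpowers (qPowUnit τ (1 / (K : ℂ)))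

/-- The Theta function `Θ_p(z) = ∑_{ℓ ∈ ℤ} p ^ (-ℓ(ℓ+1)/2) z ^ ℓ`, for `1 < |p|` and `z ≠ 0`.
The integer division is exact. -/
def theta (p z : ℂ) : ℂ := ∑' ℓ : ℤ, p ^ (-(ℓ * (ℓ + 1) / 2)) * z ^ ℓ

/-! ### Formal series -/

/-- The formal `q`-Borel transformation of order `μ`. -/
def qBorel (τ : ℂ) (μ : ℚ) (h : PowerSeries ℂ) : PowerSeries ℂ :=
  PowerSeries.mk fun ℓ =>
    PowerSeries.coeff ℓ h * qPow τ (-((ℓ : ℂ) * ((ℓ : ℂ) - 1) / (2 * (μ : ℂ))))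

/-- `qBorelIter τ κ r = B_{κ 0} ∘ B_{κ 1} ∘ ⋯ ∘ B_{κ (r-1)}`. -/
def qBorelIter (τ : ℂ) (κ : ℕ → ℚ) : ℕ → PowerSeries ℂ → PowerSeries ℂ
  | 0, h => h
  | i + 1, h => qBorelIter τ κ i (qBorel τ (κ i) h)

/-- A power series has a positive radius of convergence. -/
def Convergent (h : PowerSeries ℂ) : Prop :=
  ∃ ρ : ℝ, 0 < ρ ∧ Summable fun k : ℕ => ‖PowerSeries.coeff k h‖ * ρ ^ k

/-- The sum of a (convergent) power series. -/
def seriesSum (h : PowerSeries ℂ) (z : ℂ) : ℂ := ∑' k : ℕ, PowerSeries.coeff k h * z ^ k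

/-! ### Linear `q`-difference operators, Newton polygon, slopes -/

/-- Action on `ℂ[[z]]` of the operator `∑_i b_i σ_q ^ i`, where `b_i ∈ ℂ[z]`, `i ∈ ℤ`, and
`(σ_q ^ i h)(z) = h(q ^ i z)`. -/
def applyOp (q : ℂ) (P : ℤ →₀ ℂ[X]) (h : PowerSeries ℂ) : PowerSeries ℂ :=
  P.sum fun i b => (b : PowerSeries ℂ) * PowerSeries.rescale (q ^ i) h

/-- The Newton polygon of `∑_i b_i σ_q ^ i`: the convex hull of the half-lines
`{(i, y) | y ≥ v₀(b_i)}` over the `i` with `b_i ≠ 0`. -/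
def newtonPolygon (P : ℤ →₀ ℂ[X]) : Set (ℝ × ℝ) :=
  convexHull ℝ {p | ∃ i ∈ P.support, p.1 = (i : ℝ) ∧ ((P i).natTrailingDegree : ℝ) ≤ p.2}

/-- `s` is the slope of a non-degenerate segment of the lower boundary of the Newton polygon. -/
def IsSlope (P : ℤ →₀ ℂ[X]) (s : ℚ) : Prop :=
  ∃ a ∈ newtonPolygon P, ∃ b ∈ newtonPolygon P,
    a.1 < b.1 ∧ b.2 - a.2 = (s : ℝ) * (b.1 - a.1) ∧
    ∀ c ∈ newtonPolygon P, a.2 + (s : ℝ) * (c.1 - a.1) ≤ c.2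

/-- `h` satisfies a linear `q`-difference equation `P h = a`, with `P ≠ 0` and `a` having
coefficients in `ℂ[z]`, all of whose positive slopes belong to `S`. -/
def SatisfiesEqWithSlopesIn (q : ℂ) (h : PowerSeries ℂ) (S : Finset ℚ) : Prop :=
  ∃ (P : ℤ →₀ ℂ[X]) (a : ℂ[X]), P ≠ 0 ∧ applyOp q P h = (a : PowerSeries ℂ) ∧
    ∀ s : ℚ, 0 < s → IsSlope P s → s ∈ S

/-- `S` is a set of positive rationals such that every entry of `Y` satisfies a linear
`q`-difference equation with positive slopes contained in `S`. -/
def SlopesCovered {m : ℕ} (q : ℂ) (Y : Fin m → PowerSeries ℂ) (S : Finset ℚ) : Prop :=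
  (∀ s ∈ S, 0 < s) ∧ ∀ j, SatisfiesEqWithSlopesIn q (Y j) S

/-- The numbers `κ_i`, with indices shifted to start at `0`:
`κ_i⁻¹ = μ_i⁻¹ - μ_{i+1}⁻¹` for `i + 1 < r`, and the last one is `κ_{r-1} = μ_{r-1}`
(the convention being that the next `μ` is `+∞`). -/
def kappa (r : ℕ) (μ : ℕ → ℚ) (i : ℕ) : ℚ :=
  if i + 1 < r then ((μ i)⁻¹ - (μ (i + 1))⁻¹)⁻¹ else μ i

/-! ### Functions meromorphic near the origin, and the `q`-Laplace transformation -/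

/-- `f` represents an element of `M(ℂ*, 0)`: it is meromorphic on a punctured neighbourhood
of `0` in `ℂ*`. Its values on a discrete set carry no information. -/
def MeromorphicNearZero (f : ℂ → ℂ) : Prop := ∀ᶠ z in 𝓝[≠] (0 : ℂ), MeromorphicAt f z

/-- `z` lies on the discrete spiral `-λ q ^ (K⁻¹ ℤ)`. -/
def OnSpiral (τ : ℂ) (K : ℕ) (lam : ℂˣ) (z : ℂ) : Prop :=
  ∃ ℓ : ℤ, z = -(qPow τ ((ℓ : ℂ) / (K : ℂ)) * (lam : ℂ))

/-- `g` is an analytic continuation of the germ `f` to a connected domain `Ω` that contains the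
discs `|z - λ q^ℓ| < ε |λ q^ℓ|`, `ℓ ∈ K⁻¹ ℤ`, and `g` has `q ^ (1/μ)`-exponential growth of
order `1` on `Ω`. -/
structure IsContinuationOn (τ : ℂ) (μ : ℚ) (K : ℕ) (lam : ℂˣ) (f g : ℂ → ℂ) (Ω : Set ℂ) :
    Prop where
  isOpen : IsOpen Ω
  isConnected : IsConnected Ω
  discs : ∃ ε : ℝ, 0 < ε ∧ ∀ (ℓ : ℤ) (z : ℂ),
    ‖z - qPow τ ((ℓ : ℂ) / (K : ℂ)) * (lam : ℂ)‖ < ε * ‖qPow τ ((ℓ : ℂ) / (K : ℂ)) * (lam : ℂ)‖ →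
      z ∈ Ω
  analytic : AnalyticOnNhd ℂ g Ω
  /-- `g` is the meromorphic function `f` on the part of `Ω` close to `0`. -/
  agree : ∀ᶠ z in 𝓝[≠] (0 : ℂ), z ∈ Ω → f =ᶠ[𝓝[≠] z] g
  growth : ∃ L M : ℝ, 0 < L ∧ 0 < M ∧ ∀ z ∈ Ω, z ≠ 0 →
    ‖g z‖ < L * ‖theta ((‖Complex.exp τ‖ ^ (1 / (μ : ℝ)) : ℝ) : ℂ) ((M * ‖z‖ : ℝ) : ℂ)‖

/-- `g` is such a continuation of `f` on some domain. -/
def IsContinuation (τ : ℂ) (μ : ℚ) (K : ℕ) (lam : ℂˣ) (f g : ℂ → ℂ) : Prop :=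
  ∃ Ω : Set ℂ, IsContinuationOn τ μ K lam f g Ω

/-- Membership in the space `H^{[λ]}_{μ,K}`. -/
def InH (τ : ℂ) (μ : ℚ) (K : ℕ) (lam : ℂˣ) (f : ℂ → ℂ) : Prop :=
  MeromorphicNearZero f ∧ ∃ g, IsContinuation τ μ K lam f g

open Classical in
/-- The analytic continuation of `f ∈ H^{[λ]}_{μ,K}`. -/
def continuation (τ : ℂ) (μ : ℚ) (K : ℕ) (lam : ℂˣ) (f : ℂ → ℂ) : ℂ → ℂ :=
  if h : ∃ g, IsContinuation τ μ K lam f g then h.choose else 0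

/-- The term of index `ℓ / K` of the series defining the `q`-Laplace transform. -/
def qLaplaceTerm (τ : ℂ) (μ : ℚ) (K : ℕ) (lam : ℂˣ) (f : ℂ → ℂ) (z : ℂ) (ℓ : ℤ) : ℂ :=
  continuation τ μ K lam f (qPow τ ((ℓ : ℂ) / (K : ℂ)) * (lam : ℂ)) /
    theta (qPow τ (1 / (μ : ℂ)))
      (qPow τ (1 / (μ : ℂ) + (ℓ : ℂ) / (K : ℂ)) * (lam : ℂ) / z)

/-- The `q`-Laplace transformation `L^{[λ]}_{μ,K}`. -/
def qLaplace (τ : ℂ) (μ : ℚ) (K : ℕ) (lam : ℂˣ) (f : ℂ → ℂ) (z : ℂ) : ℂ :=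
  ((μ : ℂ) / (K : ℂ)) * ∑' ℓ : ℤ, qLaplaceTerm τ μ K lam f z ℓ

/-- The `q`-Laplace transform of `f` makes sense: `f` belongs to `H^{[λ]}_{μ,K}`, the values on
`λ q ^ (K⁻¹ ℤ)` of its analytic continuation do not depend on the choice of the domain, the
defining series converges for `z` close to `0` off the spiral `-λ q ^ (K⁻¹ ℤ)`, and its sum is an
element of `M(ℂ*, 0)`. -/
structure QLaplaceDefined (τ : ℂ) (μ : ℚ) (K : ℕ) (lam : ℂˣ) (f : ℂ → ℂ) : Prop where
  mem : InH τ μ K lam f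
  unique : ∀ g₁ g₂, IsContinuation τ μ K lam f g₁ → IsContinuation τ μ K lam f g₂ →
    ∀ ℓ : ℤ, g₁ (qPow τ ((ℓ : ℂ) / (K : ℂ)) * (lam : ℂ)) =
      g₂ (qPow τ ((ℓ : ℂ) / (K : ℂ)) * (lam : ℂ))
  summable : ∀ᶠ z in 𝓝[≠] (0 : ℂ), ¬ OnSpiral τ K lam z →
    Summable (qLaplaceTerm τ μ K lam f z)
  meromorphic : MeromorphicNearZero (qLaplace τ μ K lam f)

/-- `qLaplaceIter τ κ K λ f i = L^{[λ]}_{κ (i-1), K} ∘ ⋯ ∘ L^{[λ]}_{κ 0, K} (f)`. -/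
def qLaplaceIter (τ : ℂ) (κ : ℕ → ℚ) (K : ℕ) (lam : ℂˣ) (f : ℂ → ℂ) : ℕ → ℂ → ℂ
  | 0 => f
  | i + 1 => qLaplace τ (κ i) K lam (qLaplaceIter τ κ K lam f i)

/-- `L^{[λ]}_{κ (i-1), K} ∘ ⋯ ∘ L^{[λ]}_{κ 0, K} ∘ B_{κ 0} ∘ ⋯ ∘ B_{κ (r-1)} (h)`. -/
def stage (τ : ℂ) (κ : ℕ → ℚ) (r K : ℕ) (lam : ℂˣ) (h : PowerSeries ℂ) (i : ℕ) : ℂ → ℂ :=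
  qLaplaceIter τ κ K lam (seriesSum (qBorelIter τ κ r h)) i

/-- The Borel-Laplace sum `S_q^{[λ]}(h)` near `0`: the last of the `r` Laplace transformations
uses `n` instead of `K`. -/
def borelLaplaceSum (τ : ℂ) (κ : ℕ → ℚ) (r K n : ℕ) (lam : ℂˣ) (h : PowerSeries ℂ) : ℂ → ℂ :=
  qLaplace τ (κ (r - 1)) n lam (stage τ κ r K lam h (r - 1))

/-- `f ∼^{[λ]}_{μ,K} h`: `f` is `q`-Gevrey asymptotic to the formal series `h`. -/
def QGevreyAsymptotic (τ : ℂ) (μ : ℚ) (K : ℕ) (lam : ℂˣ) (f : ℂ → ℂ) (h : PowerSeries ℂ) :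
    Prop :=
  ∃ ε₀ R₀ : ℝ, 0 < ε₀ ∧ 0 < R₀ ∧ ∀ ε R : ℝ, 0 < ε → ε < ε₀ → 0 < R → R < R₀ →
    ∃ L M : ℝ, 0 < L ∧ 0 < M ∧ ∀ (k : ℕ) (z : ℂ), z ≠ 0 → ‖z‖ < R →
      (∀ ℓ : ℤ, ε * ‖qPow τ ((ℓ : ℂ) / (K : ℂ)) * (lam : ℂ)‖ ≤
        ‖z + qPow τ ((ℓ : ℂ) / (K : ℂ)) * (lam : ℂ)‖) →
      ‖f z - ∑ i ∈ Finset.range k, PowerSeries.coeff i h * z ^ i‖ <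
        L * M ^ k * ‖Complex.exp τ‖ ^ ((k : ℝ) * ((k : ℝ) - 1) / (2 * (μ : ℝ))) * ‖z‖ ^ k

end QDiff

end

/-! Put Q = q^(1/K), so that q = Q^K, let N_i = K/κ_i, and let D_i be the sum of the N_j with j ≥ i.
The inverses of the κ_i telescope, so D_i = K/μ_i, and D_r = 0 (indices start at 0, as in the code).
A series or function is "at level D" when its k-th coefficient has been multiplied by Q^(-D
k(k-1)/2). At level D the monomial z^d σ_q^a of an operator becomes, up to a constant,
multiplication by z^d composed with f(z) ↦ f(Q^(Ka-Dd) z). The composed Borel transformation goes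
from level 0 to level D_0, and the i-th Laplace transformation from D_i to D_{i+1}. One equation for
each entry is followed through all these levels.

At level D the monomials of greatest shift Ka-Dd are those on a supporting line of slope K/D of the
Newton polygon. As the positive slopes are among the μ_i, the right end (I, J) of the face of slope
μ_i is dominant both at D_i and at D_{i+1} (`exists_vertices`). Dominance at D_i allows the equation
to be solved for the value at the largest shift: a solution near 0 continues outwards along z ↦ Qz,
with singularities only on the spirals through the roots of a polynomial (`exists_extension`). These
spirals, finite in number, give Σ. Dominance at D_{i+1} says that this polynomial has degree J and
that the other terms are small enough for the solution to grow at most like |Q|^(ℓ²/(2 N_i)) on Q^ℓ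
U (`exists_growth`), which is the growth of the Theta function of base |Q|^(N_i). At level D_0 a
vertex of minimal degree in z is dominant, and the recursion on the coefficients then gives
convergence of the Borel transforms (`exists_geometric_bound`). At level 0 the continuation gives
meromorphic functions on ℂ*.

For the Laplace transformation with p = Q^N, the functional equation of Theta turns a sum over a
p-spiral into a Laurent series divided by a single Theta value, and sends x^i to p^(i(i-1)/2) z^i. A
lower bound for Theta away from its zeros (`exists_le_norm_theta`, which rests on the triple
product) gives the asymptotic estimate (`norm_lap_sub_le`). The Gevrey weight is multiplied by |p|
at each transformation, and the final product is |Q|^(D_0) = |q|^(1/μ_0).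

The system is recovered by carrying along every linear q-difference relation between the entries:
Laplace sums intertwine the operators of consecutive levels (`lap_relation`), and analytic
continuation preserves relations. `StageData` packages the estimates and the relations. The identity
theorem on the connected complement of the spirals makes the values of a continuation independent of
its domain. -/

noncomputable section

/-! ### The Theta function: functional equation, zeros, lower bounds -/

namespace QDiff

/-! ### Triangular numbers -/

/-- The triangular number `ℓ (ℓ + 1) / 2`. -/
def tri (ℓ : ℤ) : ℤ := ℓ * (ℓ + 1) / 2

lemma two_mul_tri (ℓ : ℤ) : 2 * tri ℓ = ℓ * (ℓ + 1) :=
  Int.mul_ediv_cancel' (Int.even_mul_succ_self ℓ).two_dvd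

lemma tri_add (k l : ℤ) : tri (k + l) = tri k + tri l + k * l := by
  have h1 := two_mul_tri (k + l)
  have h2 := two_mul_tri k
  have h3 := two_mul_tri l
  have : 2 * tri (k + l) = 2 * (tri k + tri l + k * l) := by linear_combination h1 - h2 - h3
  omega

lemma tri_sub_one (k : ℤ) : tri (k - 1) = tri k - k := by
  have h1 := two_mul_tri (k - 1)
  have h2 := two_mul_tri k
  have : 2 * tri (k - 1) = 2 * (tri k - k) := by linear_combination h1 - h2
  omega

lemma tri_neg (k : ℤ) : tri (-k) = tri k - k := by
  have h1 := two_mul_tri (-k)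
  have h2 := two_mul_tri k
  have : 2 * tri (-k) = 2 * (tri k - k) := by linear_combination h1 - h2
  omega

lemma tri_neg_sub_one (k : ℤ) : tri (-k - 1) = tri k := by
  rw [tri_sub_one, tri_neg]; ring

@[simp] lemma tri_zero : tri 0 = 0 := rfl

lemma tri_sq (k : ℤ) : k * k = tri k + tri (k - 1) := by
  have h1 := two_mul_tri k
  rw [tri_sub_one]; linarith

/-! ### Convergence of the Theta series -/

lemma summable_theta_nat {P x : ℝ} (hP : 1 < P) (hx : 0 < x) :
    Summable fun n : ℕ => P ^ (-tri n) * x ^ n := by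
  have hP0 : 0 < P := by linarith
  refine summable_of_ratio_test_tendsto_lt_one (l := 0) one_pos
    (Eventually.of_forall fun n => by positivity) ?_
  have : ∀ n : ℕ, ‖P ^ (-tri (n + 1 : ℕ)) * x ^ (n + 1)‖ / ‖P ^ (-tri n) * x ^ n‖
      = x * P⁻¹ ^ (n + 1) := by
    intro n
    rw [Real.norm_of_nonneg (by positivity), Real.norm_of_nonneg (by positivity)]
    have h : -tri ((n + 1 : ℕ) : ℤ) = -tri n - ((n + 1 : ℕ) : ℤ) := by
      push_cast
      have := tri_sub_one ((n : ℤ) + 1)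
      simp only [add_sub_cancel_right] at this
      linarith
    rw [h, zpow_sub₀ hP0.ne', zpow_natCast, inv_pow, pow_succ x]
    field_simp
  simp only [this]
  have h2 : Tendsto (fun n : ℕ => P⁻¹ ^ (n + 1)) atTop (𝓝 0) :=
    (tendsto_pow_atTop_nhds_zero_of_lt_one (by positivity) (inv_lt_one_of_one_lt₀ hP)).comp
      (tendsto_add_atTop_nat 1)
  simpa using h2.const_mul x

lemma summable_theta_real {P x : ℝ} (hP : 1 < P) (hx : 0 < x) :
    Summable fun ℓ : ℤ => P ^ (-tri ℓ) * x ^ ℓ := by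
  refine Summable.of_nat_of_neg_add_one (f := fun ℓ : ℤ => P ^ (-tri ℓ) * x ^ ℓ) ?_ ?_
  · simpa using summable_theta_nat hP hx
  · refine ((summable_theta_nat hP (inv_pos.2 hx)).mul_right x⁻¹).congr fun n => ?_
    have : tri (-((n : ℤ) + 1)) = tri n := by rw [neg_add]; exact tri_neg_sub_one n
    have h2 : x ^ (-((n : ℤ) + 1)) = x⁻¹ ^ n * x⁻¹ := by
      rw [← pow_succ, inv_pow, zpow_neg]
      exact congrArg _ (by exact_mod_cast zpow_natCast x (n + 1))
    rw [this, h2, mul_assoc]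

lemma summable_theta {p x : ℂ} (hp : 1 < ‖p‖) (hx : x ≠ 0) :
    Summable fun ℓ : ℤ => p ^ (-tri ℓ) * x ^ ℓ := by
  refine Summable.of_norm ?_
  simpa [norm_zpow] using summable_theta_real hp (norm_pos_iff.2 hx)

/-- The Theta function with real arguments. -/
def thetaR (P x : ℝ) : ℝ := ∑' ℓ : ℤ, P ^ (-tri ℓ) * x ^ ℓ

lemma theta_ofReal (P x : ℝ) : theta (P : ℂ) (x : ℂ) = (thetaR P x : ℂ) := by
  rw [thetaR, Complex.ofReal_tsum]
  refine tsum_congr fun ℓ => ?_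
  push_cast
  rfl

lemma le_thetaR {P x : ℝ} (hP : 1 < P) (hx : 0 < x) (k : ℤ) :
    P ^ (-tri k) * x ^ k ≤ thetaR P x :=
  (summable_theta_real hP hx).le_tsum k fun _ _ => by positivity

lemma thetaR_pos {P x : ℝ} (hP : 1 < P) (hx : 0 < x) : 0 < thetaR P x :=
  lt_of_lt_of_le (by positivity) (le_thetaR hP hx 0)

lemma le_norm_theta_ofReal {P x : ℝ} (hP : 1 < P) (hx : 0 < x) (k : ℤ) :
    P ^ (-tri k) * x ^ k ≤ ‖theta (P : ℂ) (x : ℂ)‖ := by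
  rw [theta_ofReal, Complex.norm_real]
  exact (le_thetaR hP hx k).trans (le_abs_self _)

/-! ### Functional equation -/

/-- Reindexing by ℓ ↦ ℓ + k completes the square in the exponent, and k² = tri k + tri (k - 1)
collects the constant. Both the reduction of Laplace sums to Laurent series and the compatibility of
Laplace sums with q-shifts rest on this identity. -/
lemma theta_zpow_mul {p x : ℂ} (hp : p ≠ 0) (hx : x ≠ 0) (k : ℤ) :
    theta p (p ^ k * x) = p ^ tri (k - 1) * x ^ k * theta p x := by
  change (∑' ℓ : ℤ, p ^ (-tri ℓ) * (p ^ k * x) ^ ℓ) = _ * ∑' ℓ : ℤ, p ^ (-tri ℓ) * x ^ ℓ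
  rw [← tsum_mul_left, ← (Equiv.addRight k).tsum_eq]
  refine tsum_congr fun m => ?_
  simp only [Equiv.coe_addRight]
  rw [mul_zpow, ← zpow_mul, zpow_add₀ hx, tri_add]
  have : p ^ (-(tri m + tri k + m * k)) * p ^ (k * (m + k)) = p ^ tri (k - 1) * p ^ (-tri m) := by
    rw [← zpow_add₀ hp, ← zpow_add₀ hp]
    congr 1
    have := tri_sq k
    linarith
  linear_combination x ^ m * x ^ k * this

lemma thetaR_zpow_mul {P x : ℝ} (hP : 0 < P) (hx : 0 < x) (k : ℤ) :
    thetaR P (P ^ k * x) = P ^ tri (k - 1) * x ^ k * thetaR P x := by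
  have := theta_zpow_mul (p := (P : ℂ)) (x := (x : ℂ)) (by exact_mod_cast hP.ne')
    (by exact_mod_cast hx.ne') k
  rw [theta_ofReal, show ((P : ℂ) ^ k * (x : ℂ)) = ((P ^ k * x : ℝ) : ℂ) by push_cast; rfl,
    theta_ofReal] at this
  exact_mod_cast this

/-! ### Non-vanishing, by a finite form of the Jacobi triple product -/

section TripleProduct

/-- `∏_{k=1}^n (1 - u^k)`. -/
def qPoch (u : ℂ) (n : ℕ) : ℂ := ∏ k ∈ Finset.range n, (1 - u ^ (k + 1))

/-- The inverse of `qPoch`, extended by zero to negative integers. -/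
def qPochInv (u : ℂ) (k : ℤ) : ℂ := if 0 ≤ k then (qPoch u k.toNat)⁻¹ else 0

lemma one_sub_pow_ne_zero {u : ℂ} (hu : ‖u‖ < 1) (k : ℕ) : 1 - u ^ (k + 1) ≠ 0 := by
  intro h
  have h2 : ‖u ^ (k + 1)‖ = 1 := by rw [← sub_eq_zero.1 h]; simp
  rw [norm_pow] at h2
  exact (pow_lt_one₀ (norm_nonneg u) hu (Nat.succ_ne_zero k)).ne h2

lemma qPoch_ne_zero {u : ℂ} (hu : ‖u‖ < 1) (n : ℕ) : qPoch u n ≠ 0 :=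
  Finset.prod_ne_zero_iff.2 fun k _ => one_sub_pow_ne_zero hu k

lemma qPochInv_sub_one {u : ℂ} (hu : ‖u‖ < 1) (k : ℤ) :
    qPochInv u (k - 1) = (1 - u ^ k) * qPochInv u k := by
  rcases lt_trichotomy k 0 with h | h | h
  · simp [qPochInv, not_le.2 h, show ¬ (1 ≤ k) by omega]
  · subst h; simp [qPochInv]
  · obtain ⟨n, rfl⟩ : ∃ n : ℕ, k = n + 1 := ⟨(k - 1).toNat, by omega⟩
    have h1 : (0 : ℤ) ≤ (n : ℤ) + 1 := by omega
    have h2 : ((n : ℤ) + 1).toNat = n + 1 := by omega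
    simp only [qPochInv, add_sub_cancel_right, Nat.cast_nonneg, if_true, h1, h2, Int.toNat_natCast]
    rw [qPoch, qPoch, Finset.prod_range_succ]
    have := one_sub_pow_ne_zero hu n
    have h3 : ∏ k ∈ Finset.range n, (1 - u ^ (k + 1)) ≠ 0 := qPoch_ne_zero hu n
    have h4 : u ^ ((n : ℤ) + 1) = u ^ (n + 1) := by exact_mod_cast zpow_natCast u (n + 1)
    rw [h4]
    field_simp

/-- The coefficients of the finite triple product, without the power of `u`. -/
def tripleCoeff (u : ℂ) (n : ℕ) (ℓ : ℤ) : ℂ :=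
  qPoch u (2 * n) * qPochInv u (n + ℓ) * qPochInv u (n - ℓ)

/-- `tripleCoeff u n ℓ` is the Gaussian binomial coefficient of 2n over n + ℓ. This is the Pascal
rule applied twice, matching multiplication by the two new factors (1 + u^(n+1) x)(1 + u^n x⁻¹).
Once every factor is expressed at the indices n + 1 ± ℓ it is a polynomial identity. -/
lemma tripleCoeff_succ {u : ℂ} (hu : ‖u‖ < 1) (hu0 : u ≠ 0) (n : ℕ) (ℓ : ℤ) :
    tripleCoeff u (n + 1) ℓ = (1 + u ^ (2 * n + 1)) * tripleCoeff u n ℓ +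
      u ^ ((n : ℤ) + 1 - ℓ) * tripleCoeff u n (ℓ - 1) +
      u ^ ((n : ℤ) + ℓ + 1) * tripleCoeff u n (ℓ + 1) := by
  simp only [tripleCoeff]
  have e1 : qPochInv u (n + ℓ) = (1 - u ^ ((n : ℤ) + 1 + ℓ)) * qPochInv u (n + 1 + ℓ) := by
    rw [← qPochInv_sub_one hu]; congr 1; ring
  have e2 : qPochInv u (n - ℓ) = (1 - u ^ ((n : ℤ) + 1 - ℓ)) * qPochInv u (n + 1 - ℓ) := by
    rw [← qPochInv_sub_one hu]; congr 1; ring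
  have e3 : qPochInv u (n + (ℓ - 1)) = (1 - u ^ ((n : ℤ) + ℓ)) * qPochInv u (n + ℓ) := by
    rw [← qPochInv_sub_one hu]; congr 1; ring
  have e4 : qPochInv u (n - (ℓ + 1)) = (1 - u ^ ((n : ℤ) - ℓ)) * qPochInv u (n - ℓ) := by
    rw [← qPochInv_sub_one hu]; congr 1; ring
  have e5 : qPochInv u (n - (ℓ - 1)) = qPochInv u (n + 1 - ℓ) := by congr 1; ring
  have e6 : qPochInv u (n + (ℓ + 1)) = qPochInv u (n + 1 + ℓ) := by congr 1; ring
  have e7 : qPoch u (2 * (n + 1)) = qPoch u (2 * n) * (1 - u ^ (2 * n + 1)) *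
      (1 - u ^ (2 * n + 2)) := by
    rw [qPoch, show 2 * (n + 1) = 2 * n + 1 + 1 by ring, Finset.prod_range_succ,
      Finset.prod_range_succ]; rfl
  rw [e3, e4, e5, e6, e1, e2, e7]
  have a1 : u ^ ((n : ℤ) + 1 + ℓ) = u ^ ((n : ℤ) + ℓ) * u := by
    rw [← zpow_add_one₀ hu0]; congr 1; ring
  have a2 : u ^ ((n : ℤ) + 1 - ℓ) = u ^ ((n : ℤ) - ℓ) * u := by
    rw [← zpow_add_one₀ hu0]; congr 1; ring
  have a3 : u ^ ((n : ℤ) + ℓ + 1) = u ^ ((n : ℤ) + ℓ) * u := by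
    rw [← zpow_add_one₀ hu0]
  have a4 : u ^ (2 * n) = u ^ ((n : ℤ) + ℓ) * u ^ ((n : ℤ) - ℓ) := by
    rw [← zpow_add₀ hu0, ← zpow_natCast]; congr 1; push_cast; ring
  rw [pow_succ u (2 * n), pow_add u (2 * n) 2, a1, a2, a3, a4]
  push_cast
  ring

/-- The finite triple product. -/
def tripleProd (u x : ℂ) (n : ℕ) : ℂ :=
  (∏ k ∈ Finset.range n, (1 + u ^ (k + 1) * x)) * ∏ k ∈ Finset.range n, (1 + u ^ k * x⁻¹)

lemma hasSum_tripleProd {u x : ℂ} (hu : ‖u‖ < 1) (hu0 : u ≠ 0) (hx : x ≠ 0) (n : ℕ) :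
    HasSum (fun ℓ : ℤ => u ^ tri ℓ * x ^ ℓ * tripleCoeff u n ℓ) (tripleProd u x n) := by
  induction n with
  | zero =>
    have : tripleProd u x 0 = u ^ tri 0 * x ^ (0 : ℤ) * tripleCoeff u 0 0 := by
      simp [tripleProd, tripleCoeff, qPochInv, qPoch]
    rw [this]
    refine hasSum_single 0 fun ℓ hℓ => ?_
    rcases lt_or_gt_of_ne hℓ with h | h
    · simp [tripleCoeff, qPochInv, not_le.2 h]
    · simp [tripleCoeff, qPochInv, not_le.2 h]
  | succ n ih =>
    have s1 := (Equiv.subRight (1 : ℤ)).hasSum_iff.2 ih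
    have s2 := (Equiv.addRight (1 : ℤ)).hasSum_iff.2 ih
    have key := ((ih.mul_left (1 + u ^ (2 * n + 1))).add (s1.mul_left (u ^ (n + 1) * x))).add
      (s2.mul_left (u ^ n * x⁻¹))
    have hT : tripleProd u x (n + 1) = (1 + u ^ (2 * n + 1)) * tripleProd u x n +
        u ^ (n + 1) * x * tripleProd u x n + u ^ n * x⁻¹ * tripleProd u x n := by
      simp only [tripleProd, Finset.prod_range_succ]
      have : x * x⁻¹ = 1 := mul_inv_cancel₀ hx
      rw [show u ^ (2 * n + 1) = u ^ (n + 1) * u ^ n by ring]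
      linear_combination (∏ k ∈ Finset.range n, (1 + u ^ (k + 1) * x)) *
        (∏ k ∈ Finset.range n, (1 + u ^ k * x⁻¹)) * (u ^ (n + 1) * u ^ n) * this
    rw [hT]
    refine Eq.mpr (congrArg (fun f : ℤ → ℂ => HasSum f _) (funext fun ℓ => ?_)) key
    · simp only [Function.comp_apply, Equiv.coe_addRight, Equiv.subRight_apply]
      rw [tripleCoeff_succ hu hu0]
      have b1 : u ^ tri (ℓ - 1) * u ^ (n + 1) = u ^ tri ℓ * u ^ ((n : ℤ) + 1 - ℓ) := by
        rw [← zpow_natCast, ← zpow_add₀ hu0, ← zpow_add₀ hu0, tri_sub_one]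
        congr 1; push_cast; ring
      have b2 : u ^ tri (ℓ + 1) * u ^ n = u ^ tri ℓ * u ^ ((n : ℤ) + ℓ + 1) := by
        rw [← zpow_natCast, ← zpow_add₀ hu0, ← zpow_add₀ hu0]
        have := tri_sub_one (ℓ + 1)
        rw [add_sub_cancel_right] at this
        congr 1; linarith
      have c1 : x ^ (ℓ - 1) * x = x ^ ℓ := by rw [← zpow_add_one₀ hx]; congr 1; ring
      have c2 : x ^ (ℓ + 1) * x⁻¹ = x ^ ℓ := by rw [← zpow_sub_one₀ hx]; congr 1; ring
      linear_combination (-tripleCoeff u n (ℓ - 1) * x ^ (ℓ - 1) * x) * b1 -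
        (tripleCoeff u n (ℓ - 1) * u ^ tri ℓ * u ^ ((n : ℤ) + 1 - ℓ)) * c1 -
        (tripleCoeff u n (ℓ + 1) * x ^ (ℓ + 1) * x⁻¹) * b2 -
        (tripleCoeff u n (ℓ + 1) * u ^ tri ℓ * u ^ ((n : ℤ) + ℓ + 1)) * c2

lemma tendsto_prod_one_add {f : ℕ → ℂ} (hf : Summable fun n => ‖f n‖) (h0 : ∀ n, 1 + f n ≠ 0) :
    ∃ c ≠ 0, Tendsto (fun n => ∏ k ∈ Finset.range n, (1 + f k)) atTop (𝓝 c) :=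
  ⟨_, tprod_one_add_ne_zero_of_summable h0 hf,
    (multipliable_one_add_of_summable hf).hasProd.tendsto_prod_nat⟩

lemma summable_norm_geometric {u : ℂ} (hu : ‖u‖ < 1) (a : ℂ) (m : ℕ) :
    Summable fun n : ℕ => ‖u ^ (n + m) * a‖ := by
  simp only [norm_mul, norm_pow]
  exact (((summable_nat_add_iff m).2 (summable_geometric_of_lt_one (norm_nonneg u) hu)).mul_right _)

/-- With u = p⁻¹, the finite triple products converge to an infinite product, none of whose factors
vanishes because x is not some -p^k. Their Laurent expansions converge to Theta divided by ∏ (1 -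
u^k). Hence Theta is a nonzero product. -/
theorem theta_ne_zero {p x : ℂ} (hp : 1 < ‖p‖) (hx : x ≠ 0) (h : ∀ k : ℤ, x ≠ -p ^ k) :
    theta p x ≠ 0 := by
  have hp0 : p ≠ 0 := norm_pos_iff.1 (by linarith)
  set u := p⁻¹ with hu_def
  have hu0 : u ≠ 0 := inv_ne_zero hp0
  have hu : ‖u‖ < 1 := by rw [hu_def, norm_inv]; exact inv_lt_one_of_one_lt₀ hp
  obtain ⟨c1, hc1, t1⟩ := tendsto_prod_one_add (f := fun k => u ^ (k + 1) * x)
    (summable_norm_geometric hu x 1) (fun n hn => by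
      refine h (n + 1) ?_
      have : u ^ (n + 1) * p ^ (n + 1) = 1 := by rw [← mul_pow, hu_def, inv_mul_cancel₀ hp0, one_pow]
      have h2 : p ^ ((n : ℤ) + 1) = p ^ (n + 1) := by exact_mod_cast zpow_natCast p (n + 1)
      rw [h2]
      linear_combination p ^ (n + 1) * hn - x * this)
  obtain ⟨c2, hc2, t2⟩ := tendsto_prod_one_add (f := fun k => u ^ k * x⁻¹)
    (summable_norm_geometric hu x⁻¹ 0) (fun n hn => by
      refine h (-n) ?_
      have h2 : p ^ (-(n : ℤ)) = u ^ n := by rw [hu_def, zpow_neg, zpow_natCast, inv_pow]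
      rw [h2]
      have := mul_inv_cancel₀ hx
      linear_combination x * hn - u ^ n * this)
  obtain ⟨c3, hc3, t3⟩ := tendsto_prod_one_add (f := fun k => u ^ (k + 1) * (-1))
    (summable_norm_geometric hu (-1) 1) (fun n hn => one_sub_pow_ne_zero hu n (by
      linear_combination hn))
  have t3' : Tendsto (qPoch u) atTop (𝓝 c3) := by
    refine t3.congr fun n => Finset.prod_congr rfl fun k _ => by ring
  have t4 : Tendsto (fun n : ℕ => (qPoch u n)⁻¹) atTop (𝓝 c3⁻¹) := t3'.inv₀ hc3
  obtain ⟨b1, hb1⟩ := t3'.norm.bddAbove_range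
  obtain ⟨b2, hb2⟩ := t4.norm.bddAbove_range
  have hb1' : ∀ n, ‖qPoch u n‖ ≤ b1 := fun n => hb1 ⟨n, rfl⟩
  have hb2' : ∀ n, ‖(qPoch u n)⁻¹‖ ≤ b2 := fun n => hb2 ⟨n, rfl⟩
  have hb1n : 0 ≤ b1 := (norm_nonneg _).trans (hb1' 0)
  have hb2n : 0 ≤ b2 := (norm_nonneg _).trans (hb2' 0)
  have hw : ∀ k, ‖qPochInv u k‖ ≤ b2 := by
    intro k
    unfold qPochInv
    split_ifs
    · exact hb2' _
    · simpa using hb2n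
  have tw : ∀ ℓ : ℤ, Tendsto (fun n : ℕ => qPochInv u (n + ℓ)) atTop (𝓝 c3⁻¹) := by
    intro ℓ
    have ht : Tendsto (fun n : ℕ => ((n : ℤ) + ℓ).toNat) atTop atTop := by
      refine tendsto_atTop.2 fun b => ?_
      filter_upwards [eventually_ge_atTop (b + ℓ.natAbs)] with n hn
      omega
    refine (t4.comp ht).congr' ?_
    filter_upwards [eventually_ge_atTop ℓ.natAbs] with n hn
    simp only [qPochInv, Function.comp_apply]
    rw [if_pos (by omega)]
  -- Dominated convergence over ℓ: the Gaussian coefficients are bounded uniformly in n and ℓ by b1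
  -- * b2 * b2 and tend to c3⁻¹, while the Theta series itself is the majorant.
  have key : Tendsto (fun n : ℕ => ∑' ℓ : ℤ, u ^ tri ℓ * x ^ ℓ * tripleCoeff u n ℓ) atTop
      (𝓝 (∑' ℓ : ℤ, u ^ tri ℓ * x ^ ℓ * (c3 * c3⁻¹ * c3⁻¹))) := by
    refine tendsto_tsum_of_dominated_convergence
      (bound := fun ℓ : ℤ => ‖p ^ (-tri ℓ) * x ^ ℓ‖ * (b1 * b2 * b2)) ?_ ?_ ?_
    · exact (summable_theta hp hx).norm.mul_right _
    · intro ℓ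
      refine Tendsto.mul tendsto_const_nhds ((Tendsto.mul ?_ (tw ℓ)).mul ?_)
      · exact t3'.comp (tendsto_id.const_mul_atTop' (by norm_num))
      · simpa [sub_eq_add_neg] using tw (-ℓ)
    · refine Eventually.of_forall fun n ℓ => ?_
      have e : u ^ tri ℓ * x ^ ℓ = p ^ (-tri ℓ) * x ^ ℓ := by rw [hu_def, inv_zpow']
      rw [norm_mul, e, tripleCoeff, norm_mul (qPoch u (2 * n) * _), norm_mul (qPoch u (2 * n))]
      exact mul_le_mul_of_nonneg_left (mul_le_mul (mul_le_mul (hb1' _) (hw _) (norm_nonneg _) hb1n)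
        (hw _) (norm_nonneg _) (by positivity)) (norm_nonneg _)
  have key2 : Tendsto (fun n : ℕ => tripleProd u x n) atTop (𝓝 (c1 * c2)) := t1.mul t2
  simp only [fun n => (hasSum_tripleProd hu hu0 hx n).tsum_eq] at key
  have := tendsto_nhds_unique key key2
  rw [tsum_mul_right] at this
  intro h0
  refine mul_ne_zero hc1 hc2 (this ▸ ?_)
  have : theta p x = ∑' ℓ : ℤ, u ^ tri ℓ * x ^ ℓ := by
    refine tsum_congr fun ℓ => ?_
    rw [hu_def, inv_zpow']; rfl
  rw [← this, h0, zero_mul]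

end TripleProduct

/-! ### Analyticity and lower bounds -/

/-- Supplies a Weierstrass majorant on an annulus for positive and negative powers at once. -/
lemma zpow_le_add_zpow {r₁ r₂ x : ℝ} (h1 : 0 < r₁) (hx1 : r₁ ≤ x) (hx2 : x ≤ r₂) (ℓ : ℤ) :
    x ^ ℓ ≤ r₁ ^ ℓ + r₂ ^ ℓ := by
  have hx : 0 < x := h1.trans_le hx1
  have h2 : 0 < r₂ := hx.trans_le hx2
  rcases le_total 0 ℓ with h | h
  · have := zpow_le_zpow_left₀ h hx.le hx2
    have : 0 < r₁ ^ ℓ := by positivity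
    linarith
  · have h3 : x ^ ℓ ≤ r₁ ^ ℓ := by
      obtain ⟨m, rfl⟩ : ∃ m, ℓ = -m := ⟨-ℓ, by ring⟩
      rw [zpow_neg, zpow_neg]
      exact inv_anti₀ (by positivity) (zpow_le_zpow_left₀ (by omega) h1.le hx1)
    have : 0 < r₂ ^ ℓ := by positivity
    linarith

lemma isOpen_annulus (r₁ r₂ : ℝ) : IsOpen {x : ℂ | r₁ < ‖x‖ ∧ ‖x‖ < r₂} :=
  (isOpen_lt continuous_const continuous_norm).inter (isOpen_lt continuous_norm continuous_const)

/-- A Laurent series that converges absolutely in `0 < |z| < R` is analytic there. -/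
lemma analyticAt_laurent {c : ℤ → ℂ} {R : ℝ}
    (hc : ∀ r : ℝ, 0 < r → r < R → Summable fun ℓ : ℤ => ‖c ℓ‖ * r ^ ℓ) {x : ℂ} (hx : x ≠ 0)
    (hxR : ‖x‖ < R) : AnalyticAt ℂ (fun x => ∑' ℓ : ℤ, c ℓ * x ^ ℓ) x := by
  have hx' : 0 < ‖x‖ := norm_pos_iff.2 hx
  obtain ⟨r, hr1, hr2⟩ := exists_between hxR
  have hU : {y : ℂ | ‖x‖ / 2 < ‖y‖ ∧ ‖y‖ < r} ∈ 𝓝 x :=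
    (isOpen_annulus _ _).mem_nhds ⟨by linarith, hr1⟩
  refine DifferentiableOn.analyticAt (s := {y : ℂ | ‖x‖ / 2 < ‖y‖ ∧ ‖y‖ < r}) ?_ hU
  refine Complex.differentiableOn_tsum_of_summable_norm
    (u := fun ℓ => ‖c ℓ‖ * (‖x‖ / 2) ^ ℓ + ‖c ℓ‖ * r ^ ℓ) ?_ ?_ (isOpen_annulus _ _) ?_
  · exact (hc _ (by positivity) (by linarith)).add (hc _ (hx'.trans hr1) hr2)
  · intro ℓ y hy
    have hy0 : y ≠ 0 := norm_pos_iff.1 ((by positivity : (0 : ℝ) < ‖x‖ / 2).trans hy.1)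
    exact ((differentiableAt_zpow.2 (Or.inl hy0)).const_mul _).differentiableWithinAt
  · intro ℓ y hy
    rw [norm_mul, norm_zpow, ← mul_add]
    exact mul_le_mul_of_nonneg_left
      (zpow_le_add_zpow (by positivity) hy.1.le hy.2.le ℓ) (norm_nonneg _)

lemma analyticAt_theta {p x : ℂ} (hp : 1 < ‖p‖) (hx : x ≠ 0) : AnalyticAt ℂ (theta p) x := by
  refine analyticAt_laurent (c := fun ℓ => p ^ (-tri ℓ)) (R := ‖x‖ + 1) (fun r hr _ => ?_) hx
    (by linarith)
  simpa [norm_zpow] using summable_theta_real hp hr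

lemma thetaR_le {P x : ℝ} (hP : 1 < P) (h1 : 1 ≤ x) (h2 : x ≤ P) :
    thetaR P x ≤ thetaR P 1 + thetaR P P := by
  have hP0 : 0 < P := by linarith
  have hx : 0 < x := by linarith
  rw [thetaR, thetaR, thetaR, ← (summable_theta_real hP one_pos).tsum_add
    (summable_theta_real hP hP0)]
  refine (summable_theta_real hP hx).tsum_le_tsum (fun ℓ => ?_)
    ((summable_theta_real hP one_pos).add (summable_theta_real hP hP0))
  rw [← mul_add]
  exact mul_le_mul_of_nonneg_left (zpow_le_add_zpow one_pos h1 h2 ℓ) (by positivity)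

/-- Away from its zeros, the modulus of the Theta function is comparable to the Theta function of
the moduli. -/
theorem exists_le_norm_theta {p : ℂ} (hp : 1 < ‖p‖) {ε : ℝ} (hε : 0 < ε) :
    ∃ c : ℝ, 0 < c ∧ ∀ x : ℂ, x ≠ 0 → (∀ k : ℤ, ε * ‖x‖ ≤ ‖x + p ^ k‖) → ∀ k : ℤ,
      c * (‖p‖ ^ (-tri k) * ‖x‖ ^ k) ≤ ‖theta p x‖ := by
  have hp0 : p ≠ 0 := norm_pos_iff.1 (by linarith)
  have hP0 : 0 < ‖p‖ := by linarith
  -- S is compact and contains no zero of Theta, so |Theta| has a positive minimum there. The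
  -- condition on ε is invariant under multiplication by powers of p, so every admissible x can be
  -- brought into S.
  set S : Set ℂ := {y | 1 ≤ ‖y‖ ∧ ‖y‖ ≤ ‖p‖ ∧ ∀ k : ℤ, ε * ‖y‖ ≤ ‖y + p ^ k‖} with hS
  have hcl : IsClosed S := by
    have : S = {y | 1 ≤ ‖y‖} ∩ ({y | ‖y‖ ≤ ‖p‖} ∩ ⋂ k : ℤ, {y | ε * ‖y‖ ≤ ‖y + p ^ k‖}) := by
      ext y; simp [hS]
    rw [this]
    refine (isClosed_le continuous_const continuous_norm).inter
      ((isClosed_le continuous_norm continuous_const).inter (isClosed_iInter fun k => ?_))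
    exact isClosed_le (by fun_prop) (by fun_prop)
  have hcomp : IsCompact S := by
    refine Metric.isCompact_of_isClosed_isBounded hcl ?_
    refine (Metric.isBounded_closedBall (x := (0 : ℂ)) (r := ‖p‖)).subset fun y hy => ?_
    simpa using hy.2.1
  have hne : ∀ y ∈ S, theta p y ≠ 0 := by
    intro y hy
    have hy0 : 0 < ‖y‖ := by linarith [hy.1]
    refine theta_ne_zero hp (norm_pos_iff.1 hy0) fun k hk => ?_
    have h1 := hy.2.2 k
    rw [hk] at h1
    simp only [neg_add_cancel, norm_zero, norm_neg] at h1
    have : 0 < ε * ‖p ^ k‖ := mul_pos hε (norm_pos_iff.2 (zpow_ne_zero _ hp0))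
    linarith
  obtain ⟨c0, hc0, hc0'⟩ : ∃ c0 : ℝ, 0 < c0 ∧ ∀ y ∈ S, c0 ≤ ‖theta p y‖ := by
    have hcont : ContinuousOn (fun y => ‖theta p y‖) S := fun y hy =>
      (analyticAt_theta hp (norm_pos_iff.1 (by linarith [hy.1]))).continuousAt.norm.continuousWithinAt
    rcases S.eq_empty_or_nonempty with h | h
    · exact ⟨1, one_pos, by simp [h]⟩
    · obtain ⟨y, hy, hmin⟩ := hcomp.exists_isMinOn h hcont
      exact ⟨_, norm_pos_iff.2 (hne y hy), fun z hz => hmin hz⟩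
  set C := thetaR ‖p‖ 1 + thetaR ‖p‖ ‖p‖
  have hC : 0 < C := add_pos (thetaR_pos hp one_pos) (thetaR_pos hp hP0)
  refine ⟨c0 / C, by positivity, fun x hx hxk k => ?_⟩
  have hx0 : 0 < ‖x‖ := norm_pos_iff.2 hx
  refine (mul_le_mul_of_nonneg_left (le_thetaR hp hx0 k) (by positivity)).trans ?_
  -- Under x = p^m y the functional equation gives |Theta p x| and `thetaR ‖p‖ ‖x‖` the same factor,
  -- so the comparison on the annulus is enough.
  obtain ⟨m, hm1, hm2⟩ := exists_mem_Ico_zpow hx0 hp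
  set y := p ^ (-m) * x with hy
  have hpm : 0 < ‖p‖ ^ m := by positivity
  have hny : ‖y‖ = ‖x‖ / ‖p‖ ^ m := by
    rw [hy, norm_mul, norm_zpow, zpow_neg]; field_simp
  have hxy : x = p ^ m * y := by
    rw [hy, ← mul_assoc, ← zpow_add₀ hp0]; simp
  have hyS : y ∈ S := by
    refine ⟨?_, ?_, fun j => ?_⟩
    · rw [hny, le_div_iff₀ hpm]; linarith
    · rw [hny, div_le_iff₀ hpm]
      rw [zpow_add_one₀ hP0.ne'] at hm2
      linarith
    · have h1 := hxk (m + j)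
      rw [zpow_add₀ hp0, show x + p ^ m * p ^ j = p ^ m * (y + p ^ j) by rw [mul_add, ← hxy],
        norm_mul, norm_zpow, show ‖x‖ = ‖p‖ ^ m * ‖y‖ by rw [hny]; field_simp] at h1
      have : ‖p‖ ^ m * (ε * ‖y‖) ≤ ‖p‖ ^ m * ‖y + p ^ j‖ := by linarith
      exact le_of_mul_le_mul_left this hpm
  have hy0 : 0 < ‖y‖ := by linarith [hyS.1]
  have e1 : thetaR ‖p‖ ‖x‖ = ‖p‖ ^ tri (m - 1) * ‖y‖ ^ m * thetaR ‖p‖ ‖y‖ := by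
    rw [← thetaR_zpow_mul hP0 hy0, hxy, norm_mul, norm_zpow]
  have e2 : ‖theta p x‖ = ‖p‖ ^ tri (m - 1) * ‖y‖ ^ m * ‖theta p y‖ := by
    rw [hxy, theta_zpow_mul hp0 (norm_pos_iff.1 hy0), norm_mul, norm_mul, norm_zpow, norm_zpow]
  rw [e1, e2, ← mul_assoc, mul_comm (c0 / C), mul_assoc]
  refine mul_le_mul_of_nonneg_left ?_ (by positivity)
  calc c0 / C * thetaR ‖p‖ ‖y‖ ≤ c0 / C * C :=
        mul_le_mul_of_nonneg_left (thetaR_le hp hyS.1 hyS.2.1) (by positivity)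
    _ = c0 := by field_simp
    _ ≤ _ := hc0' y hyS

end QDiff

end

/-! ### Discrete spirals, spiral-shaped domains, and the identity theorem -/

noncomputable section

namespace QDiff

/-! ### Discrete spirals -/

/-- The union of the discrete spirals `ρ Q ^ ℤ`, `ρ ∈ s`. -/
def spirals (Q : ℂ) (s : Finset ℂ) : Set ℂ := {z | ∃ ρ ∈ s, ∃ ℓ : ℤ, z = Q ^ ℓ * ρ}

/-- The complement of the spirals in `ℂ*`. -/
def regular (Q : ℂ) (s : Finset ℂ) : Set ℂ := {z | z ≠ 0 ∧ z ∉ spirals Q s}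

variable {Q : ℂ} {s : Finset ℂ}

lemma ne_zero_of_one_lt_norm {Q : ℂ} (hQ : 1 < ‖Q‖) : Q ≠ 0 := norm_pos_iff.1 (by linarith)

lemma zpow_mul_mem_spirals (hQ : 1 < ‖Q‖) (k : ℤ) (z : ℂ) :
    Q ^ k * z ∈ spirals Q s ↔ z ∈ spirals Q s := by
  have hQ0 := ne_zero_of_one_lt_norm hQ
  constructor
  · rintro ⟨ρ, hρ, ℓ, h⟩
    refine ⟨ρ, hρ, -k + ℓ, ?_⟩
    rw [zpow_add₀ hQ0, mul_assoc, ← h, ← mul_assoc, ← zpow_add₀ hQ0]; simp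
  · rintro ⟨ρ, hρ, ℓ, h⟩
    exact ⟨ρ, hρ, k + ℓ, by rw [zpow_add₀ hQ0, mul_assoc, ← h]⟩

lemma zpow_mul_mem_regular (hQ : 1 < ‖Q‖) (k : ℤ) (z : ℂ) :
    Q ^ k * z ∈ regular Q s ↔ z ∈ regular Q s := by
  simp [regular, zpow_mul_mem_spirals hQ, zpow_ne_zero k (ne_zero_of_one_lt_norm hQ)]

lemma countable_spirals : (spirals Q s).Countable := by
  have : spirals Q s = ⋃ ρ ∈ s, Set.range fun ℓ : ℤ => Q ^ ℓ * ρ := by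
    ext z; simp [spirals, eq_comm]
  rw [this]
  exact s.countable_toSet.biUnion fun ρ _ => Set.countable_range _

lemma finite_zpow_between {P : ℝ} (hP : 1 < P) {a b : ℝ} (ha : 0 < a) :
    {ℓ : ℤ | a ≤ P ^ ℓ ∧ P ^ ℓ ≤ b}.Finite := by
  obtain ⟨n, hn⟩ := pow_unbounded_of_one_lt b hP
  obtain ⟨m, hm⟩ := pow_unbounded_of_one_lt a⁻¹ hP
  have hP0 : 0 < P := by linarith
  refine (Set.finite_Icc (-(m : ℤ)) n).subset fun ℓ hℓ => ⟨?_, ?_⟩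
  · by_contra h
    push Not at h
    have h1 := zpow_lt_zpow_right₀ hP h
    rw [zpow_neg, zpow_natCast] at h1
    have h2 : (P ^ m)⁻¹ < a := inv_lt_of_inv_lt₀ ha hm
    linarith [hℓ.1]
  · by_contra h
    push Not at h
    have h1 := zpow_lt_zpow_right₀ hP h
    rw [zpow_natCast] at h1
    linarith [hℓ.2]

/-- Only finitely many exponents give a modulus comparable to that of z, so the spirals accumulate
at no point of ℂ*. -/
lemma eventually_notMem_spirals (hQ : 1 < ‖Q‖) (hs : (0 : ℂ) ∉ s) {z : ℂ} (hz : z ≠ 0) :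
    ∀ᶠ w in 𝓝[≠] z, w ∉ spirals Q s := by
  have hz' : 0 < ‖z‖ := norm_pos_iff.2 hz
  have hfin : (spirals Q s ∩ Metric.ball z (‖z‖ / 2)).Finite := by
    have : spirals Q s ∩ Metric.ball z (‖z‖ / 2) ⊆ ⋃ ρ ∈ s, (fun ℓ : ℤ => Q ^ ℓ * ρ) ''
        {ℓ : ℤ | ‖z‖ / 2 / ‖ρ‖ ≤ ‖Q‖ ^ ℓ ∧ ‖Q‖ ^ ℓ ≤ 2 * ‖z‖ / ‖ρ‖} := by
      rintro w ⟨⟨ρ, hρ, ℓ, rfl⟩, hw⟩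
      have hρ0 : 0 < ‖ρ‖ := norm_pos_iff.2 fun h => hs (h ▸ hρ)
      simp only [Set.mem_iUnion]
      refine ⟨ρ, hρ, ℓ, ⟨?_, ?_⟩, rfl⟩
      · rw [div_le_iff₀ hρ0, ← norm_zpow, ← norm_mul]
        rw [Metric.mem_ball, dist_comm, dist_eq_norm] at hw
        have := norm_sub_norm_le z (Q ^ ℓ * ρ)
        linarith
      · rw [le_div_iff₀ hρ0, ← norm_zpow, ← norm_mul]
        rw [Metric.mem_ball, dist_eq_norm] at hw
        have := norm_sub_norm_le (Q ^ ℓ * ρ) z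
        linarith
    refine Set.Finite.subset (Set.Finite.biUnion s.finite_toSet fun ρ hρ => ?_) this
    have hρ0 : 0 < ‖ρ‖ := norm_pos_iff.2 fun h => hs (h ▸ hρ)
    exact (finite_zpow_between hQ (by positivity)).image _
  have h1 : ((spirals Q s ∩ Metric.ball z (‖z‖ / 2)) \ {z})ᶜ ∈ 𝓝 z :=
    (hfin.subset Set.sdiff_subset).isClosed.isOpen_compl.mem_nhds (by simp)
  filter_upwards [mem_nhdsWithin_of_mem_nhds h1, self_mem_nhdsWithin,
    mem_nhdsWithin_of_mem_nhds (Metric.ball_mem_nhds z (half_pos hz'))] with w hw1 hw2 hw3 hw4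
  exact hw1 ⟨⟨hw4, hw3⟩, hw2⟩

lemma eventually_mem_regular (hQ : 1 < ‖Q‖) (hs : (0 : ℂ) ∉ s) {z : ℂ} (hz : z ≠ 0) :
    ∀ᶠ w in 𝓝[≠] z, w ∈ regular Q s := by
  filter_upwards [eventually_notMem_spirals hQ hs hz,
    mem_nhdsWithin_of_mem_nhds (isOpen_ne.mem_nhds hz)] with w h1 h2
  exact ⟨h2, h1⟩

lemma isOpen_regular (hQ : 1 < ‖Q‖) (hs : (0 : ℂ) ∉ s) : IsOpen (regular Q s) := by
  refine isOpen_iff_mem_nhds.2 fun z hz => ?_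
  have := eventually_mem_regular hQ hs hz.1
  rw [eventually_nhdsWithin_iff] at this
  filter_upwards [this] with w hw
  by_cases h : w = z
  · exact h ▸ hz
  · exact hw h

/-- The complement of a countable set in the plane is path connected. -/
lemma isPathConnected_regular : IsPathConnected (regular Q s) := by
  have : regular Q s = (insert 0 (spirals Q s))ᶜ := by
    ext z; simp [regular]
  rw [this]
  exact (countable_spirals.insert 0).isPathConnected_compl_of_one_lt_rank
    (by simp)

/-! ### A spiral-shaped domain -/

/-- `U` is a bounded connected open set, at a positive distance of `0` and of the spirals, that
contains `lam` and `Q lam`. -/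
structure IsFundamental (Q : ℂ) (s : Finset ℂ) (lam : ℂ) (U : Set ℂ) : Prop where
  isOpen : IsOpen U
  isConnected : IsConnected U
  mem : lam ∈ U
  mul_mem : Q * lam ∈ U
  bounds : ∃ m M : ℝ, 0 < m ∧ ∀ z ∈ U, m ≤ ‖z‖ ∧ ‖z‖ ≤ M
  dist : ∃ δ : ℝ, 0 < δ ∧ ∀ z ∈ U, ∀ b ∈ spirals Q s, δ * ‖z‖ ≤ ‖z - b‖

lemma isPreconnected_thickening {C : Set ℂ} (hC : IsConnected C) {δ : ℝ} (hδ : 0 < δ) :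
    IsConnected (Metric.thickening δ C) := by
  have : Metric.thickening δ C = (fun x : ℂ × ℂ => x.1 + x.2) '' (C ×ˢ Metric.ball 0 δ) := by
    ext z
    simp only [Metric.mem_thickening_iff, Set.mem_image, Set.mem_prod, Prod.exists]
    constructor
    · rintro ⟨c, hc, h⟩
      exact ⟨c, z - c, ⟨hc, by simpa [dist_eq_norm] using h⟩, by ring⟩
    · rintro ⟨c, v, ⟨hc, hv⟩, rfl⟩
      exact ⟨c, hc, by simpa [dist_eq_norm] using hv⟩
  rw [this]
  refine (hC.prod ⟨⟨0, by simpa⟩, (convex_ball _ _).isPreconnected⟩).image _ ?_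
  fun_prop

/-- A thin neighbourhood of a path from lam to Q lam that avoids 0 and the spirals. Its translates
by powers of Q form the domain on which continuations are exhibited. -/
lemma exists_isFundamental (hQ : 1 < ‖Q‖) (hs : (0 : ℂ) ∉ s) {lam : ℂ} (hl : lam ∈ regular Q s) :
    ∃ U, IsFundamental Q s lam U := by
  have hl2 : Q * lam ∈ regular Q s := by
    simpa using (zpow_mul_mem_regular hQ 1 lam).2 hl
  obtain ⟨γ, hγ⟩ := isPathConnected_regular.joinedIn _ hl _ hl2
  have hC : IsCompact (Set.range γ) := isCompact_range γ.continuous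
  have hCc : IsConnected (Set.range γ) := isConnected_range γ.continuous
  obtain ⟨δ, hδ, hδ2⟩ := hC.exists_cthickening_subset_open (isOpen_regular hQ hs)
    (Set.range_subset_iff.2 hγ)
  -- Thickening by only half of δ keeps a margin δ / 2 from every non-regular point, 0 included.
  have hfar : ∀ z ∈ Metric.thickening (δ / 2) (Set.range γ), ∀ b, b ∉ regular Q s →
      δ / 2 ≤ ‖z - b‖ := by
    intro z hz b hb
    by_contra h
    push Not at h
    obtain ⟨c, hc, hzc⟩ := Metric.mem_thickening_iff.1 hz
    refine hb (hδ2 (Metric.thickening_subset_cthickening _ _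
      (Metric.mem_thickening_iff.2 ⟨c, hc, ?_⟩)))
    have := dist_triangle b z c
    rw [dist_comm b z, dist_eq_norm z b] at this
    linarith
  obtain ⟨M, hM⟩ := (hC.isBounded.thickening (δ := δ / 2)).exists_norm_le
  have hm : ∀ z ∈ Metric.thickening (δ / 2) (Set.range γ), δ / 2 ≤ ‖z‖ := by
    intro z hz
    simpa using hfar z hz 0 (by simp [regular])
  have hmem : lam ∈ Metric.thickening (δ / 2) (Set.range γ) :=
    Metric.self_subset_thickening (half_pos hδ) _ ⟨0, by simp⟩
  refine ⟨Metric.thickening (δ / 2) (Set.range γ), Metric.isOpen_thickening,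
    isPreconnected_thickening hCc (half_pos hδ), hmem,
    Metric.self_subset_thickening (half_pos hδ) _ ⟨1, by simp⟩,
    ⟨δ / 2, M, half_pos hδ, fun z hz => ⟨hm z hz, hM z hz⟩⟩, ?_⟩
  have hM0 : 0 < M := (half_pos hδ).trans_le ((hm _ hmem).trans (hM _ hmem))
  refine ⟨δ / 2 / M, by positivity, fun z hz b hb => ?_⟩
  refine le_trans ?_ (hfar z hz b fun h => h.2 hb)
  rw [div_mul_eq_mul_div, div_le_iff₀ hM0]
  exact mul_le_mul_of_nonneg_left (hM z hz) (half_pos hδ).le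

/-- The union of the sets `Q ^ ℓ U`, `ℓ ∈ ℤ`. -/
def orbit (Q : ℂ) (U : Set ℂ) : Set ℂ := {z | ∃ ℓ : ℤ, ∃ u ∈ U, z = Q ^ ℓ * u}

lemma orbit_eq_iUnion (Q : ℂ) (U : Set ℂ) : orbit Q U = ⋃ ℓ : ℤ, (fun u => Q ^ ℓ * u) '' U := by
  ext z; simp [orbit, eq_comm]

namespace IsFundamental

variable {lam : ℂ} {U : Set ℂ}

lemma isOpen_orbit (hU : IsFundamental Q s lam U) (hQ : 1 < ‖Q‖) : IsOpen (orbit Q U) := by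
  rw [orbit_eq_iUnion]
  exact isOpen_iUnion fun ℓ =>
    (Homeomorph.mulLeft₀ _ (zpow_ne_zero ℓ (ne_zero_of_one_lt_norm hQ))).isOpenMap _ hU.isOpen

/-- Consecutive translates Q^ℓ U and Q^(ℓ+1) U share the point Q^(ℓ+1) lam. -/
lemma isConnected_orbit (hU : IsFundamental Q s lam U) (hQ : 1 < ‖Q‖) :
    IsConnected (orbit Q U) := by
  rw [orbit_eq_iUnion]
  refine IsConnected.iUnion_of_chain
    (fun ℓ => hU.isConnected.image _ (by fun_prop)) fun ℓ => ⟨Q ^ ℓ * (Q * lam), ?_, ?_⟩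
  · exact ⟨_, hU.mul_mem, rfl⟩
  · refine ⟨lam, hU.mem, ?_⟩
    simp only [Order.succ_eq_add_one]
    rw [zpow_add_one₀ (ne_zero_of_one_lt_norm hQ), mul_assoc]

lemma exists_discs (hU : IsFundamental Q s lam U) (hQ : 1 < ‖Q‖) :
    ∃ ε : ℝ, 0 < ε ∧ ∀ (ℓ : ℤ) (z : ℂ), ‖z - Q ^ ℓ * lam‖ < ε * ‖Q ^ ℓ * lam‖ →
      z ∈ orbit Q U := by
  have hQ0 := ne_zero_of_one_lt_norm hQ
  obtain ⟨m, M, hm, hb⟩ := hU.bounds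
  have hl : 0 < ‖lam‖ := hm.trans_le (hb _ hU.mem).1
  obtain ⟨r, hr, hr2⟩ := Metric.isOpen_iff.1 hU.isOpen lam hU.mem
  refine ⟨r / ‖lam‖, by positivity, fun ℓ z hz => ⟨ℓ, Q ^ (-ℓ) * z, hr2 ?_, ?_⟩⟩
  · rw [Metric.mem_ball, dist_eq_norm]
    have e : z - Q ^ ℓ * lam = Q ^ ℓ * (Q ^ (-ℓ) * z - lam) := by
      rw [mul_sub, ← mul_assoc, ← zpow_add₀ hQ0]; simp
    have hp : 0 < ‖Q ^ ℓ‖ := norm_pos_iff.2 (zpow_ne_zero _ hQ0)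
    rw [e, norm_mul, norm_mul] at hz
    have : ‖Q ^ ℓ‖ * ‖Q ^ (-ℓ) * z - lam‖ < ‖Q ^ ℓ‖ * r := by
      refine hz.trans_eq ?_
      field_simp
    exact lt_of_mul_lt_mul_left this hp.le
  · rw [← mul_assoc, ← zpow_add₀ hQ0]; simp

lemma dist_orbit (hU : IsFundamental Q s lam U) (hQ : 1 < ‖Q‖) :
    ∃ δ : ℝ, 0 < δ ∧ ∀ z ∈ orbit Q U, ∀ b ∈ spirals Q s, δ * ‖z‖ ≤ ‖z - b‖ := by
  have hQ0 := ne_zero_of_one_lt_norm hQ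
  obtain ⟨δ, hδ, h⟩ := hU.dist
  refine ⟨δ, hδ, ?_⟩
  rintro z ⟨ℓ, u, hu, rfl⟩ b hb
  have h1 := h u hu (Q ^ (-ℓ) * b) ((zpow_mul_mem_spirals hQ _ _).2 hb)
  have e : Q ^ ℓ * u - b = Q ^ ℓ * (u - Q ^ (-ℓ) * b) := by
    rw [mul_sub, ← mul_assoc, ← zpow_add₀ hQ0]; simp
  rw [e, norm_mul, norm_mul]
  have := mul_le_mul_of_nonneg_left h1 (norm_nonneg (Q ^ ℓ))
  linarith

lemma orbit_subset_regular (hU : IsFundamental Q s lam U) (hQ : 1 < ‖Q‖) :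
    orbit Q U ⊆ regular Q s := by
  have hQ0 := ne_zero_of_one_lt_norm hQ
  obtain ⟨m, M, hm, hb⟩ := hU.bounds
  obtain ⟨δ, hδ, h⟩ := hU.dist
  rintro z ⟨ℓ, u, hu, rfl⟩
  rw [zpow_mul_mem_regular hQ]
  have hu0 : 0 < ‖u‖ := hm.trans_le (hb u hu).1
  refine ⟨norm_pos_iff.1 hu0, fun hmem => ?_⟩
  have := h u hu u hmem
  rw [sub_self, norm_zero] at this
  have : 0 < δ * ‖u‖ := by positivity
  linarith

end IsFundamental

/-! ### Identity theorems -/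

lemma isPreconnected_punctured_ball (z : ℂ) (r : ℝ) :
    IsPreconnected (Metric.ball z r \ {z}) := by
  have : Metric.ball z r \ {z} =
      (fun x : ℝ × ℂ => z + x.1 * x.2) '' (Set.Ioo 0 r ×ˢ Metric.sphere 0 1) := by
    ext w
    simp only [Set.mem_sdiff, Metric.mem_ball, Set.mem_singleton_iff, Set.mem_image, Set.mem_prod,
      Set.mem_Ioo, mem_sphere_iff_norm, sub_zero, Prod.exists, dist_eq_norm]
    constructor
    · rintro ⟨h1, h2⟩
      have h3 : 0 < ‖w - z‖ := norm_pos_iff.2 (sub_ne_zero.2 h2)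
      have h4 : (‖w - z‖ : ℂ) ≠ 0 := by exact_mod_cast h3.ne'
      refine ⟨‖w - z‖, (w - z) / ‖w - z‖, ⟨⟨h3, h1⟩, ?_⟩, ?_⟩
      · rw [norm_div, Complex.norm_real, norm_norm, div_self h3.ne']
      · rw [mul_div_cancel₀ _ h4]; ring
    · rintro ⟨t, v, ⟨⟨h1, h2⟩, h3⟩, rfl⟩
      have : ‖z + t * v - z‖ = t := by
        rw [add_sub_cancel_left, norm_mul, h3, Complex.norm_real, Real.norm_of_nonneg h1.le, mul_one]
      refine ⟨by rw [this]; exact h2, fun h => ?_⟩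
      rw [h, sub_self, norm_zero] at this
      linarith
  rw [this]
  exact (isPreconnected_Ioo.prod (isPreconnected_sphere (by simp) 0 1)).image _ (by fun_prop)

/-- Two analytic functions, one of which may be singular on the spirals, agree on a connected
domain if they agree near `0`. -/
theorem eqOn_of_agree_near_zero (hQ : 1 < ‖Q‖) (hs : (0 : ℂ) ∉ s) {F g : ℂ → ℂ} {Ω : Set ℂ}
    (hΩ : IsOpen Ω) (hΩc : IsPreconnected Ω) (hF : AnalyticOnNhd ℂ F (regular Q s))
    (hg : AnalyticOnNhd ℂ g Ω)
    (hagree : ∀ᶠ z in 𝓝[≠] (0 : ℂ), z ∈ Ω → z ∈ regular Q s → F z = g z)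
    (hfreq : ∃ᶠ z in 𝓝[≠] (0 : ℂ), z ∈ Ω ∧ z ∈ regular Q s) :
    ∀ z ∈ Ω, z ∈ regular Q s → F z = g z := by
  have hreg := isOpen_regular hQ hs
  -- T and V partition Ω according to whether F and g agree at the regular points near z. Both are
  -- open, and agreement near 0 makes T nonempty, so connectedness of Ω excludes V. The origin, if
  -- it lies in Ω, belongs to T by hypothesis.
  set T : Set ℂ := {z | z ∈ Ω ∧ ∀ᶠ w in 𝓝[≠] z, w ∈ regular Q s → F w = g w} with hT
  set V : Set ℂ := {z | z ∈ Ω ∧ ¬ ∀ᶠ w in 𝓝[≠] z, w ∈ regular Q s → F w = g w} with hV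
  have h0 : ∀ z ∈ Ω, z = 0 → z ∈ T := by
    rintro z hz rfl
    refine ⟨hz, ?_⟩
    filter_upwards [hagree, mem_nhdsWithin_of_mem_nhds (hΩ.mem_nhds hz)] with w h1 h2 h3
    exact h1 h2 h3
  have hTo : IsOpen T := by
    refine isOpen_iff_mem_nhds.2 fun z hz => ?_
    have h1 := hz.2
    rw [eventually_nhdsWithin_iff] at h1
    filter_upwards [eventually_eventually_nhds.2 h1, hΩ.mem_nhds hz.1] with w hw1 hw2
    refine ⟨hw2, ?_⟩
    by_cases hwz : w = z
    · exact hwz ▸ hz.2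
    · filter_upwards [mem_nhdsWithin_of_mem_nhds hw1,
        mem_nhdsWithin_of_mem_nhds (isOpen_ne.mem_nhds hwz)] with x h2 h3
      exact h2 h3
  have hVo : IsOpen V := by
    refine isOpen_iff_mem_nhds.2 fun z hz => ?_
    have hz0 : z ≠ 0 := fun h => hz.2 (h0 z hz.1 h).2
    have h1 := eventually_mem_regular hQ hs hz0 (s := s)
    rw [eventually_nhdsWithin_iff] at h1
    obtain ⟨r, hr, hball⟩ := Metric.mem_nhds_iff.1 (inter_mem h1 (hΩ.mem_nhds hz.1))
    filter_upwards [Metric.ball_mem_nhds z hr] with w hw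
    refine ⟨(hball hw).2, fun hcontra => ?_⟩
    by_cases hwz : w = z
    · exact hz.2 (hwz ▸ hcontra)
    -- A small punctured disc around a nonzero point is regular and connected, even if its centre is
    -- on a spiral. Agreement near one of its points would therefore reach the centre.
    · have hsub : Metric.ball z r \ {z} ⊆ regular Q s := fun x hx => (hball hx.1).1 hx.2
      have hwreg : w ∈ regular Q s := hsub ⟨hw, hwz⟩
      have hev : F =ᶠ[𝓝 w] g := by
        refine ((hF w hwreg).continuousAt.eventuallyEq_nhds_iff_eventuallyEq_nhdsNE
          (hg w (hball hw).2).continuousAt).1 ?_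
        filter_upwards [hcontra, mem_nhdsWithin_of_mem_nhds (hreg.mem_nhds hwreg)] with x h2 h3
        exact h2 h3
      have heq := AnalyticOnNhd.eqOn_of_preconnected_of_eventuallyEq
        (fun x hx => hF x (hsub hx)) (fun x hx => hg x (hball hx.1).2)
        (isPreconnected_punctured_ball z r) (show w ∈ Metric.ball z r \ {z} from ⟨hw, hwz⟩) hev
      refine hz.2 ?_
      filter_upwards [mem_nhdsWithin_of_mem_nhds (Metric.ball_mem_nhds z hr),
        self_mem_nhdsWithin] with x h2 h3 _
      exact heq ⟨h2, h3⟩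
  have hsub : Ω ⊆ T := by
    intro z hz
    by_contra hzT
    have hagree' := hagree
    have hz₀T : ∃ w, w ∈ Ω ∧ w ∈ T := by
      rw [eventually_nhdsWithin_iff] at hagree'
      obtain ⟨w, ⟨⟨hw1, hw2⟩, hw3⟩⟩ := (hfreq.and_eventually (mem_nhdsWithin_of_mem_nhds
        (eventually_eventually_nhds.2 hagree'))).exists
      refine ⟨w, hw1, hw1, ?_⟩
      filter_upwards [mem_nhdsWithin_of_mem_nhds hw3,
        mem_nhdsWithin_of_mem_nhds (hΩ.mem_nhds hw1)] with x h1 h2 h3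
      exact h1 h3.1 h2 h3
    obtain ⟨w, hw1, hw2⟩ := hz₀T
    obtain ⟨x, -, hx1, hx2⟩ := hΩc T V hTo hVo (fun x hx => by
      by_cases h : ∀ᶠ w in 𝓝[≠] x, w ∈ regular Q s → F w = g w
      · exact Or.inl ⟨hx, h⟩
      · exact Or.inr ⟨hx, h⟩) ⟨w, hw1, hw2⟩ ⟨z, hz, hz, fun h => hzT ⟨hz, h⟩⟩
    exact hx2.2 hx1.2
  intro z hz hzr
  refine Filter.EventuallyEq.eq_of_nhds (f := F) (g := g)
    (((hF z hzr).continuousAt.eventuallyEq_nhds_iff_eventuallyEq_nhdsNE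
      (hg z hz).continuousAt).1 ?_)
  filter_upwards [(hsub hz).2, mem_nhdsWithin_of_mem_nhds (hreg.mem_nhds hzr)] with x h2 h3
  exact h2 h3

lemma exists_mem_regular_norm_lt (hQ : 1 < ‖Q‖) (hs : (0 : ℂ) ∉ s) {R : ℝ} (hR : 0 < R) :
    ∃ z ∈ regular Q s, ‖z‖ < R := by
  have h1 := eventually_mem_regular hQ hs (z := ((R / 2 : ℝ) : ℂ)) (s := s)
    (by exact_mod_cast (half_pos hR).ne')
  have h2 : ∀ᶠ w in 𝓝[≠] ((R / 2 : ℝ) : ℂ), ‖w‖ < R := by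
    refine mem_nhdsWithin_of_mem_nhds
      ((isOpen_lt continuous_norm continuous_const).mem_nhds ?_)
    simp only [Set.mem_ofPred_eq, Complex.norm_real]
    rw [Real.norm_of_nonneg (half_pos hR).le]
    linarith
  obtain ⟨z, hz⟩ := (h1.and h2).exists
  exact ⟨z, hz.1, hz.2⟩

/-- An analytic function on the complement of the spirals is zero if it is so near `0`. -/
theorem eq_zero_of_eq_zero_near_zero (hQ : 1 < ‖Q‖) (hs : (0 : ℂ) ∉ s) {F : ℂ → ℂ}
    (hF : AnalyticOnNhd ℂ F (regular Q s)) {R : ℝ} (hR : 0 < R)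
    (h : ∀ z ∈ regular Q s, ‖z‖ < R → F z = 0) : ∀ z ∈ regular Q s, F z = 0 := by
  obtain ⟨z₀, hz₀, hz₀'⟩ := exists_mem_regular_norm_lt hQ hs hR
  refine hF.eqOn_zero_of_preconnected_of_eventuallyEq_zero
    isPathConnected_regular.isConnected.isPreconnected hz₀ ?_
  filter_upwards [(isOpen_regular hQ hs).mem_nhds hz₀,
    (isOpen_lt continuous_norm continuous_const).mem_nhds hz₀'] with w h1 h2
  exact h w h1 h2

end QDiff

end

/-! ### Laplace transforms of sequences along one p-spiral -/

noncomputable section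

namespace QDiff

/-! ### The discrete Laplace transformation of a sequence -/

/-- The general term of the Laplace transform along the spiral `lam Q ^ ℤ` of the sequence `a` of
values of a function on that spiral. -/
def lapTerm (p Q lam : ℂ) (a : ℤ → ℂ) (z : ℂ) (ℓ : ℤ) : ℂ :=
  a ℓ / theta p (p * Q ^ ℓ * lam / z)

/-- The Laplace transform of a sequence. -/
def lap (p Q lam : ℂ) (N : ℕ) (a : ℤ → ℂ) (z : ℂ) : ℂ :=
  1 / (N : ℂ) * ∑' ℓ : ℤ, lapTerm p Q lam a z ℓ

lemma tri_natCast_sub_one (k : ℕ) : tri ((k : ℤ) - 1) = (k.choose 2 : ℤ) := by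
  have h1 := two_mul_tri ((k : ℤ) - 1)
  have h2 : (k.choose 2) * 2 = k * (k - 1) := by
    rw [Nat.choose_two_right]; exact Nat.div_mul_cancel (Nat.even_mul_pred_self k).two_dvd
  rcases k with _ | k
  · simp [tri]
  · have h3 : ((k + 1).choose 2 : ℤ) * 2 = ((k : ℤ) + 1) * k := by
      have : (((k + 1).choose 2 * 2 : ℕ) : ℤ) = (((k + 1) * (k + 1 - 1) : ℕ) : ℤ) := by rw [h2]
      push_cast at this
      simpa using this
    push_cast at h1 ⊢
    have : 2 * tri ((k : ℤ) + 1 - 1) = 2 * ((k + 1).choose 2 : ℤ) := by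
      rw [h1, mul_comm 2, h3]; ring
    omega

/-- The functional equation extracts the single factor `theta p (lam / z)` from all terms and leaves
a monomial in z. -/
lemma lapTerm_self {p lam z : ℂ} (hp : p ≠ 0) (hl : lam ≠ 0) (hz : z ≠ 0) (a : ℤ → ℂ) (k : ℤ) :
    lapTerm p p lam a z k =
      a k * p ^ (-tri k) * lam ^ (-(k + 1)) * z ^ (k + 1) / theta p (lam / z) := by
  have hx : lam / z ≠ 0 := div_ne_zero hl hz
  have e : p * p ^ k * lam / z = p ^ (k + 1) * (lam / z) := by
    rw [zpow_add_one₀ hp]; ring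
  rw [lapTerm, e, theta_zpow_mul hp hx, add_sub_cancel_right, div_zpow, zpow_neg, zpow_neg]
  have h1 : p ^ tri k ≠ 0 := zpow_ne_zero _ hp
  have h2 : lam ^ (k + 1) ≠ 0 := zpow_ne_zero _ hl
  have h3 : z ^ (k + 1) ≠ 0 := zpow_ne_zero _ hz
  -- At a zero of Theta both sides are 0 by the convention on division by zero.
  by_cases h : theta p (lam / z) = 0
  · simp [h]
  · field_simp

/-- The growth conditions on a sequence that make its Laplace transform (with `Q = p`) converge. -/
structure SeqGrowth (P L M : ℝ) (a : ℤ → ℂ) : Prop where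
  neg : ∀ k : ℤ, k < 0 → ‖a k‖ ≤ L
  nonneg : ∀ k : ℕ, ‖a k‖ ≤ L * M ^ k * P ^ (k.choose 2)

/-- For k ≥ 0 the factor P^(-tri k) absorbs the growth P^(k choose 2), leaving at worst a geometric
series of ratio r M / l. For k < 0 the values are bounded and the Theta series at r / l is a
majorant. -/
lemma summable_lap_coeff {P L M l r : ℝ} (hP : 1 < P) (hM : 0 < M) (hl : 0 < l)
    (hr : 0 < r) (hrl : r * M < l) {a : ℤ → ℂ} (ha : SeqGrowth P L M a) :
    Summable fun k : ℤ => ‖a k‖ * P ^ (-tri k) * l ^ (-(k + 1)) * r ^ k := by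
  have hP0 : 0 < P := by linarith
  have hL : 0 ≤ L := (norm_nonneg _).trans (ha.neg (-1) (by norm_num))
  refine Summable.of_nat_of_neg_add_one
    (f := fun k : ℤ => ‖a k‖ * P ^ (-tri k) * l ^ (-(k + 1)) * r ^ k) ?_ ?_
  · refine Summable.of_nonneg_of_le (fun n => by positivity) (fun n => ?_)
      ((summable_geometric_of_lt_one (r := r * M / l) (by positivity)
        ((div_lt_one hl).2 hrl)).mul_left (L / l))
    have e1 : P ^ (-tri n) = (P ^ (n.choose 2))⁻¹ * (P ^ n)⁻¹ := by
      have := tri_sub_one (n : ℤ)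
      rw [tri_natCast_sub_one] at this
      rw [show tri (n : ℤ) = (n.choose 2 : ℤ) + n by linarith, neg_add, zpow_add₀ hP0.ne',
        zpow_neg, zpow_neg, zpow_natCast, zpow_natCast]
    have e2 : l ^ (-((n : ℤ) + 1)) = (l ^ n)⁻¹ * l⁻¹ := by
      rw [neg_add, zpow_add₀ hl.ne', zpow_neg, zpow_natCast, zpow_neg_one]
    calc ‖a n‖ * P ^ (-tri n) * l ^ (-((n : ℤ) + 1)) * r ^ (n : ℤ)
        ≤ (L * M ^ n * P ^ (n.choose 2)) * P ^ (-tri n) * l ^ (-((n : ℤ) + 1)) * r ^ (n : ℤ) := by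
          gcongr; exact ha.nonneg n
      _ = L / l * (r * M / l) ^ n * (P ^ n)⁻¹ := by
          rw [e1, e2, zpow_natCast, div_pow, mul_pow]
          field_simp
      _ ≤ L / l * (r * M / l) ^ n * 1 := by
          gcongr
          exact inv_le_one_of_one_le₀ (one_le_pow₀ hP.le)
      _ = _ := mul_one _
  · have h := (summable_theta_real hP (div_pos hr hl)).comp_injective
      (i := fun n : ℕ => -((n : ℤ) + 1)) (fun m n h => by simpa using h)
    refine Summable.of_nonneg_of_le (fun n => by positivity) (fun n => ?_) (h.mul_left (L / l))
    simp only [Function.comp_apply]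
    set k : ℤ := -((n : ℤ) + 1)
    have e2 : l ^ (-(k + 1)) = (l ^ k)⁻¹ * l⁻¹ := by
      rw [neg_add, zpow_add₀ hl.ne', zpow_neg, zpow_neg_one]
    calc ‖a k‖ * P ^ (-tri k) * l ^ (-(k + 1)) * r ^ k
        ≤ L * P ^ (-tri k) * l ^ (-(k + 1)) * r ^ k := by
          gcongr; exact ha.neg k (by omega)
      _ = L / l * (P ^ (-tri k) * (r / l) ^ k) := by
          rw [e2, div_zpow]; field_simp

/-- The numerator of the Laplace transform over a `p`-spiral. -/
def lapNum (p lam : ℂ) (a : ℤ → ℂ) (z : ℂ) : ℂ :=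
  z * ∑' k : ℤ, a k * p ^ (-tri k) * lam ^ (-(k + 1)) * z ^ k

section SingleSpiral

variable {p lam : ℂ} {L M : ℝ} {a : ℤ → ℂ}

lemma analyticAt_lapNum (hp : 1 < ‖p‖) (hl : lam ≠ 0) (hM : 0 < M) (ha : SeqGrowth ‖p‖ L M a)
    {z : ℂ} (hz : z ≠ 0) (hzM : ‖z‖ * M < ‖lam‖) : AnalyticAt ℂ (lapNum p lam a) z := by
  refine analyticAt_id.mul (analyticAt_laurent
    (c := fun k => a k * p ^ (-tri k) * lam ^ (-(k + 1))) (R := ‖lam‖ / M) (fun r hr hr2 => ?_) hz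
    ((lt_div_iff₀ hM).2 hzM))
  have := summable_lap_coeff hp hM (norm_pos_iff.2 hl) hr ((lt_div_iff₀ hM).1 hr2) ha
  simpa only [norm_mul, norm_zpow] using this

lemma hasSum_lapTerm_self (hp : 1 < ‖p‖) (hl : lam ≠ 0) (hM : 0 < M) (ha : SeqGrowth ‖p‖ L M a)
    {z : ℂ} (hz : z ≠ 0) (hzM : ‖z‖ * M < ‖lam‖) :
    HasSum (lapTerm p p lam a z) (lapNum p lam a z / theta p (lam / z)) := by
  have hs : Summable fun k : ℤ => a k * p ^ (-tri k) * lam ^ (-(k + 1)) * z ^ k := by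
    refine Summable.of_norm ?_
    have := summable_lap_coeff hp hM (norm_pos_iff.2 hl) (norm_pos_iff.2 hz) hzM ha
    simpa only [norm_mul, norm_zpow] using this
  have h := (hs.hasSum.mul_left z).div_const (theta p (lam / z))
  convert! h using 2 with k
  rw [lapTerm_self (ne_zero_of_one_lt_norm hp) hl hz, zpow_add_one₀ hz]
  ring

/-- The Laplace transform of a monomial. -/
lemma hasSum_lapTerm_monomial (hp : 1 < ‖p‖) (hl : lam ≠ 0) {z : ℂ} (hz : z ≠ 0)
    (hθ : theta p (lam / z) ≠ 0) (i : ℕ) :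
    HasSum (lapTerm p p lam (fun k => (p ^ k * lam) ^ i) z) (p ^ (i.choose 2) * z ^ i) := by
  have hp0 := ne_zero_of_one_lt_norm hp
  have hx : lam / z ≠ 0 := div_ne_zero hl hz
  have h := ((summable_theta hp hx).hasSum.mul_left
    (p ^ (i.choose 2) * z ^ i / theta p (lam / z)))
  have e : (∑' ℓ : ℤ, p ^ (-tri ℓ) * (lam / z) ^ ℓ) = theta p (lam / z) := rfl
  rw [e, div_mul_cancel₀ _ hθ] at h
  -- With k = i - 1 - l the numerators become the terms of the Theta series at lam / z, which the
  -- common denominator cancels.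
  refine (Equiv.subLeft ((i : ℤ) - 1)).hasSum_iff.1 ?_
  refine Eq.mpr (congrArg (fun f : ℤ → ℂ => HasSum f _) (funext fun l => ?_)) h
  simp only [Function.comp_apply, Equiv.subLeft_apply]
  rw [lapTerm_self hp0 hl hz]
  have e1 : tri ((i : ℤ) - 1 - l) = tri l + tri i - i - l * i := by
    rw [show (i : ℤ) - 1 - l = -(l - i) - 1 by ring, tri_neg_sub_one,
      show l - (i : ℤ) = l + -i by ring, tri_add, tri_neg]
    ring
  have e2 : (i : ℤ) * i = tri i + i.choose 2 := by rw [tri_sq, tri_natCast_sub_one]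
  have e3 : (p ^ ((i : ℤ) - 1 - l) * lam) ^ i * p ^ (-tri ((i : ℤ) - 1 - l)) =
      p ^ (i.choose 2) * p ^ (-tri l) * lam ^ (i : ℤ) := by
    rw [mul_pow, ← zpow_natCast (p ^ _), ← zpow_mul, ← zpow_natCast lam, ← zpow_natCast p,
      mul_right_comm, ← zpow_add₀ hp0, ← zpow_add₀ hp0, e1]
    congr 2
    linear_combination e2
  rw [e3, show (i : ℤ) - 1 - l + 1 = i - l by ring]
  have e4 : lam ^ (i : ℤ) * lam ^ (-((i : ℤ) - l)) = lam ^ l := by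
    rw [← zpow_add₀ hl]; congr 1; ring
  have e5 : z ^ ((i : ℤ) - l) = z ^ i * (z ^ l)⁻¹ := by
    rw [zpow_sub₀ hz, zpow_natCast]; rfl
  rw [mul_assoc (_ * _) (lam ^ (i : ℤ)), e4, e5, div_zpow]
  ring

/-- The hypotheses on a function `a` on a spiral that make its Laplace transform asymptotic to a
series: it is asymptotic to `∑ c i x ^ i` near `0`, and does not grow too fast at infinity. -/
structure SeqAsymptotic (P W L M : ℝ) (x a : ℤ → ℂ) (c : ℕ → ℂ) : Prop where
  one_le : 1 ≤ M
  one_le_weight : 1 ≤ W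
  coeff : ∀ i, ‖c i‖ ≤ L * M ^ i * W ^ (i.choose 2)
  neg : ∀ k : ℤ, k < 0 → ∀ m : ℕ,
    ‖a k - ∑ i ∈ Finset.range m, c i * x k ^ i‖ ≤ L * M ^ m * W ^ (m.choose 2) * ‖x k‖ ^ m
  nonneg : ∀ k : ℕ, ‖a k‖ ≤ L * M ^ k * P ^ (k.choose 2)

lemma SeqAsymptotic.seqGrowth {P W L M : ℝ} {x a : ℤ → ℂ} {c : ℕ → ℂ}
    (h : SeqAsymptotic P W L M x a c) : SeqGrowth P L M a :=
  ⟨fun k hk => by simpa using h.neg k hk 0, h.nonneg⟩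

lemma choose_two_succ (m : ℕ) : (m + 1).choose 2 = m.choose 2 + m := by
  rw [Nat.choose_succ_succ' m 1, Nat.choose_one_right, add_comm]

/-- A lower bound of `theta` in the form in which it is used to bound the terms of a Laplace
transform. -/
lemma inv_norm_theta_le {P : ℝ} (hP : 1 < P) {c t w v : ℝ} (hc : 0 < c) (ht : 0 < t) (hw : 0 < w)
    (m : ℕ) (h : c * (P ^ (-tri m) * (P * t / w) ^ (m : ℤ)) ≤ v) :
    t ^ m / v ≤ c⁻¹ * P ^ (m.choose 2) * w ^ m := by
  have hP0 : 0 < P := by linarith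
  have hpos : 0 < c * (P ^ (-tri m) * (P * t / w) ^ (m : ℤ)) := by positivity
  rw [div_le_iff₀ (hpos.trans_le h)]
  refine le_trans (le_of_eq ?_) (mul_le_mul_of_nonneg_left h (by positivity))
  have e1 : P ^ (-tri m) = (P ^ (m.choose 2))⁻¹ * (P ^ m)⁻¹ := by
    have := tri_sub_one (m : ℤ)
    rw [tri_natCast_sub_one] at this
    rw [show tri (m : ℤ) = (m.choose 2 : ℤ) + m by linarith, neg_add, zpow_add₀ hP0.ne',
      zpow_neg, zpow_neg, zpow_natCast, zpow_natCast]
  rw [e1, zpow_natCast, div_pow, mul_pow]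
  field_simp

lemma choose_two_add (m k : ℕ) : (m + k).choose 2 = m.choose 2 + k.choose 2 + m * k := by
  have h := tri_natCast_sub_one (m + k)
  have h1 := tri_natCast_sub_one m
  have h2 := tri_natCast_sub_one k
  rw [tri_sub_one] at h h1 h2
  push_cast at h
  rw [tri_add] at h
  zify
  linarith

/-- A term of nonnegative index of a Laplace transform. -/
lemma lap_term_nonneg_le {P L M l w c v α : ℝ} (hP : 1 < P) (hL : 0 ≤ L) (hM : 0 < M) (hl : 0 < l)
    (hw : 0 < w) (hc : 0 < c) (hv : 0 ≤ v) {m j : ℕ}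
    (hα : α ≤ L * M ^ j * P ^ (j.choose 2))
    (h : (P ^ j * l) ^ (m + j) / v ≤ c⁻¹ * P ^ ((m + j).choose 2) * w ^ (m + j))
    (hz : w * M * l⁻¹ ≤ 1 / 2) :
    α / v ≤ (c⁻¹ * L) * (l⁻¹ ^ m) * (P ^ (m.choose 2) * w ^ m) * (1 / 2) ^ j := by
  have hP0 : 0 < P := by linarith
  -- The balance of exponents: growth of the sequence plus the Theta bound of order m + j, against
  -- (P^j)^(m+j). The outcome is P^(m choose 2) with a surplus factor P^(-j).
  have hexp : P ^ (j.choose 2) * P ^ ((m + j).choose 2) * P ^ j =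
      P ^ (m.choose 2) * (P ^ j) ^ (m + j) := by
    rw [choose_two_add, ← pow_add, ← pow_add, ← pow_mul, ← pow_add]
    congr 1
    have e1 : j * j = j.choose 2 + (j.choose 2 + j) := by
      have h1 := tri_sq (j : ℤ)
      have h2 := tri_sub_one (j : ℤ)
      rw [tri_natCast_sub_one] at h1 h2
      zify; linarith
    rw [mul_add, e1]; ring
  have hgeo : (w * M * l⁻¹ * P⁻¹) ^ j ≤ (1 / 2) ^ j := by
    refine pow_le_pow_left₀ (by positivity) ?_ j
    have h4 : P⁻¹ ≤ 1 := inv_le_one_of_one_le₀ hP.le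
    calc w * M * l⁻¹ * P⁻¹ ≤ 1 / 2 * 1 := by gcongr
      _ = 1 / 2 := mul_one _
  have hcancel : P ^ (j.choose 2) * P ^ ((m + j).choose 2) =
      P ^ (m.choose 2) * (P ^ j) ^ (m + j) * (P ^ j)⁻¹ := by
    rw [← hexp]; field_simp
  calc α / v ≤ (L * M ^ j * P ^ (j.choose 2)) / v := by gcongr
    _ = (L * M ^ j * P ^ (j.choose 2)) * ((P ^ j * l) ^ (m + j))⁻¹ *
        ((P ^ j * l) ^ (m + j) / v) := by
        field_simp
    _ ≤ (L * M ^ j * P ^ (j.choose 2)) * ((P ^ j * l) ^ (m + j))⁻¹ *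
        (c⁻¹ * P ^ ((m + j).choose 2) * w ^ (m + j)) := by gcongr
    _ = L * M ^ j * ((P ^ j) ^ (m + j) * l ^ (m + j))⁻¹ * c⁻¹ * w ^ (m + j) *
        (P ^ (j.choose 2) * P ^ ((m + j).choose 2)) := by rw [mul_pow]; ring
    _ = (c⁻¹ * L) * (l⁻¹ ^ m) * (P ^ (m.choose 2) * w ^ m) * (w * M * l⁻¹ * P⁻¹) ^ j := by
        rw [hcancel]
        simp only [mul_pow, inv_pow, pow_add w, pow_add l]
        field_simp
    _ ≤ _ := by gcongr

/-- The contribution of a polynomial to a term of nonnegative index of a Laplace transform. -/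
lemma lap_poly_nonneg_le {P L M W l w c v Λ t : ℝ} (hP : 1 < P) (hL : 0 ≤ L) (hM : 1 ≤ M)
    (hW : 1 ≤ W) (hl : 0 < l) (hw : 0 < w) (hw1 : w ≤ 1) (hc : 0 < c) (hv : 0 ≤ v) (hΛ : 1 ≤ Λ)
    (hΛl : l⁻¹ ≤ Λ) {m j : ℕ} (ht : t = P ^ j * l) {b : ℕ → ℝ}
    (hb : ∀ i, b i ≤ L * M ^ i * W ^ (i.choose 2))
    (h : t ^ (m + 1) / v ≤ c⁻¹ * P ^ ((m + 1).choose 2) * w ^ (m + 1)) :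
    (∑ i ∈ Finset.range (m + 1), b i * t ^ i) / v ≤
      c⁻¹ * L * l⁻¹ * (2 * M * Λ * P) ^ m * (W ^ (m.choose 2) * (P ^ (m.choose 2) * w ^ m)) *
        P⁻¹ ^ j := by
  have hP0 : 0 < P := by linarith
  have hl' : l ≤ t := by rw [ht]; exact le_mul_of_one_le_left hl.le (one_le_pow₀ hP.le)
  have ht0 : 0 < t := hl.trans_le hl'
  have hi : ∀ i ∈ Finset.range (m + 1), b i * t ^ i ≤
      L * M ^ m * W ^ (m.choose 2) * (Λ ^ m * t ^ m) := by
    intro i hi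
    have him : i ≤ m := Nat.lt_succ_iff.1 (Finset.mem_range.1 hi)
    have h3 : b i ≤ L * M ^ m * W ^ (m.choose 2) := by
      refine (hb i).trans ?_
      have h1 : M ^ i ≤ M ^ m := pow_le_pow_right₀ hM him
      have h2 : W ^ (i.choose 2) ≤ W ^ (m.choose 2) :=
        pow_le_pow_right₀ hW (Nat.choose_le_choose 2 him)
      gcongr
    -- Since Λ t ≥ 1, lower powers of t are dominated by t^m at the cost of Λ^m. The Theta bound of
    -- order m + 1 then leaves t⁻¹, which decays geometrically in j.
    have h4 : t ^ i ≤ Λ ^ m * t ^ m := by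
      have h5 : 1 ≤ Λ * t := by
        rw [← inv_mul_cancel₀ hl.ne']
        gcongr
      calc t ^ i ≤ t ^ i * (Λ * t) ^ (m - i) := le_mul_of_one_le_right (by positivity)
            (one_le_pow₀ h5)
        _ = Λ ^ (m - i) * t ^ m := by
            rw [mul_pow, ← pow_mul_pow_sub t him]; ring
        _ ≤ Λ ^ m * t ^ m := by
            have := pow_le_pow_right₀ hΛ (Nat.sub_le m i)
            gcongr
    gcongr
  have hsum2 : ∑ i ∈ Finset.range (m + 1), b i * t ^ i ≤
      2 ^ m * (L * M ^ m * W ^ (m.choose 2) * (Λ ^ m * t ^ m)) := by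
    refine (Finset.sum_le_card_nsmul _ _ _ hi).trans ?_
    rw [Finset.card_range, nsmul_eq_mul]
    gcongr
    have := Nat.lt_two_pow_self (n := m)
    exact_mod_cast this
  have htβ : t⁻¹ = l⁻¹ * P⁻¹ ^ j := by
    rw [ht, mul_inv, mul_comm, ← inv_pow]
  rw [choose_two_succ] at h
  calc (∑ i ∈ Finset.range (m + 1), b i * t ^ i) / v
      ≤ (2 ^ m * (L * M ^ m * W ^ (m.choose 2) * (Λ ^ m * t ^ m))) / v := by gcongr
    _ = (2 * M * Λ) ^ m * L * W ^ (m.choose 2) * t⁻¹ * (t ^ (m + 1) / v) := by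
        rw [mul_pow, mul_pow, pow_succ]; field_simp
    _ ≤ (2 * M * Λ) ^ m * L * W ^ (m.choose 2) * t⁻¹ *
        (c⁻¹ * P ^ (m.choose 2 + m) * w ^ (m + 1)) := by gcongr
    _ = c⁻¹ * L * l⁻¹ * (2 * M * Λ * P) ^ m * (W ^ (m.choose 2) * (P ^ (m.choose 2) * w ^ m)) *
        P⁻¹ ^ j * w := by
        rw [htβ, pow_add P, pow_succ w, mul_pow (2 * M * Λ) P]; ring
    _ ≤ c⁻¹ * L * l⁻¹ * (2 * M * Λ * P) ^ m * (W ^ (m.choose 2) * (P ^ (m.choose 2) * w ^ m)) *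
        P⁻¹ ^ j * 1 := by gcongr
    _ = _ := mul_one _

/-- The `q`-Gevrey estimate for the Laplace transform along a `p`-spiral. -/
theorem norm_lap_sub_le (hp : 1 < ‖p‖) (hl : lam ≠ 0) {W : ℝ} {c : ℕ → ℂ}
    (ha : SeqAsymptotic ‖p‖ W L M (fun k => p ^ k * lam) a c) {ε : ℝ} (hε : 0 < ε) :
    ∃ L' M' : ℝ, 0 < L' ∧ 1 ≤ M' ∧ ∀ (m : ℕ) (z : ℂ), z ≠ 0 → ‖z‖ ≤ 1 → 2 * (‖z‖ * M) < ‖lam‖ →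
      (∀ k : ℤ, ε * ‖lam / z‖ ≤ ‖lam / z + p ^ k‖) →
      ‖lapNum p lam a z / theta p (lam / z) -
          ∑ i ∈ Finset.range m, c i * p ^ (i.choose 2) * z ^ i‖ ≤
        L' * M' ^ m * (W * ‖p‖) ^ (m.choose 2) * ‖z‖ ^ m := by
  have hp0 := ne_zero_of_one_lt_norm hp
  set P := ‖p‖ with hPdef
  have hP0 : 0 < P := by linarith
  set l := ‖lam‖ with hldef
  have hl0 : 0 < l := norm_pos_iff.2 hl
  have hM := ha.one_le
  have hM0 : 0 < M := by linarith
  have hW := ha.one_le_weight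
  have hW0 : 0 < W := by linarith
  have hL : 0 ≤ L := (norm_nonneg _).trans (by simpa using ha.coeff 0)
  obtain ⟨c₀, hc₀, hθ⟩ := exists_le_norm_theta hp hε
  -- A common ratio for the sum over k: 1 / 2 comes from the smallness of ‖z‖ M when k ≥ 0, and P⁻¹
  -- from the polynomial part there and from the factor |p^k lam| when k < 0.
  set β := max (1 / 2) P⁻¹ with hβ
  have hβ0 : 0 < β := lt_max_of_lt_left (by norm_num)
  have hβ1 : β < 1 := max_lt (by norm_num) (inv_lt_one_of_one_lt₀ hp)
  have hsum : Summable fun k : ℤ => β ^ k.natAbs := by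
    refine Summable.of_nat_of_neg (f := fun k : ℤ => β ^ k.natAbs) ?_ ?_ <;>
      simpa using summable_geometric_of_lt_one hβ0.le hβ1
  set S := ∑' k : ℤ, β ^ k.natAbs with hS
  have hS0 : 0 ≤ S := tsum_nonneg fun _ => by positivity
  set Λ := 1 + l⁻¹ with hΛ
  have hΛ1 : 1 ≤ Λ := by rw [hΛ]; have : 0 < l⁻¹ := inv_pos.2 hl0; linarith
  have hΛl : l⁻¹ ≤ Λ := by rw [hΛ]; linarith
  -- the constants
  set B := 2 * M * W * Λ * P with hB
  have hB1 : 1 ≤ B := by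
    have h1 : 1 ≤ M * W := one_le_mul_of_one_le_of_one_le hM hW
    have h2 : 1 ≤ Λ * P := one_le_mul_of_one_le_of_one_le hΛ1 hp.le
    have h3 := one_le_mul_of_one_le_of_one_le h1 h2
    rw [hB]; nlinarith
  set A := c₀⁻¹ * L * (M * l + 2 * Λ) with hA
  have hA0 : 0 ≤ A := by positivity
  refine ⟨A * S + L + 1, B, by positivity, hB1, fun m z hz hz1 hzM hzε => ?_⟩
  have hz0 : 0 < ‖z‖ := norm_pos_iff.2 hz
  have hx0 : lam / z ≠ 0 := div_ne_zero hl hz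
  have hθ0 : theta p (lam / z) ≠ 0 := by
    have := hθ _ hx0 hzε 0
    intro h
    rw [h] at this
    simp only [tri_zero, neg_zero, zpow_zero, norm_zero, mul_one] at this
    linarith
  -- the bounds of theta
  have hth : ∀ (k : ℤ) (j : ℕ), (P ^ k * l) ^ j / ‖theta p (p * p ^ k * lam / z)‖ ≤
      c₀⁻¹ * P ^ (j.choose 2) * ‖z‖ ^ j := by
    intro k j
    refine inv_norm_theta_le hp hc₀ (by positivity) hz0 j ?_
    have hne : p * p ^ k * lam / z ≠ 0 :=
      div_ne_zero (mul_ne_zero (mul_ne_zero hp0 (zpow_ne_zero _ hp0)) hl) hz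
    have h1 := hθ (p * p ^ k * lam / z) hne (fun i => by
      have e1 : p * p ^ k * lam / z = p ^ (k + 1) * (lam / z) := by
        rw [zpow_add_one₀ hp0]; ring
      have e2 : p ^ (k + 1) * (lam / z) + p ^ i = p ^ (k + 1) * (lam / z + p ^ (i - (k + 1))) := by
        rw [mul_add, ← zpow_add₀ hp0]; congr 2; ring
      rw [e1, e2, norm_mul, norm_mul]
      have := mul_le_mul_of_nonneg_left (hzε (i - (k + 1))) (norm_nonneg (p ^ (k + 1)))
      linarith) j
    rw [norm_div, norm_mul, norm_mul, norm_zpow] at h1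
    rw [show P * (P ^ k * l) = P * P ^ k * l by ring]
    exact h1
  set X := (W * P) ^ (m.choose 2) * ‖z‖ ^ m with hX
  have hX0 : 0 < X := by positivity
  -- the remainder of order `m + 1`
  have hgrow := ha.seqGrowth
  have hzM' : ‖z‖ * M < l := by nlinarith
  have hsumR : HasSum (fun k : ℤ => lapTerm p p lam a z k -
      ∑ i ∈ Finset.range (m + 1), c i * lapTerm p p lam (fun k => (p ^ k * lam) ^ i) z k)
      (lapNum p lam a z / theta p (lam / z) -
        ∑ i ∈ Finset.range (m + 1), c i * (p ^ (i.choose 2) * z ^ i)) :=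
    (hasSum_lapTerm_self hp hl hM0 hgrow hz hzM').sub
      (hasSum_sum fun i _ => (hasSum_lapTerm_monomial hp hl hz hθ0 i).mul_left (c i))
  -- Subtracting one order more than required leaves a spare factor |p^k lam| for k < 0, which makes
  -- the sum over k → -∞ converge. For k ≥ 0 the sequence and the polynomial are bounded separately.
  have hterm : ∀ k : ℤ, ‖lapTerm p p lam a z k -
      ∑ i ∈ Finset.range (m + 1), c i * lapTerm p p lam (fun k => (p ^ k * lam) ^ i) z k‖ ≤
      A * B ^ m * X * β ^ k.natAbs := by
    intro k
    obtain ⟨θk, hθk⟩ : ∃ θk, θk = theta p (p * p ^ k * lam / z) := ⟨_, rfl⟩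
    obtain ⟨t, ht⟩ : ∃ t, t = P ^ k * l := ⟨_, rfl⟩
    have ht0 : 0 < t := by rw [ht]; positivity
    have htn : ‖p ^ k * lam‖ = t := by rw [norm_mul, norm_zpow, ht]
    have e : lapTerm p p lam a z k -
        ∑ i ∈ Finset.range (m + 1), c i * lapTerm p p lam (fun k => (p ^ k * lam) ^ i) z k =
        (a k - ∑ i ∈ Finset.range (m + 1), c i * (p ^ k * lam) ^ i) / θk := by
      simp only [lapTerm, ← hθk]
      rw [sub_div, Finset.sum_div]
      congr 1
      exact Finset.sum_congr rfl fun i _ => by ring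
    rw [e, norm_div]
    have hWm : W ^ ((m + 1).choose 2) = W ^ (m.choose 2) * W ^ m := by
      rw [choose_two_succ, pow_add]
    have hBm : ∀ y : ℝ, 0 ≤ y → y ≤ B → y ^ m ≤ B ^ m := fun y h0 h1 => pow_le_pow_left₀ h0 h1 m
    have hXe : X = W ^ (m.choose 2) * (P ^ (m.choose 2) * ‖z‖ ^ m) := by
      rw [hX, mul_pow]; ring
    rcases lt_or_ge k 0 with hk | hk
    · obtain ⟨j, rfl⟩ : ∃ j : ℕ, k = -(j : ℤ) := ⟨(-k).toNat, by omega⟩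
      have h1 := ha.neg _ hk (m + 1)
      have h2 := hth (-(j : ℤ)) m
      rw [← hθk, ← ht] at h2
      have htβ : t ≤ l * β ^ j := by
        rw [ht, mul_comm, zpow_neg, zpow_natCast, ← inv_pow]
        gcongr
        exact le_max_right _ _
      have hMW : (M * W) ^ m ≤ B ^ m := by
        refine hBm _ (by positivity) ?_
        have h3 : 1 ≤ 2 * (Λ * P) := by
          have := one_le_mul_of_one_le_of_one_le hΛ1 hp.le; linarith
        have : B = (M * W) * (2 * (Λ * P)) := by rw [hB]; ring
        rw [this]
        exact le_mul_of_one_le_right (by positivity) h3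
      calc ‖a (-(j : ℤ)) - ∑ i ∈ Finset.range (m + 1), c i * (p ^ (-(j : ℤ)) * lam) ^ i‖ / ‖θk‖
          ≤ (L * M ^ (m + 1) * W ^ ((m + 1).choose 2) * t ^ (m + 1)) / ‖θk‖ := by
            rw [← htn]; gcongr
        _ = (L * M * W ^ (m.choose 2)) * (M * W) ^ m * t * (t ^ m / ‖θk‖) := by
            rw [hWm, mul_pow]; ring
        _ ≤ (L * M * W ^ (m.choose 2)) * B ^ m * (l * β ^ j) *
            (c₀⁻¹ * P ^ (m.choose 2) * ‖z‖ ^ m) := by gcongr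
        _ = (c₀⁻¹ * L * (M * l)) * B ^ m * X * β ^ j := by rw [hXe]; ring
        _ ≤ A * B ^ m * X * β ^ j := by
            gcongr
            rw [hA]
            gcongr
            linarith
        _ = _ := by simp
    · obtain ⟨j, rfl⟩ : ∃ j : ℕ, k = (j : ℤ) := ⟨k.toNat, by omega⟩
      have htj : t = P ^ j * l := by rw [ht, zpow_natCast]
      have htl : l ≤ t := by
        rw [htj]; exact le_mul_of_one_le_left hl0.le (one_le_pow₀ hp.le)
      have hmono : ∀ y D : ℝ, 0 ≤ y → 1 ≤ D → B = y * D → y ^ m ≤ B ^ m := fun y D h0 h1 h2 =>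
        hBm y h0 (h2 ▸ le_mul_of_one_le_right h0 h1)
      have hβ2 : (1 / 2 : ℝ) ^ j ≤ β ^ j := pow_le_pow_left₀ (by norm_num) (le_max_left _ _) j
      have hβP : P⁻¹ ^ j ≤ β ^ j := pow_le_pow_left₀ (by positivity) (le_max_right _ _) j
      have hW1 : 1 ≤ W ^ (m.choose 2) := one_le_pow₀ hW
      have hA1 : ‖a j‖ / ‖θk‖ ≤ c₀⁻¹ * L * B ^ m * X * β ^ j := by
        -- The order of the Theta bound is allowed to depend on the index j, to match the growth of
        -- a j.
        have h2 := hth (j : ℤ) (m + j)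
        rw [← hθk, zpow_natCast] at h2
        refine (lap_term_nonneg_le hp hL hM0 hl0 hz0 hc₀ (norm_nonneg _) (ha.nonneg j) h2 ?_).trans ?_
        · rw [← div_eq_mul_inv, div_le_iff₀ hl0]; linarith
        · have hlB : (l⁻¹) ^ m ≤ B ^ m := by
            refine (pow_le_pow_left₀ (by positivity) hΛl m).trans
              (hmono Λ (2 * (M * W) * P) (by positivity) ?_ (by rw [hB]; ring))
            have := one_le_mul_of_one_le_of_one_le (one_le_mul_of_one_le_of_one_le hM hW) hp.le
            linarith
          have hX1 : P ^ (m.choose 2) * ‖z‖ ^ m ≤ X := by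
            rw [hXe]; exact le_mul_of_one_le_left (by positivity) hW1
          gcongr
      have hA2 : (∑ i ∈ Finset.range (m + 1), ‖c i‖ * t ^ i) / ‖θk‖ ≤
          c₀⁻¹ * L * l⁻¹ * B ^ m * X * β ^ j := by
        have h2 := hth (j : ℤ) (m + 1)
        rw [← hθk, ← ht] at h2
        refine (lap_poly_nonneg_le hp hL hM hW hl0 hz0 hz1 hc₀ (norm_nonneg _) hΛ1 hΛl htj
          ha.coeff h2).trans ?_
        have hBe : (2 * M * Λ * P) ^ m ≤ B ^ m :=
          hmono _ W (by positivity) hW (by rw [hB]; ring)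
        rw [← hXe]
        gcongr
      have hnorm : ‖a j - ∑ i ∈ Finset.range (m + 1), c i * (p ^ (j : ℤ) * lam) ^ i‖ ≤
          ‖a j‖ + ∑ i ∈ Finset.range (m + 1), ‖c i‖ * t ^ i := by
        refine (norm_sub_le _ _).trans (add_le_add le_rfl ((norm_sum_le _ _).trans (le_of_eq ?_)))
        refine Finset.sum_congr rfl fun i _ => ?_
        rw [norm_mul, norm_pow, htn]
      calc _ ≤ (‖a j‖ + ∑ i ∈ Finset.range (m + 1), ‖c i‖ * t ^ i) / ‖θk‖ := by gcongr
        _ = ‖a j‖ / ‖θk‖ + (∑ i ∈ Finset.range (m + 1), ‖c i‖ * t ^ i) / ‖θk‖ := add_div _ _ _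
        _ ≤ c₀⁻¹ * L * B ^ m * X * β ^ j + c₀⁻¹ * L * l⁻¹ * B ^ m * X * β ^ j :=
            add_le_add hA1 hA2
        _ = (c₀⁻¹ * L * Λ) * B ^ m * X * β ^ j := by rw [hΛ]; ring
        _ ≤ A * B ^ m * X * β ^ j := by
            gcongr
            rw [hA]
            gcongr
            nlinarith
        _ = _ := by simp
  have hR := hsumR.norm_le_of_bounded (hsum.hasSum.mul_left (A * B ^ m * X)) hterm
  -- The term of degree m, subtracted in excess, is put back and is itself of the required size.
  have hlast : ‖c m * (p ^ (m.choose 2) * z ^ m)‖ ≤ L * B ^ m * X := by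
    have hMB : M ^ m ≤ B ^ m := by
      refine pow_le_pow_left₀ hM0.le ?_ m
      have h3 : 1 ≤ 2 * (W * (Λ * P)) := by
        have := one_le_mul_of_one_le_of_one_le hW (one_le_mul_of_one_le_of_one_le hΛ1 hp.le)
        linarith
      have : B = M * (2 * (W * (Λ * P))) := by rw [hB]; ring
      rw [this]
      exact le_mul_of_one_le_right (by positivity) h3
    rw [norm_mul, norm_mul, norm_pow, norm_pow]
    calc ‖c m‖ * (P ^ (m.choose 2) * ‖z‖ ^ m)
        ≤ (L * B ^ m * W ^ (m.choose 2)) * (P ^ (m.choose 2) * ‖z‖ ^ m) := by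
          gcongr
          exact (ha.coeff m).trans (by gcongr)
      _ = L * B ^ m * X := by rw [hX, mul_pow]; ring
  have hfin : lapNum p lam a z / theta p (lam / z) -
      ∑ i ∈ Finset.range m, c i * p ^ (i.choose 2) * z ^ i =
      (lapNum p lam a z / theta p (lam / z) -
        ∑ i ∈ Finset.range (m + 1), c i * (p ^ (i.choose 2) * z ^ i)) +
        c m * (p ^ (m.choose 2) * z ^ m) := by
    rw [Finset.sum_range_succ]
    simp only [mul_assoc]
    ring
  rw [hfin]
  refine (norm_add_le _ _).trans ?_
  calc _ ≤ A * B ^ m * X * S + L * B ^ m * X := add_le_add hR hlast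
    _ = (A * S + L) * B ^ m * X := by ring
    _ ≤ (A * S + L + 1) * B ^ m * X :=
        mul_le_mul_of_nonneg_right (mul_le_mul_of_nonneg_right (by linarith) (by positivity)) hX0.le
    _ = _ := by rw [hX]; ring

end SingleSpiral

end QDiff

end

/-! ### Laplace transforms along finer spirals, and their compatibility with shifts -/

noncomputable section

namespace QDiff

section FineSpiral

variable {Q lam : ℂ} {N : ℕ} {P W L M : ℝ} {a : ℤ → ℂ} {c : ℕ → ℂ}

/-- The numerators and denominators of a Laplace transform along a `Q`-spiral, where
`p = Q ^ N`. -/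
def lapQuot (Q lam : ℂ) (N : ℕ) (a : ℤ → ℂ) (z : ℂ) (j : ℕ) : ℂ :=
  lapNum (Q ^ N) (Q ^ j * lam) (fun k => a (k * N + j)) z / theta (Q ^ N) (Q ^ j * lam / z)

lemma lapTerm_subspiral (hQ0 : Q ≠ 0) (z : ℂ) (k : ℤ) (j : ℕ) :
    lapTerm (Q ^ N) Q lam a z (k * N + j) =
      lapTerm (Q ^ N) (Q ^ N) (Q ^ j * lam) (fun k => a (k * N + j)) z k := by
  simp only [lapTerm]
  congr 2
  have : Q ^ (k * N + j : ℤ) = (Q ^ N) ^ k * Q ^ j := by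
    rw [zpow_add₀ hQ0, mul_comm k, zpow_mul, zpow_natCast, zpow_natCast]
  rw [this]; ring

lemma one_lt_norm_pow {Q : ℂ} (hQ : 1 < ‖Q‖) (hN : N ≠ 0) : 1 < ‖Q ^ N‖ := by
  rw [norm_pow]; exact one_lt_pow₀ hQ hN

lemma norm_le_norm_pow_mul {Q : ℂ} (hQ : 1 < ‖Q‖) (lam : ℂ) (j : ℕ) : ‖lam‖ ≤ ‖Q ^ j * lam‖ := by
  rw [norm_mul, norm_pow]
  exact le_mul_of_one_le_left (norm_nonneg _) (one_le_pow₀ hQ.le)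

/-- A Q-spiral is the disjoint union of the N spirals Q^j lam p^ℤ with p = Q^N. Writing ℓ = k N + j
by Euclidean division reduces the sum to N single-spiral sums. -/
theorem hasSum_lapTerm (hQ : 1 < ‖Q‖) (hN : N ≠ 0) (hl : lam ≠ 0) (hM : 0 < M)
    (ha : ∀ j < N, SeqGrowth ‖Q ^ N‖ L M fun k => a (k * N + j))
    {z : ℂ} (hz : z ≠ 0) (hzM : ‖z‖ * M < ‖lam‖) :
    HasSum (lapTerm (Q ^ N) Q lam a z) (∑ j ∈ Finset.range N, lapQuot Q lam N a z j) := by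
  have hQ0 := ne_zero_of_one_lt_norm hQ
  have : NeZero N := ⟨hN⟩
  set g : Fin N × ℤ → ℂ := fun x => lapTerm (Q ^ N) Q lam a z (x.2 * N + x.1) with hg
  have hfib : ∀ j : Fin N, HasSum (fun k => g (j, k)) (lapQuot Q lam N a z j) := by
    intro j
    have h1 := hasSum_lapTerm_self (one_lt_norm_pow hQ hN)
      (mul_ne_zero (pow_ne_zero j hQ0) hl) hM (ha j j.2) hz
      (hzM.trans_le (norm_le_norm_pow_mul hQ lam j))
    simp only [hg, lapTerm_subspiral hQ0]
    exact h1
  have hs : Summable g := by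
    refine Summable.of_norm ?_
    rw [summable_prod_of_nonneg (fun _ => norm_nonneg _)]
    exact ⟨fun j => (hfib j).summable.norm, (hasSum_fintype _).summable⟩
  have h2 := hs.hasSum.prod_fiberwise hfib
  have h3 : ∑' x, g x = ∑ j ∈ Finset.range N, lapQuot Q lam N a z j := by
    rw [Finset.sum_range]
    exact h2.unique (hasSum_fintype _)
  have h4 := hs.hasSum
  rw [h3] at h4
  refine (((Equiv.prodComm _ _).trans (Int.divModEquiv N).symm).hasSum_iff).1 ?_
  exact h4

theorem lap_eq (hQ : 1 < ‖Q‖) (hN : N ≠ 0) (hl : lam ≠ 0) (hM : 0 < M)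
    (ha : ∀ j < N, SeqGrowth ‖Q ^ N‖ L M fun k => a (k * N + j))
    {z : ℂ} (hz : z ≠ 0) (hzM : ‖z‖ * M < ‖lam‖) :
    lap (Q ^ N) Q lam N a z = 1 / (N : ℂ) * ∑ j ∈ Finset.range N, lapQuot Q lam N a z j := by
  rw [lap, (hasSum_lapTerm hQ hN hl hM ha hz hzM).tsum_eq]

lemma analyticAt_theta_div (hQ : 1 < ‖Q‖) (hN : N ≠ 0) (hl : lam ≠ 0) {z : ℂ} (hz : z ≠ 0) :
    AnalyticAt ℂ (fun z => theta (Q ^ N) (lam / z)) z :=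
  (analyticAt_theta (one_lt_norm_pow hQ hN) (div_ne_zero hl hz)).fun_comp
    (analyticAt_const.div analyticAt_id hz)

/-- The points where the Laplace transform may have a pole. -/
def offSpiral (Q lam z : ℂ) : Prop := ∀ ℓ : ℤ, z ≠ -(Q ^ ℓ * lam)

lemma theta_ne_zero_of_offSpiral (hQ : 1 < ‖Q‖) (hN : N ≠ 0) (hl : lam ≠ 0) {z : ℂ} (hz : z ≠ 0)
    (h : offSpiral Q lam z) (j : ℕ) : theta (Q ^ N) (Q ^ j * lam / z) ≠ 0 := by
  have hQ0 := ne_zero_of_one_lt_norm hQ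
  refine theta_ne_zero (one_lt_norm_pow hQ hN)
    (div_ne_zero (mul_ne_zero (pow_ne_zero j hQ0) hl) hz) fun k hk => h (j - N * k) ?_
  rw [div_eq_iff hz] at hk
  have e : Q ^ ((j : ℤ) - N * k) = Q ^ j * ((Q ^ N) ^ k)⁻¹ := by
    rw [zpow_sub₀ hQ0, zpow_natCast, zpow_mul, zpow_natCast]; rfl
  rw [e, mul_right_comm, hk]
  have : (Q ^ N) ^ k ≠ 0 := zpow_ne_zero _ (pow_ne_zero _ hQ0)
  field_simp

lemma meromorphicAt_lapQuot (hQ : 1 < ‖Q‖) (hN : N ≠ 0) (hl : lam ≠ 0) (hM : 0 < M)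
    (ha : ∀ j < N, SeqGrowth ‖Q ^ N‖ L M fun k => a (k * N + j))
    {z : ℂ} (hz : z ≠ 0) (hzM : ‖z‖ * M < ‖lam‖) {j : ℕ} (hj : j < N) :
    MeromorphicAt (fun z => lapQuot Q lam N a z j) z ∧
      (offSpiral Q lam z → AnalyticAt ℂ (fun z => lapQuot Q lam N a z j) z) := by
  have hQ0 := ne_zero_of_one_lt_norm hQ
  have hl' : Q ^ j * lam ≠ 0 := mul_ne_zero (pow_ne_zero j hQ0) hl
  have h1 := analyticAt_lapNum (one_lt_norm_pow hQ hN) hl' hM (ha j hj) hz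
    (hzM.trans_le (norm_le_norm_pow_mul hQ lam j))
  have h2 := analyticAt_theta_div hQ hN hl' hz
  exact ⟨h1.meromorphicAt.div h2.meromorphicAt,
    fun h => h1.div h2 (theta_ne_zero_of_offSpiral hQ hN hl hz h j)⟩

lemma lap_eventuallyEq (hQ : 1 < ‖Q‖) (hN : N ≠ 0) (hl : lam ≠ 0) (hM : 0 < M)
    (ha : ∀ j < N, SeqGrowth ‖Q ^ N‖ L M fun k => a (k * N + j))
    {z : ℂ} (hz : z ≠ 0) (hzM : ‖z‖ * M < ‖lam‖) :
    lap (Q ^ N) Q lam N a =ᶠ[𝓝 z]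
      fun z => 1 / (N : ℂ) * ∑ j ∈ Finset.range N, lapQuot Q lam N a z j := by
  have h1 : ∀ᶠ w in 𝓝 z, ‖w‖ * M < ‖lam‖ :=
    (isOpen_lt (by fun_prop) continuous_const).mem_nhds hzM
  filter_upwards [h1, isOpen_ne.mem_nhds hz] with w hw1 hw2
  exact lap_eq hQ hN hl hM ha hw2 hw1

theorem meromorphicAt_lap (hQ : 1 < ‖Q‖) (hN : N ≠ 0) (hl : lam ≠ 0) (hM : 0 < M)
    (ha : ∀ j < N, SeqGrowth ‖Q ^ N‖ L M fun k => a (k * N + j))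
    {z : ℂ} (hz : z ≠ 0) (hzM : ‖z‖ * M < ‖lam‖) :
    MeromorphicAt (lap (Q ^ N) Q lam N a) z := by
  refine MeromorphicAt.congr ?_
    ((lap_eventuallyEq hQ hN hl hM ha hz hzM).filter_mono nhdsWithin_le_nhds).symm
  refine (MeromorphicAt.const _ _).mul (MeromorphicAt.fun_sum fun j hj => ?_)
  exact (meromorphicAt_lapQuot hQ hN hl hM ha hz hzM (Finset.mem_range.1 hj)).1

theorem analyticAt_lap (hQ : 1 < ‖Q‖) (hN : N ≠ 0) (hl : lam ≠ 0) (hM : 0 < M)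
    (ha : ∀ j < N, SeqGrowth ‖Q ^ N‖ L M fun k => a (k * N + j))
    {z : ℂ} (hz : z ≠ 0) (hzM : ‖z‖ * M < ‖lam‖) (h : offSpiral Q lam z) :
    AnalyticAt ℂ (lap (Q ^ N) Q lam N a) z := by
  refine AnalyticAt.congr ?_ (lap_eventuallyEq hQ hN hl hM ha hz hzM).symm
  refine analyticAt_const.mul (Finset.analyticAt_fun_sum _ fun j hj => ?_)
  exact (meromorphicAt_lapQuot hQ hN hl hM ha hz hzM (Finset.mem_range.1 hj)).2 h

/-- The `q`-Gevrey estimate for the Laplace transform. -/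
theorem norm_lap_sub_sum_le (hQ : 1 < ‖Q‖) (hN : N ≠ 0) (hl : lam ≠ 0)
    (ha : ∀ j < N, SeqAsymptotic ‖Q ^ N‖ W L M (fun k => (Q ^ N) ^ k * (Q ^ j * lam))
      (fun k => a (k * N + j)) c) {ε : ℝ} (hε : 0 < ε) :
    ∃ L' M' : ℝ, 0 < L' ∧ 1 ≤ M' ∧ ∀ (m : ℕ) (z : ℂ), z ≠ 0 → ‖z‖ ≤ 1 → 2 * (‖z‖ * M) < ‖lam‖ →
      (∀ ℓ : ℤ, ε * ‖Q ^ ℓ * lam‖ ≤ ‖z + Q ^ ℓ * lam‖) →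
      ‖lap (Q ^ N) Q lam N a z - ∑ i ∈ Finset.range m, c i * (Q ^ N) ^ (i.choose 2) * z ^ i‖ ≤
        L' * M' ^ m * (W * ‖Q ^ N‖) ^ (m.choose 2) * ‖z‖ ^ m := by
  have hQ0 := ne_zero_of_one_lt_norm hQ
  have hp := one_lt_norm_pow hQ hN
  have hp0 := ne_zero_of_one_lt_norm hp
  have h1 := fun (j : ℕ) (hj : j < N) => norm_lap_sub_le hp
    (mul_ne_zero (pow_ne_zero j hQ0) hl) (ha j hj) hε
  choose! L₁ M₁ hL₁ hM₁ hest using h1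
  have h0N : 0 < N := Nat.pos_of_ne_zero hN
  refine ⟨∑ j ∈ Finset.range N, L₁ j, ∑ j ∈ Finset.range N, M₁ j,
    Finset.sum_pos (fun j hj => hL₁ j (Finset.mem_range.1 hj)) ⟨0, Finset.mem_range.2 h0N⟩, ?_, ?_⟩
  · exact (hM₁ 0 h0N).trans (Finset.single_le_sum (f := M₁)
      (fun j hj => by linarith [hM₁ j (Finset.mem_range.1 hj)]) (Finset.mem_range.2 h0N))
  intro m z hz hz1 hzM hzε
  have hM := (ha 0 h0N).one_le
  have hW := (ha 0 h0N).one_le_weight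
  have hzM' : ‖z‖ * M < ‖lam‖ := by
    have : 0 ≤ ‖z‖ * M := by positivity
    linarith
  rw [lap_eq hQ hN hl (by linarith) (fun j hj => (ha j hj).seqGrowth) hz hzM']
  set T := ∑ i ∈ Finset.range m, c i * (Q ^ N) ^ (i.choose 2) * z ^ i
  set X := (W * ‖Q ^ N‖) ^ (m.choose 2) * ‖z‖ ^ m with hX
  have hX0 : 0 ≤ X := by positivity
  have hNC : (N : ℂ) ≠ 0 := by exact_mod_cast hN
  have e : 1 / (N : ℂ) * ∑ j ∈ Finset.range N, lapQuot Q lam N a z j - T =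
      1 / (N : ℂ) * ∑ j ∈ Finset.range N, (lapQuot Q lam N a z j - T) := by
    rw [Finset.sum_sub_distrib, Finset.sum_const, Finset.card_range, nsmul_eq_mul]
    field_simp
  have hterm : ∀ j ∈ Finset.range N, ‖lapQuot Q lam N a z j - T‖ ≤
      L₁ j * (∑ j ∈ Finset.range N, M₁ j) ^ m * X := by
    intro j hj
    have hj' := Finset.mem_range.1 hj
    have h2 := hest j hj' m z hz hz1 (hzM.trans_le (norm_le_norm_pow_mul hQ lam j)) (fun k => by
      have h3 := hzε (j - N * k)
      have e1 : Q ^ ((j : ℤ) - N * k) * lam = ((Q ^ N) ^ k)⁻¹ * (Q ^ j * lam) := by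
        rw [zpow_sub₀ hQ0, zpow_natCast, zpow_mul, zpow_natCast, div_eq_mul_inv]; ring
      have hpk : (Q ^ N) ^ k ≠ 0 := zpow_ne_zero _ hp0
      have e2 : Q ^ j * lam / z + (Q ^ N) ^ k =
          (Q ^ N) ^ k / z * (z + ((Q ^ N) ^ k)⁻¹ * (Q ^ j * lam)) := by
        field_simp
        ring
      have e3 : Q ^ j * lam / z = (Q ^ N) ^ k / z * (((Q ^ N) ^ k)⁻¹ * (Q ^ j * lam)) := by
        field_simp
      rw [e1] at h3
      rw [e2, norm_mul, e3, norm_mul]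
      have := mul_le_mul_of_nonneg_left h3 (norm_nonneg ((Q ^ N) ^ k / z))
      linarith)
    refine h2.trans ?_
    rw [mul_assoc (L₁ j * M₁ j ^ m), ← hX]
    have h4 : M₁ j ≤ ∑ j ∈ Finset.range N, M₁ j := Finset.single_le_sum (f := M₁)
      (fun j hj => by linarith [hM₁ j (Finset.mem_range.1 hj)]) hj
    have h5 := hL₁ j hj'
    have h6 : 0 ≤ M₁ j := by linarith [hM₁ j hj']
    gcongr
  rw [e, norm_mul]
  have hN1 : ‖1 / (N : ℂ)‖ ≤ 1 := by
    rw [norm_div, norm_one, Complex.norm_natCast]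
    exact div_le_one_of_le₀ (by exact_mod_cast h0N) (by positivity)
  calc ‖1 / (N : ℂ)‖ * ‖∑ j ∈ Finset.range N, (lapQuot Q lam N a z j - T)‖
      ≤ 1 * ∑ j ∈ Finset.range N, L₁ j * (∑ j ∈ Finset.range N, M₁ j) ^ m * X :=
        mul_le_mul hN1 ((norm_sum_le _ _).trans (Finset.sum_le_sum hterm)) (norm_nonneg _)
          zero_le_one
    _ = _ := by rw [one_mul, ← Finset.sum_mul, ← Finset.sum_mul, hX]; ring

/-- Growth of the subsequences of step `N`. -/
lemma growth_subsequence {ϖ : ℝ} (hϖ : 1 < ϖ) (hN : N ≠ 0) (hL : 0 ≤ L) (hM : 1 ≤ M)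
    {b : ℕ → ℝ} (hb : ∀ ℓ : ℕ, b ℓ ≤ L * M ^ ℓ * ϖ ^ ((ℓ : ℝ) ^ 2 / (2 * N))) {j : ℕ} (hj : j < N)
    (k : ℕ) : b (k * N + j) ≤ L * (M ^ N * ϖ ^ N) * (M ^ N * ϖ ^ (2 * N)) ^ k *
      (ϖ ^ N) ^ (k.choose 2) := by
  have hϖ0 : 0 < ϖ := by linarith
  refine (hb _).trans ?_
  have hNr : (0 : ℝ) < N := by exact_mod_cast Nat.pos_of_ne_zero hN
  have hjr : (j : ℝ) ≤ N := by exact_mod_cast hj.le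
  -- As j < N, the quotient (kN + j)²/(2N) is at most k²N/2 + kN + N/2, and k²/2 = (k choose 2) +
  -- k/2. The linear remainder in k is rounded up to 2N k and goes into the geometric constant.
  have h1 : ϖ ^ (((k * N + j : ℕ) : ℝ) ^ 2 / (2 * N)) ≤
      ϖ ^ ((N + 2 * N * k + N * k.choose 2 : ℕ) : ℝ) := by
    refine Real.rpow_le_rpow_of_exponent_le hϖ.le ?_
    rw [div_le_iff₀ (by positivity)]
    push_cast
    rw [Nat.cast_choose_two]
    have hk : (0 : ℝ) ≤ k := Nat.cast_nonneg k
    have hj0 : (0 : ℝ) ≤ j := Nat.cast_nonneg j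
    have h2 : (k * N + j : ℝ) ^ 2 ≤ (k * N) ^ 2 + 2 * (k * N) * N + N * N := by nlinarith [mul_nonneg hk hNr.le]
    nlinarith [mul_nonneg hk hNr.le, mul_nonneg (mul_nonneg hk hNr.le) hNr.le]
  rw [Real.rpow_natCast] at h1
  have h3 : M ^ (k * N + j) ≤ M ^ N * (M ^ N) ^ k := by
    rw [← pow_mul, ← pow_add]
    exact pow_le_pow_right₀ hM (by nlinarith)
  calc L * M ^ (k * N + j) * ϖ ^ (((k * N + j : ℕ) : ℝ) ^ 2 / (2 * N))
      ≤ L * (M ^ N * (M ^ N) ^ k) * ϖ ^ (N + 2 * N * k + N * k.choose 2) := by gcongr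
    _ = _ := by rw [mul_pow, pow_add, pow_add, pow_mul ϖ (2 * N), pow_mul ϖ N (k.choose 2)]; ring

/-- The values of a function on a `Q`-spiral: asymptotics at `0` and growth at infinity. -/
structure SpiralAsymptotic (Q lam : ℂ) (N : ℕ) (W L M : ℝ) (a : ℤ → ℂ) (c : ℕ → ℂ) : Prop where
  one_le : 1 ≤ M
  one_le_weight : 1 ≤ W
  coeff : ∀ i, ‖c i‖ ≤ L * M ^ i * W ^ (i.choose 2)
  neg : ∀ ℓ : ℤ, ℓ < 0 → ∀ m : ℕ, ‖a ℓ - ∑ i ∈ Finset.range m, c i * (Q ^ ℓ * lam) ^ i‖ ≤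
    L * M ^ m * W ^ (m.choose 2) * ‖Q ^ ℓ * lam‖ ^ m
  nonneg : ∀ ℓ : ℕ, ‖a ℓ‖ ≤ L * M ^ ℓ * ‖Q‖ ^ ((ℓ : ℝ) ^ 2 / (2 * N))

lemma SpiralAsymptotic.subspiral (h : SpiralAsymptotic Q lam N W L M a c) (hQ : 1 < ‖Q‖)
    (hN : N ≠ 0) : ∃ L' M' : ℝ, ∀ j < N,
      SeqAsymptotic ‖Q ^ N‖ W L' M' (fun k => (Q ^ N) ^ k * (Q ^ j * lam))
        (fun k => a (k * N + j)) c := by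
  have hM := h.one_le
  have hW := h.one_le_weight
  have hL : 0 ≤ L := (norm_nonneg _).trans (by simpa using h.coeff 0)
  have hQ0 := ne_zero_of_one_lt_norm hQ
  have hMN : M ≤ M ^ N * ‖Q‖ ^ (2 * N) :=
    (le_self_pow₀ hM hN).trans (le_mul_of_one_le_right (by positivity) (one_le_pow₀ hQ.le))
  have hLN : L ≤ L * (M ^ N * ‖Q‖ ^ N) := le_mul_of_one_le_right hL
    (one_le_mul_of_one_le_of_one_le (one_le_pow₀ hM) (one_le_pow₀ hQ.le))
  refine ⟨L * (M ^ N * ‖Q‖ ^ N), M ^ N * ‖Q‖ ^ (2 * N), fun j hj => ⟨hM.trans hMN, hW,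
    fun i => (h.coeff i).trans ?_, fun k hk m => ?_, fun k => ?_⟩⟩
  · gcongr
  · have e : (Q ^ N) ^ k * (Q ^ j * lam) = Q ^ (k * N + j : ℤ) * lam := by
      rw [zpow_add₀ hQ0, mul_comm k, zpow_mul, zpow_natCast, zpow_natCast, mul_assoc]
    -- k ≤ -1 and j < N place the whole index on the negative side, where the asymptotic estimate is
    -- available.
    have hneg : k * N + j < 0 := by
      have : (j : ℤ) < N := by exact_mod_cast hj
      nlinarith
    simp only [e]
    refine (h.neg _ hneg m).trans ?_
    gcongr
  · have := growth_subsequence hQ hN hL hM (b := fun ℓ => ‖a ℓ‖) h.nonneg hj k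
    rw [norm_pow]
    push_cast at this
    exact this

end FineSpiral

/-! ### Compatibility with `q`-difference equations -/

section Intertwining

variable {Q lam : ℂ} {N : ℕ} {a : ℤ → ℂ}

/-- The intertwining rule: z^d times the shift by Q^E after the transformation is, up to p^(d choose
2), multiplication by x^d and the shift by Q^(E - N d) before it. Reindexing by N d - E multiplies
the argument of Theta by p^d, and the functional equation does the rest. -/
lemma hasSum_lapTerm_shift (hQ : 1 < ‖Q‖) (hl : lam ≠ 0) {z : ℂ} (hz : z ≠ 0) (E : ℤ) (d : ℕ)
    {S : ℂ} (h : HasSum (lapTerm (Q ^ N) Q lam a (Q ^ E * z)) S) :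
    HasSum (lapTerm (Q ^ N) Q lam (fun ℓ => (Q ^ ℓ * lam) ^ d * a (ℓ + (E - N * d))) z)
      ((Q ^ N) ^ (d.choose 2) * z ^ d * S) := by
  have hQ0 := ne_zero_of_one_lt_norm hQ
  refine (Equiv.addRight (-E + N * d)).hasSum_iff.1 ?_
  refine Eq.mpr (congrArg (fun f : ℤ → ℂ => HasSum f _) (funext fun ℓ => ?_))
    (h.mul_left ((Q ^ N) ^ (d.choose 2) * z ^ d))
  simp only [Function.comp_apply, Equiv.coe_addRight, lapTerm]
  set p := Q ^ N with hp
  have hp0 : p ≠ 0 := pow_ne_zero _ hQ0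
  have hE : Q ^ E ≠ 0 := zpow_ne_zero _ hQ0
  have hℓ : Q ^ ℓ ≠ 0 := zpow_ne_zero _ hQ0
  set x := p * Q ^ ℓ * lam / (Q ^ E * z) with hx
  have hx0 : x ≠ 0 := div_ne_zero (mul_ne_zero (mul_ne_zero hp0 hℓ) hl) (mul_ne_zero hE hz)
  have e0 : Q ^ (ℓ + (-E + N * d)) = Q ^ ℓ * (Q ^ E)⁻¹ * p ^ d := by
    rw [zpow_add₀ hQ0, zpow_add₀ hQ0, zpow_neg, zpow_mul, zpow_natCast, zpow_natCast, mul_assoc]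
  have e1 : p * Q ^ (ℓ + (-E + N * d)) * lam / z = p ^ (d : ℤ) * x := by
    rw [e0, hx, zpow_natCast]; field_simp
  have e2 : ℓ + (-E + N * d) + (E - N * d) = ℓ := by ring
  rw [e1, e2, theta_zpow_mul hp0 hx0, tri_natCast_sub_one, zpow_natCast, zpow_natCast, e0]
  have e3 : (Q ^ ℓ * (Q ^ E)⁻¹ * p ^ d * lam) ^ d =
      p ^ (d.choose 2) * z ^ d * (p ^ (d.choose 2) * x ^ d) := by
    have h1 : Q ^ ℓ * (Q ^ E)⁻¹ * p ^ d * lam * p = p ^ d * (x * z) := by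
      rw [hx]; field_simp
    have h2 : p ^ (d.choose 2) * p ^ (d.choose 2) * p ^ d = (p ^ d) ^ d := by
      have h3 := tri_natCast_sub_one d
      have h4 := two_mul_tri ((d : ℤ) - 1)
      rw [h3] at h4
      have h5 : d.choose 2 + d.choose 2 + d = d * d := by zify; linarith
      rw [← pow_add, ← pow_add, h5, pow_mul]
    have h5 : (Q ^ ℓ * (Q ^ E)⁻¹ * p ^ d * lam) ^ d * p ^ d =
        p ^ (d.choose 2) * z ^ d * (p ^ (d.choose 2) * x ^ d) * p ^ d := by
      rw [← mul_pow, h1, mul_pow, ← h2, mul_pow]; ring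
    exact mul_right_cancel₀ (pow_ne_zero d hp0) h5
  rw [e3]
  have hpd : p ^ (d.choose 2) * x ^ d ≠ 0 := mul_ne_zero (pow_ne_zero _ hp0) (pow_ne_zero _ hx0)
  rw [mul_div_assoc, mul_assoc (p ^ d.choose 2 * z ^ d)]
  congr 1
  rw [← mul_div_assoc, mul_div_mul_left _ _ hpd]

/-- Shifting the base point of the spiral. -/
lemma lap_shift (hQ : 1 < ‖Q‖) (p lam z : ℂ) (k : ℤ) :
    lap p Q (Q ^ k * lam) N (fun ℓ => a (ℓ + k)) z = lap p Q lam N a z := by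
  have hQ0 := ne_zero_of_one_lt_norm hQ
  simp only [lap]
  congr 1
  rw [← (Equiv.addRight k).tsum_eq (lapTerm p Q lam a z)]
  refine tsum_congr fun ℓ => ?_
  simp only [lapTerm, Equiv.coe_addRight]
  rw [zpow_add₀ hQ0]
  congr 2
  ring

lemma offSpiral_shift (hQ : 1 < ‖Q‖) {lam z : ℂ} (k : ℤ) :
    offSpiral Q (Q ^ k * lam) z ↔ offSpiral Q lam z := by
  have hQ0 := ne_zero_of_one_lt_norm hQ
  constructor
  · intro h ℓ hz
    refine h (ℓ - k) ?_
    rw [hz, ← mul_assoc, ← zpow_add₀ hQ0, sub_add_cancel]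
  · intro h ℓ hz
    refine h (ℓ + k) ?_
    rw [hz, ← mul_assoc, ← zpow_add₀ hQ0]

lemma summable_lapTerm_shift (hQ : 1 < ‖Q‖) (p lam z : ℂ) (k : ℤ) :
    Summable (lapTerm p Q (Q ^ k * lam) (fun ℓ => a (ℓ + k)) z) ↔
      Summable (lapTerm p Q lam a z) := by
  have hQ0 := ne_zero_of_one_lt_norm hQ
  rw [← (Equiv.addRight k).summable_iff (f := lapTerm p Q lam a z)]
  refine summable_congr fun ℓ => ?_
  simp only [lapTerm, Equiv.coe_addRight, Function.comp_apply]
  rw [zpow_add₀ hQ0]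
  congr 2
  ring

end Intertwining

end QDiff

end

/-! ### q-difference equations as recursions: continuation and growth of solutions -/

noncomputable section

namespace QDiff

/-! ### `q`-difference operators acting on functions -/

/-- The shift exponent of the monomial `z ^ d σ_q ^ a`, where `q = Q ^ K`, after a Borel
transformation for which `ζ ^ d` replaces `(ζ σ_Q ^ (-D)) ^ d` up to a constant. -/
def shiftExp (K D : ℕ) (t : ℤ × ℕ) : ℤ := K * t.1 - D * t.2

/-- The coefficient that the Borel transformation attaches to `z ^ d`. -/
def borelFactor (Q : ℂ) (D d : ℕ) : ℂ := ((Q ^ D) ^ (d.choose 2))⁻¹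

/-- The action of the operator `∑ S(a, d) z ^ d σ_q ^ a` after a Borel transformation. -/
def opVal (Q : ℂ) (K D : ℕ) (S : ℤ × ℕ →₀ ℂ) (f : ℂ → ℂ) (z : ℂ) : ℂ :=
  ∑ t ∈ S.support, S t * borelFactor Q D t.2 * z ^ t.2 * f (Q ^ shiftExp K D t * z)

/-- The Borel transform of a polynomial. -/
def rhsVal (Q : ℂ) (D : ℕ) (A : ℂ[X]) (z : ℂ) : ℂ :=
  ∑ k ∈ A.support, A.coeff k * borelFactor Q D k * z ^ k

/-- `(I, J)` is a monomial of maximal shift exponent. -/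
structure IsTop (K D : ℕ) (S : ℤ × ℕ →₀ ℂ) (I : ℤ) (J : ℕ) : Prop where
  mem : (I, J) ∈ S.support
  le : ∀ t ∈ S.support, shiftExp K D t ≤ shiftExp K D (I, J)

/-- The coefficient of the maximal shift, as a polynomial. -/
def topPoly (Q : ℂ) (K D : ℕ) (S : ℤ × ℕ →₀ ℂ) (E : ℤ) : ℂ[X] :=
  ∑ t ∈ S.support with shiftExp K D t = E, C (S t * borelFactor Q D t.2) * X ^ t.2

variable {Q : ℂ} {K D N : ℕ} {S : ℤ × ℕ →₀ ℂ} {I : ℤ} {J : ℕ} {A : ℂ[X]} {s : Finset ℂ}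

lemma borelFactor_ne_zero (hQ0 : Q ≠ 0) (D d : ℕ) : borelFactor Q D d ≠ 0 :=
  inv_ne_zero (pow_ne_zero _ (pow_ne_zero _ hQ0))

lemma coeff_topPoly (hK : K ≠ 0) (h : IsTop K D S I J) :
    (topPoly Q K D S (shiftExp K D (I, J))).coeff J = S (I, J) * borelFactor Q D J := by
  rw [topPoly, finsetSum_coeff, Finset.sum_eq_single (I, J)]
  · rw [coeff_C_mul, coeff_X_pow, if_pos rfl, mul_one]
  · rintro ⟨a, d⟩ ht hne
    rw [coeff_C_mul, coeff_X_pow, if_neg, mul_zero]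
    rintro rfl
    refine hne ?_
    have := (Finset.mem_filter.1 ht).2
    simp only [shiftExp] at this
    have h2 : (K : ℤ) * a = K * I := by linarith
    rw [mul_left_cancel₀ (by exact_mod_cast hK) h2]
  · intro h1
    exact absurd (Finset.mem_filter (p := fun t => shiftExp K D t = shiftExp K D (I, J)).2
      ⟨h.mem, rfl⟩) h1

lemma coeff_topPoly_ne_zero (hK : K ≠ 0) (hQ0 : Q ≠ 0) (h : IsTop K D S I J) :
    (topPoly Q K D S (shiftExp K D (I, J))).coeff J ≠ 0 := by
  rw [coeff_topPoly hK h]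
  exact mul_ne_zero (Finsupp.mem_support_iff.1 h.mem) (borelFactor_ne_zero hQ0 _ _)

lemma topPoly_ne_zero (hK : K ≠ 0) (hQ0 : Q ≠ 0) (h : IsTop K D S I J) :
    topPoly Q K D S (shiftExp K D (I, J)) ≠ 0 := fun h0 =>
  coeff_topPoly_ne_zero hK hQ0 h (by rw [h0, coeff_zero])

lemma eval_topPoly (E : ℤ) (w : ℂ) : (topPoly Q K D S E).eval w =
    ∑ t ∈ S.support with shiftExp K D t = E, S t * borelFactor Q D t.2 * w ^ t.2 := by
  simp [topPoly, eval_finsetSum]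

/-- The part of `opVal` with non-maximal shift. -/
def lowVal (Q : ℂ) (K D : ℕ) (S : ℤ × ℕ →₀ ℂ) (E : ℤ) (f : ℂ → ℂ) (z : ℂ) : ℂ :=
  ∑ t ∈ S.support with shiftExp K D t < E,
    S t * borelFactor Q D t.2 * z ^ t.2 * f (Q ^ shiftExp K D t * z)

lemma opVal_eq (h : IsTop K D S I J) (f : ℂ → ℂ) (w : ℂ) :
    opVal Q K D S f w = (topPoly Q K D S (shiftExp K D (I, J))).eval w *
      f (Q ^ shiftExp K D (I, J) * w) + lowVal Q K D S (shiftExp K D (I, J)) f w := by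
  rw [opVal, lowVal, eval_topPoly, Finset.sum_mul,
    ← Finset.sum_filter_add_sum_filter_not S.support
      (fun t => shiftExp K D t = shiftExp K D (I, J))]
  congr 1
  · exact Finset.sum_congr rfl fun t ht => by rw [(Finset.mem_filter.1 ht).2]
  · refine Finset.sum_congr (Finset.filter_congr fun t ht => ?_) fun _ _ => rfl
    exact ⟨fun hne => lt_of_le_of_ne (h.le t ht) hne, fun hlt => hlt.ne⟩

/-- The equation solved for the value at the maximal shift. -/
def stepVal (Q : ℂ) (K D : ℕ) (S : ℤ × ℕ →₀ ℂ) (A : ℂ[X]) (E : ℤ) (f : ℂ → ℂ) (z : ℂ) : ℂ :=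
  (rhsVal Q D A (Q ^ (-E) * z) - lowVal Q K D S E f (Q ^ (-E) * z)) /
    (topPoly Q K D S E).eval (Q ^ (-E) * z)

lemma opVal_eq_iff (hQ0 : Q ≠ 0) (h : IsTop K D S I J) {f : ℂ → ℂ} {z : ℂ}
    (hz : (topPoly Q K D S (shiftExp K D (I, J))).eval (Q ^ (-shiftExp K D (I, J)) * z) ≠ 0) :
    opVal Q K D S f (Q ^ (-shiftExp K D (I, J)) * z) =
        rhsVal Q D A (Q ^ (-shiftExp K D (I, J)) * z) ↔
      f z = stepVal Q K D S A (shiftExp K D (I, J)) f z := by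
  rw [opVal_eq h, stepVal, eq_div_iff hz, ← mul_assoc, ← zpow_add₀ hQ0, add_neg_cancel, zpow_zero,
    one_mul, mul_comm (f z)]
  constructor <;> intro h <;> linear_combination h

lemma lowVal_congr {E : ℤ} {f g : ℂ → ℂ} {w : ℂ}
    (h : ∀ k : ℤ, k < E → f (Q ^ k * w) = g (Q ^ k * w)) :
    lowVal Q K D S E f w = lowVal Q K D S E g w :=
  Finset.sum_congr rfl fun t ht => by rw [h _ (Finset.mem_filter.1 ht).2]

/-- Only the values at Q^k z with k < 0, points closer to 0, enter the solved equation. This is what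
makes it a recursion directed outwards from the origin. -/
lemma stepVal_congr (hQ0 : Q ≠ 0) {E : ℤ} {f g : ℂ → ℂ} {z : ℂ}
    (h : ∀ k : ℤ, k < 0 → f (Q ^ k * z) = g (Q ^ k * z)) :
    stepVal Q K D S A E f z = stepVal Q K D S A E g z := by
  rw [stepVal, stepVal, lowVal_congr (g := g) fun k hk => ?_]
  rw [← mul_assoc, ← zpow_add₀ hQ0]
  exact h _ (by omega)

lemma norm_zpow_mul_lt (hQ : 1 < ‖Q‖) {r : ℝ} {n : ℕ} {z : ℂ} (hz : ‖z‖ < r * ‖Q‖ ^ (n + 1))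
    {k : ℤ} (hk : k < 0) : ‖Q ^ k * z‖ < r * ‖Q‖ ^ n := by
  have h0 : 0 < ‖Q‖ := by linarith
  have h1 : ‖Q‖ ^ k ≤ ‖Q‖⁻¹ := by
    rw [← zpow_neg_one]
    exact zpow_le_zpow_right₀ hQ.le (by omega)
  rw [norm_mul, norm_zpow]
  calc ‖Q‖ ^ k * ‖z‖ ≤ ‖Q‖⁻¹ * ‖z‖ := by gcongr
    _ < ‖Q‖⁻¹ * (r * ‖Q‖ ^ (n + 1)) := by gcongr
    _ = r * ‖Q‖ ^ n := by rw [pow_succ]; field_simp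

lemma exists_norm_lt_mul_pow (hQ : 1 < ‖Q‖) {r : ℝ} (hr : 0 < r) (z : ℂ) :
    ∃ n : ℕ, ‖z‖ < r * ‖Q‖ ^ n := by
  obtain ⟨n, hn⟩ := pow_unbounded_of_one_lt (‖z‖ / r) hQ
  exact ⟨n, by rwa [div_lt_iff₀ hr, mul_comm] at hn⟩

/-- Construction of a function by recursion along `z ↦ Q z`. -/
lemma exists_recursion (hQ : 1 < ‖Q‖) (f : ℂ → ℂ) {r : ℝ} (hr : 0 < r)
    (Φ : (ℂ → ℂ) → ℂ → ℂ)
    (hΦ : ∀ (g₁ g₂ : ℂ → ℂ) (z : ℂ), (∀ k : ℤ, k < 0 → g₁ (Q ^ k * z) = g₂ (Q ^ k * z)) →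
      Φ g₁ z = Φ g₂ z) :
    ∃ F : ℂ → ℂ, (∀ z, ‖z‖ < r → F z = f z) ∧ ∀ z, ¬ ‖z‖ < r → F z = Φ F z := by
  classical
  -- Iterating n times gives the final values on the disc of radius r |Q|^n. The solution is read
  -- off at any sufficiently large n.
  let G : ℕ → ℂ → ℂ := fun n =>
    Nat.rec f (fun _ g z => if ‖z‖ < r then f z else Φ g z) n
  have hG : ∀ n z, G (n + 1) z = if ‖z‖ < r then f z else Φ (G n) z := fun n z => rfl
  have h1 : ∀ n z, ‖z‖ < r * ‖Q‖ ^ n → G (n + 1) z = G n z := by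
    intro n
    induction n with
    | zero =>
      intro z hz
      rw [hG, if_pos (by simpa using hz)]
      rfl
    | succ n ih =>
      intro z hz
      rw [hG (n + 1), hG n]
      split_ifs with h
      · rfl
      · exact hΦ _ _ _ fun k hk => ih _ (norm_zpow_mul_lt hQ hz hk)
  have h2 : ∀ n m z, ‖z‖ < r * ‖Q‖ ^ n → n ≤ m → G m z = G n z := by
    intro n m z hz hnm
    induction m, hnm using Nat.le_induction with
    | base => rfl
    | succ m hm ih =>
      rw [h1 m z, ih]
      refine hz.trans_le ?_
      gcongr
      exact hQ.le
  choose ν hν using exists_norm_lt_mul_pow hQ hr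
  have h3 : ∀ n z, ‖z‖ < r * ‖Q‖ ^ n → G (ν z) z = G n z := by
    intro n z hz
    rcases le_total n (ν z) with h | h
    · exact h2 _ _ _ hz h
    · exact (h2 _ _ _ (hν z) h).symm
  refine ⟨fun z => G (ν z) z, fun z hz => h3 0 z (by simpa using hz), fun z hz => ?_⟩
  have h4 : ‖z‖ < r * ‖Q‖ ^ (ν z + 1) := by
    refine (hν z).trans_le ?_
    gcongr
    · exact hQ.le
    · omega
  change G (ν z) z = _
  rw [h3 _ z h4, hG, if_neg hz]
  exact hΦ _ _ _ fun k hk => (h3 _ _ (norm_zpow_mul_lt hQ h4 hk)).symm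

lemma analyticAt_const_mul' (c z : ℂ) : AnalyticAt ℂ (fun z => c * z) z :=
  analyticAt_const.mul analyticAt_id

lemma analyticAt_stepVal (hQ0 : Q ≠ 0) {E : ℤ} {f : ℂ → ℂ} {z : ℂ}
    (hz : (topPoly Q K D S E).eval (Q ^ (-E) * z) ≠ 0)
    (hf : ∀ k : ℤ, k < 0 → AnalyticAt ℂ f (Q ^ k * z)) :
    AnalyticAt ℂ (stepVal Q K D S A E f) z := by
  refine AnalyticAt.div (AnalyticAt.sub ?_ ?_) ?_ hz
  · refine Finset.analyticAt_fun_sum _ fun k _ => ?_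
    exact analyticAt_const.mul ((analyticAt_const_mul' _ z).pow k)
  · refine Finset.analyticAt_fun_sum _ fun t ht => ?_
    refine (analyticAt_const.mul ((analyticAt_const_mul' _ z).pow _)).mul ?_
    have e : (fun z => f (Q ^ shiftExp K D t * (Q ^ (-E) * z))) =
        fun z => f (Q ^ (shiftExp K D t - E) * z) := by
      funext z; rw [← mul_assoc, ← zpow_add₀ hQ0, sub_eq_add_neg]
    rw [e]
    exact (hf _ (by have := (Finset.mem_filter.1 ht).2; omega)).fun_comp
      (analyticAt_const_mul' _ z)
  · simp only [eval_topPoly]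
    refine Finset.analyticAt_fun_sum _ fun t _ => ?_
    exact analyticAt_const.mul ((analyticAt_const_mul' _ z).pow _)

lemma meromorphicAt_stepVal (hQ0 : Q ≠ 0) {E : ℤ} {f : ℂ → ℂ} {z : ℂ}
    (hf : ∀ k : ℤ, k < 0 → MeromorphicAt f (Q ^ k * z)) :
    MeromorphicAt (stepVal Q K D S A E f) z := by
  refine MeromorphicAt.div (MeromorphicAt.sub ?_ ?_) ?_
  · refine MeromorphicAt.fun_sum fun k _ => ?_
    exact (analyticAt_const.mul ((analyticAt_const_mul' _ z).pow k)).meromorphicAt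
  · refine MeromorphicAt.fun_sum fun t ht => ?_
    refine (analyticAt_const.mul ((analyticAt_const_mul' _ z).pow _)).meromorphicAt.mul ?_
    have e : (fun z => f (Q ^ shiftExp K D t * (Q ^ (-E) * z))) =
        fun z => f (Q ^ (shiftExp K D t - E) * z) := by
      funext z; rw [← mul_assoc, ← zpow_add₀ hQ0, sub_eq_add_neg]
    rw [e]
    exact (hf _ (by have := (Finset.mem_filter.1 ht).2; omega)).comp_analyticAt
      (analyticAt_const_mul' _ z)
  · simp only [eval_topPoly]
    refine MeromorphicAt.fun_sum fun t _ => ?_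
    exact (analyticAt_const.mul ((analyticAt_const_mul' _ z).pow _)).meromorphicAt

/-- A solution near `0` of a `q`-difference equation extends to `ℂ*`, with singularities only on
the spirals. -/
theorem exists_extension (hQ : 1 < ‖Q‖) (hs : (0 : ℂ) ∉ s)
    (htop : IsTop K D S I J)
    (hroots : ∀ ρ : ℂ, ρ ≠ 0 → (topPoly Q K D S (shiftExp K D (I, J))).eval ρ = 0 → ρ ∈ s)
    {f : ℂ → ℂ} {R : ℝ} (hR : 0 < R)
    (hf : ∀ z ∈ regular Q s, ‖z‖ < R → AnalyticAt ℂ f z)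
    (hfm : ∀ z, z ≠ 0 → ‖z‖ < R → MeromorphicAt f z)
    {R₁ : ℝ} (hR₁ : 0 < R₁)
    (heq : ∀ z ∈ regular Q s, ‖z‖ < R₁ → opVal Q K D S f z = rhsVal Q D A z) :
    ∃ F : ℂ → ℂ, ∃ r : ℝ, 0 < r ∧ (∀ z, ‖z‖ < r → F z = f z) ∧
      AnalyticOnNhd ℂ F (regular Q s) ∧ (∀ z, z ≠ 0 → MeromorphicAt F z) ∧
      ∀ z ∈ regular Q s, opVal Q K D S F z = rhsVal Q D A z := by
  have hQ0 := ne_zero_of_one_lt_norm hQ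
  set E := shiftExp K D (I, J) with hE
  have hQE : 0 < ‖Q‖ ^ E := zpow_pos (by linarith) _
  -- The equation giving the value at z is taken at Q^(-E) z, hence the bound by |Q|^E R₁.
  obtain ⟨r, hr, hrR, hrR₁⟩ : ∃ r : ℝ, 0 < r ∧ r < R ∧ r < ‖Q‖ ^ E * R₁ := by
    obtain ⟨r, h1, h2⟩ := exists_between (lt_min hR (mul_pos hQE hR₁))
    exact ⟨r, h1, h2.trans_le (min_le_left _ _), h2.trans_le (min_le_right _ _)⟩
  obtain ⟨F, hF1, hF2⟩ := exists_recursion hQ f hr (stepVal Q K D S A E)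
    fun g₁ g₂ z h => stepVal_congr hQ0 h
  have htop0 : ∀ z ∈ regular Q s, (topPoly Q K D S E).eval (Q ^ (-E) * z) ≠ 0 := by
    intro z hz h0
    have h1 := (zpow_mul_mem_regular hQ (-E) z).2 hz
    exact h1.2 ⟨_, hroots _ h1.1 h0, 0, by simp⟩
  have hstep : ∀ z ∈ regular Q s, F z = stepVal Q K D S A E F z := by
    intro z hz
    by_cases hzr : ‖z‖ < r
    · have h1 : f z = stepVal Q K D S A E f z := by
        refine (opVal_eq_iff hQ0 htop (htop0 z hz)).1
          (heq _ ((zpow_mul_mem_regular hQ _ z).2 hz) ?_)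
        rw [norm_mul, norm_zpow, zpow_neg, inv_mul_lt_iff₀ hQE]
        exact hzr.trans hrR₁
      rw [hF1 z hzr, h1]
      refine stepVal_congr hQ0 fun k hk => (hF1 _ ?_).symm
      have := norm_zpow_mul_lt hQ (r := r) (n := 0) (z := z) (hzr.trans_le (by
        rw [zero_add, pow_one]; exact le_mul_of_one_le_right hr.le hQ.le)) hk
      simpa using this
    · exact hF2 z hzr
  have hFf : ∀ z, ‖z‖ < r → F =ᶠ[𝓝 z] f := fun z hz => by
    filter_upwards [(isOpen_lt continuous_norm continuous_const).mem_nhds hz] with w hw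
    exact hF1 w hw
  have hreg := isOpen_regular hQ hs
  have hana : ∀ n : ℕ, ∀ z ∈ regular Q s, ‖z‖ < r * ‖Q‖ ^ n → AnalyticAt ℂ F z := by
    intro n
    induction n with
    | zero =>
      intro z hz hzn
      have hzr : ‖z‖ < r := by simpa using hzn
      exact (hf z hz (hzr.trans hrR)).congr (hFf z hzr).symm
    | succ n ih =>
      intro z hz hzn
      have h1 : F =ᶠ[𝓝 z] stepVal Q K D S A E F := by
        filter_upwards [hreg.mem_nhds hz] with w hw using hstep w hw
      refine (analyticAt_stepVal hQ0 (htop0 z hz) fun k hk => ?_).congr h1.symm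
      exact ih _ ((zpow_mul_mem_regular hQ _ z).2 hz) (norm_zpow_mul_lt hQ hzn hk)
  have hmer : ∀ n : ℕ, ∀ z, z ≠ 0 → ‖z‖ < r * ‖Q‖ ^ n → MeromorphicAt F z := by
    intro n
    induction n with
    | zero =>
      intro z hz hzn
      have hzr : ‖z‖ < r := by simpa using hzn
      exact (hfm z hz (hzr.trans hrR)).congr
        ((hFf z hzr).symm.filter_mono nhdsWithin_le_nhds)
    | succ n ih =>
      intro z hz hzn
      have h1 : F =ᶠ[𝓝[≠] z] stepVal Q K D S A E F := by
        filter_upwards [eventually_mem_regular hQ hs hz] with w hw using hstep w hw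
      refine (meromorphicAt_stepVal hQ0 fun k hk => ?_).congr h1.symm
      exact ih _ (mul_ne_zero (zpow_ne_zero _ hQ0) hz) (norm_zpow_mul_lt hQ hzn hk)
  refine ⟨F, r, hr, hF1, fun z hz => ?_, fun z hz => ?_, fun z hz => ?_⟩
  · obtain ⟨n, hn⟩ := exists_norm_lt_mul_pow hQ hr z
    exact hana n z hz hn
  · obtain ⟨n, hn⟩ := exists_norm_lt_mul_pow hQ hr z
    exact hmer n z hz hn
  · have hz' : Q ^ E * z ∈ regular Q s := (zpow_mul_mem_regular hQ _ z).2 hz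
    have h1 := (opVal_eq_iff hQ0 htop (htop0 _ hz')).2 (hstep _ hz')
    rw [← mul_assoc, ← zpow_add₀ hQ0, neg_add_cancel, zpow_zero, one_mul] at h1
    exact h1

/-! ### Growth of the solutions -/

/-- The Gaussian ϖ^(ℓ²/(2N)) solves the recursion up to bounded factors, since ℓτ/N + (ℓ - τ)²/(2N)
= ℓ²/(2N) + τ²/(2N) and the lags τ are bounded. Each step costs one factor M. -/
lemma growth_of_recursion {ϖ : ℝ} (hϖ : 1 < ϖ) (hN : N ≠ 0) {ι : Type*} (T : Finset ι) (τ : ι → ℕ)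
    (hτ : ∀ i ∈ T, 1 ≤ τ i) {C₀ C₁ C₂ G : ℝ} (hC₁ : 0 ≤ C₁) (hC₂ : 0 ≤ C₂) (hG : 1 ≤ G) :
    ∃ L M : ℝ, C₀ ≤ L ∧ 1 ≤ L ∧ 1 ≤ M ∧ ∀ x : ℤ → ℝ, (∀ ℓ ≤ 0, x ℓ ≤ C₀) →
      (∀ ℓ : ℕ, 1 ≤ ℓ → x ℓ ≤ C₁ * G ^ ℓ +
        ∑ i ∈ T, C₂ * ϖ ^ ((ℓ : ℝ) * τ i / N) * x (ℓ - τ i)) →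
      ∀ ℓ : ℕ, x ℓ ≤ L * M ^ ℓ * ϖ ^ ((ℓ : ℝ) ^ 2 / (2 * N)) := by
  have hϖ0 : 0 < ϖ := by linarith
  have hNr : (0 : ℝ) < N := by exact_mod_cast Nat.pos_of_ne_zero hN
  obtain ⟨B, hB⟩ : ∃ B : ℕ, ∀ i ∈ T, τ i ≤ B :=
    ⟨T.sup τ, fun i hi => Finset.le_sup hi⟩
  set C₃ := T.card * (C₂ * ϖ ^ ((B : ℝ) ^ 2 / N)) with hC₃
  have hC₃0 : 0 ≤ C₃ := by positivity
  set L := max C₀ 1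
  set M := max G (C₁ * G + C₃) with hMdef
  have hL : 1 ≤ L := le_max_right _ _
  have hM : 1 ≤ M := hG.trans (le_max_left _ _)
  refine ⟨L, M, le_max_left _ _, hL, hM, fun x hx0 hx ℓ => ?_⟩
  induction ℓ using Nat.strong_induction_on with
  | _ ℓ ih =>
    rcases Nat.eq_zero_or_pos ℓ with rfl | hℓ
    · have := hx0 0 le_rfl
      have h2 : (C₀ : ℝ) ≤ L := le_max_left _ _
      simpa using this.trans h2
    · refine (hx ℓ hℓ).trans ?_
      set w := ϖ ^ ((ℓ : ℝ) ^ 2 / (2 * N)) with hw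
      have hw1 : 1 ≤ w := Real.one_le_rpow hϖ.le (by positivity)
      obtain ⟨n, rfl⟩ : ∃ n, ℓ = n + 1 := ⟨ℓ - 1, by omega⟩
      have hterm : ∀ i ∈ T, C₂ * ϖ ^ (((n + 1 : ℕ) : ℝ) * τ i / N) *
          x (((n + 1 : ℕ) : ℤ) - τ i) ≤ C₂ * ϖ ^ ((B : ℝ) ^ 2 / N) * (L * M ^ n * w) := by
        intro i hi
        have hτi := hτ i hi
        have hBi : (τ i : ℝ) ≤ B := by exact_mod_cast hB i hi
        have hτ0 : (0 : ℝ) ≤ τ i := by positivity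
        rw [mul_assoc, mul_assoc]
        refine mul_le_mul_of_nonneg_left ?_ hC₂
        rcases le_or_gt (τ i) (n + 1) with h | h
        · obtain ⟨k, hk⟩ : ∃ k, n + 1 = k + τ i := ⟨n + 1 - τ i, by omega⟩
          have e : (((n + 1 : ℕ) : ℤ) - τ i) = (k : ℤ) := by omega
          rw [e]
          have h3 := ih k (by omega)
          have hkr : ((n + 1 : ℕ) : ℝ) = k + τ i := by exact_mod_cast hk
          have hMk : M ^ k ≤ M ^ n := pow_le_pow_right₀ hM (by omega)
          calc ϖ ^ (((n + 1 : ℕ) : ℝ) * τ i / N) * x k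
              ≤ ϖ ^ (((n + 1 : ℕ) : ℝ) * τ i / N) *
                (L * M ^ k * ϖ ^ ((k : ℝ) ^ 2 / (2 * N))) := by gcongr
            _ = L * M ^ k * (ϖ ^ (((n + 1 : ℕ) : ℝ) * τ i / N) * ϖ ^ ((k : ℝ) ^ 2 / (2 * N))) := by
                ring
            _ = L * M ^ k * (ϖ ^ ((τ i : ℝ) ^ 2 / (2 * N)) * w) := by
                rw [hw, ← Real.rpow_add hϖ0, ← Real.rpow_add hϖ0, hkr]
                congr 2
                field_simp
                ring
            _ ≤ L * M ^ n * (ϖ ^ ((B : ℝ) ^ 2 / N) * w) := by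
                have : ϖ ^ ((τ i : ℝ) ^ 2 / (2 * N)) ≤ ϖ ^ ((B : ℝ) ^ 2 / N) := by
                  refine Real.rpow_le_rpow_of_exponent_le hϖ.le ?_
                  rw [div_le_div_iff₀ (by positivity) hNr]
                  have h5 : (τ i : ℝ) ^ 2 ≤ (B : ℝ) ^ 2 := by gcongr
                  nlinarith [sq_nonneg (B : ℝ)]
                gcongr
            _ = _ := by ring
        -- Here the lag reaches back beyond the origin, so only the bound C₀ is used. This occurs
        -- only for n + 1 < τ i ≤ B, so the coefficient is bounded too.
        · have h3 := hx0 (((n + 1 : ℕ) : ℤ) - τ i) (by omega)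
          have h4 : x (((n + 1 : ℕ) : ℤ) - τ i) ≤ L := h3.trans (le_max_left _ _)
          have h5 : ϖ ^ (((n + 1 : ℕ) : ℝ) * τ i / N) ≤ ϖ ^ ((B : ℝ) ^ 2 / N) := by
            refine Real.rpow_le_rpow_of_exponent_le hϖ.le ?_
            have h6 : ((n + 1 : ℕ) : ℝ) ≤ τ i := by exact_mod_cast h.le
            have h7 : ((n + 1 : ℕ) : ℝ) * τ i ≤ (B : ℝ) ^ 2 := by nlinarith
            gcongr
          have h8 : L ≤ L * M ^ n * w := by
            rw [mul_assoc]
            exact le_mul_of_one_le_right (by linarith)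
              (one_le_mul_of_one_le_of_one_le (one_le_pow₀ hM) hw1)
          calc ϖ ^ (((n + 1 : ℕ) : ℝ) * τ i / N) * x (((n + 1 : ℕ) : ℤ) - τ i)
              ≤ ϖ ^ (((n + 1 : ℕ) : ℝ) * τ i / N) * L := by gcongr
            _ ≤ ϖ ^ ((B : ℝ) ^ 2 / N) * (L * M ^ n * w) := by gcongr
      have hGM : G ^ n ≤ M ^ n := pow_le_pow_left₀ (by linarith) (le_max_left _ _) n
      calc C₁ * G ^ (n + 1) + ∑ i ∈ T, C₂ * ϖ ^ (((n + 1 : ℕ) : ℝ) * τ i / N) *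
            x (((n + 1 : ℕ) : ℤ) - τ i)
          ≤ C₁ * G * (L * M ^ n * w) + C₃ * (L * M ^ n * w) := by
            refine add_le_add ?_ ?_
            · rw [pow_succ, mul_comm (G ^ n), ← mul_assoc]
              refine mul_le_mul_of_nonneg_left ?_ (by positivity)
              calc G ^ n ≤ M ^ n := hGM
                _ = 1 * M ^ n * 1 := by ring
                _ ≤ L * M ^ n * w := by gcongr
            · refine (Finset.sum_le_card_nsmul _ _ _ hterm).trans (le_of_eq ?_)
              rw [nsmul_eq_mul, hC₃]; ring
        _ = (C₁ * G + C₃) * (L * M ^ n * w) := by ring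
        _ ≤ M * (L * M ^ n * w) := by
            gcongr
            exact le_max_right _ _
        _ = L * M ^ (n + 1) * w := by rw [pow_succ]; ring

lemma pow_card_le_norm_prod {δ : ℝ} (hδ : 0 ≤ δ) (w : ℂ) (m : Multiset ℂ)
    (h : ∀ ρ ∈ m, δ ≤ ‖w - ρ‖) : δ ^ m.card ≤ ‖(m.map fun ρ => w - ρ).prod‖ := by
  induction m using Multiset.induction_on with
  | empty => simp
  | cons ρ m ih =>
    rw [Multiset.card_cons, pow_succ, Multiset.map_cons, Multiset.prod_cons, norm_mul, mul_comm]
    exact mul_le_mul (h ρ (Multiset.mem_cons_self _ _))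
      (ih fun x hx => h x (Multiset.mem_cons_of_mem hx)) (by positivity) (norm_nonneg _)

/-- Lower bound of a polynomial away from its roots. -/
lemma norm_eval_ge {b : ℂ[X]} {δ : ℝ} (hδ : 0 ≤ δ) (w : ℂ)
    (h : ∀ ρ ∈ b.roots, δ ≤ ‖w - ρ‖) : ‖b.leadingCoeff‖ * δ ^ b.natDegree ≤ ‖b.eval w‖ := by
  have hs : b.Splits := IsAlgClosed.splits b
  have h1 : b.eval w = b.leadingCoeff * (b.roots.map fun ρ => w - ρ).prod := by
    conv_lhs => rw [hs.eq_prod_roots]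
    rw [eval_mul, eval_C, eval_multiset_prod, Multiset.map_map]
    simp
  rw [h1, norm_mul, hs.natDegree_eq_card_roots]
  gcongr
  exact pow_card_le_norm_prod hδ w _ h

/-- Growth of a solution on a spiral-shaped domain. -/
theorem exists_growth (hQ : 1 < ‖Q‖) (hK : K ≠ 0) (hN : N ≠ 0)
    (htop : IsTop K D S I J)
    (hslope : ∀ t ∈ S.support,
      ((t.2 : ℤ) - J) * N ≤ shiftExp K D (I, J) - shiftExp K D t)
    (hroots : ∀ ρ : ℂ, ρ ≠ 0 → (topPoly Q K D S (shiftExp K D (I, J))).eval ρ = 0 → ρ ∈ s)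
    {lam : ℂ} {U : Set ℂ} (hU : IsFundamental Q s lam U) {F : ℂ → ℂ}
    (heq : ∀ z ∈ regular Q s, opVal Q K D S F z = rhsVal Q D A z) {C₀ : ℝ}
    (hC₀ : ∀ ℓ : ℤ, ℓ ≤ 0 → ∀ u ∈ U, ‖F (Q ^ ℓ * u)‖ ≤ C₀) :
    ∃ L M : ℝ, C₀ ≤ L ∧ 1 ≤ L ∧ 1 ≤ M ∧
      ∀ (ℓ : ℕ), ∀ u ∈ U, ‖F (Q ^ (ℓ : ℤ) * u)‖ ≤ L * M ^ ℓ * ‖Q‖ ^ ((ℓ : ℝ) ^ 2 / (2 * N)) := by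
  have hQ0 := ne_zero_of_one_lt_norm hQ
  set E := shiftExp K D (I, J) with hE
  set b := topPoly Q K D S E with hb
  have hϖ0 : 0 < ‖Q‖ := by linarith
  have hbJ : b.coeff J ≠ 0 := coeff_topPoly_ne_zero hK hQ0 htop
  have hb0 : b ≠ 0 := topPoly_ne_zero hK hQ0 htop
  -- Monomials with the same shift as (I, J) have degree at most J by the slope condition: (I, J) is
  -- the right end of its face.
  have hdeg : b.natDegree = J := by
    refine le_antisymm ?_ (le_natDegree_of_ne_zero hbJ)
    rw [hb, topPoly]
    refine natDegree_sum_le_of_forall_le _ _ fun t ht => (natDegree_C_mul_X_pow_le _ _).trans ?_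
    have h1 := hslope t (Finset.mem_filter.1 ht).1
    rw [(Finset.mem_filter.1 ht).2, sub_self] at h1
    have hN' : (0 : ℤ) < N := by exact_mod_cast Nat.pos_of_ne_zero hN
    by_contra hlt
    push Not at hlt
    have : (0 : ℤ) < (t.2 : ℤ) - J := by omega
    nlinarith
  obtain ⟨δ, hδ, hdist⟩ := hU.dist_orbit hQ
  obtain ⟨m, Mu, hm, hbd⟩ := hU.bounds
  have hregU := hU.orbit_subset_regular hQ
  set δ' := min δ 1 with hδ'
  have hδ'0 : 0 < δ' := lt_min hδ one_pos
  set c₁ := ‖b.leadingCoeff‖ * δ' ^ J with hc₁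
  have hc₁0 : 0 < c₁ := mul_pos (norm_pos_iff.2 (leadingCoeff_ne_zero.2 hb0)) (by positivity)
  -- On the orbit the distance to every root, 0 included, is at least a fixed multiple of |w|, so
  -- the polynomial is bounded below by its leading term.
  have hlow : ∀ w ∈ orbit Q U, c₁ * ‖w‖ ^ J ≤ ‖b.eval w‖ := by
    intro w hw
    have h1 := norm_eval_ge (b := b) (δ := δ' * ‖w‖) (by positivity) w (fun ρ hρ => by
      by_cases hρ0 : ρ = 0
      · rw [hρ0, sub_zero]
        exact mul_le_of_le_one_left (norm_nonneg _) (min_le_right _ _)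
      · refine le_trans ?_ (hdist w hw ρ ⟨ρ, hroots ρ hρ0 (isRoot_of_mem_roots hρ), 0, by simp⟩)
        gcongr
        exact min_le_left _ _)
    rw [hdeg, mul_pow, ← mul_assoc] at h1
    exact h1
  -- bounds for the powers of `w`
  set r₁ := ‖Q‖ ^ (-E) * m with hr₁
  set r₂ := ‖Q‖ ^ (-E) * Mu with hr₂
  have hr₁0 : 0 < r₁ := by positivity
  have hw_eq : ∀ (ℓ : ℕ), ∀ u ∈ U, ∀ e : ℤ, ‖Q ^ (-E) * (Q ^ (ℓ : ℤ) * u)‖ ^ e ≤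
      (‖Q‖ ^ (e * ℓ : ℤ)) * (r₁ ^ e + r₂ ^ e) := by
    intro ℓ u hu e
    obtain ⟨hu1, hu2⟩ := hbd u hu
    have e1 : ‖Q ^ (-E) * (Q ^ (ℓ : ℤ) * u)‖ ^ e =
        ‖Q‖ ^ (e * ℓ : ℤ) * (‖Q‖ ^ (-E) * ‖u‖) ^ e := by
      rw [norm_mul, norm_mul, norm_zpow, norm_zpow, mul_comm e, zpow_mul, ← mul_zpow]
      congr 1; ring
    rw [e1]
    refine mul_le_mul_of_nonneg_left ?_ (by positivity)
    exact zpow_le_add_zpow hr₁0 (by rw [hr₁]; gcongr) (by rw [hr₂]; gcongr) e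
  have hr₂0 : 0 ≤ r₂ := by
    obtain ⟨h1, h2⟩ := hbd _ hU.mem
    have : 0 ≤ Mu := by linarith
    positivity
  -- the constants of the recursion
  set CA : ℝ := ∑ k ∈ A.support, c₁⁻¹ * ‖A.coeff k * borelFactor Q D k‖ *
    (r₁ ^ ((k : ℤ) - J) + r₂ ^ ((k : ℤ) - J)) with hCA
  set G : ℝ := ‖Q‖ ^ A.natDegree with hG
  set C₂ : ℝ := ∑ t ∈ S.support, c₁⁻¹ * ‖S t * borelFactor Q D t.2‖ *
    (r₁ ^ ((t.2 : ℤ) - J) + r₂ ^ ((t.2 : ℤ) - J)) with hC₂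
  obtain ⟨L, M, hL0, hL, hM, hmain⟩ := growth_of_recursion (N := N) hQ hN
    (S.support.filter fun t => shiftExp K D t < E) (fun t => (E - shiftExp K D t).toNat)
    (fun t ht => by have := (Finset.mem_filter.1 ht).2; omega)
    (C₀ := C₀) (C₁ := CA) (C₂ := C₂) (G := G)
    (Finset.sum_nonneg fun k _ => by positivity) (Finset.sum_nonneg fun k _ => by positivity)
    (one_le_pow₀ hQ.le)
  refine ⟨L, M, hL0, hL, hM, fun ℓ u hu => ?_⟩
  refine hmain (fun ℓ => ‖F (Q ^ ℓ * u)‖) (fun ℓ hℓ => hC₀ ℓ hℓ u hu) (fun ℓ hℓ => ?_) ℓ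
  have hzU : Q ^ (ℓ : ℤ) * u ∈ orbit Q U := ⟨ℓ, u, hu, rfl⟩
  set w := Q ^ (-E) * (Q ^ (ℓ : ℤ) * u) with hw
  have hwU : w ∈ orbit Q U := ⟨-E + ℓ, u, hu, by rw [hw, zpow_add₀ hQ0, mul_assoc]⟩
  have hw0 : 0 < ‖w‖ := norm_pos_iff.2 (hregU hwU).1
  have hbw := hlow w hwU
  have hbw0 : 0 < ‖b.eval w‖ := lt_of_lt_of_le (by positivity) hbw
  have h1 := (opVal_eq_iff hQ0 htop (A := A) (f := F) (z := Q ^ (ℓ : ℤ) * u)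
    (norm_pos_iff.1 hbw0)).1 (heq w (hregU hwU))
  have hdiv : ∀ (x : ℂ) (k : ℕ), ‖x * w ^ k‖ / ‖b.eval w‖ ≤
      c₁⁻¹ * ‖x‖ * (‖Q‖ ^ (((k : ℤ) - J) * ℓ) * (r₁ ^ ((k : ℤ) - J) + r₂ ^ ((k : ℤ) - J))) := by
    intro x k
    have h2 := hw_eq ℓ u hu ((k : ℤ) - J)
    rw [← hw] at h2
    rw [norm_mul, norm_pow]
    calc ‖x‖ * ‖w‖ ^ k / ‖b.eval w‖ ≤ ‖x‖ * ‖w‖ ^ k / (c₁ * ‖w‖ ^ J) := by gcongr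
      _ = c₁⁻¹ * ‖x‖ * ‖w‖ ^ ((k : ℤ) - J) := by
          rw [zpow_sub₀ hw0.ne', zpow_natCast, zpow_natCast]; field_simp
      _ ≤ _ := by gcongr
  change ‖F (Q ^ (ℓ : ℤ) * u)‖ ≤ _
  rw [h1, stepVal, norm_div, ← hb, ← hw]
  refine (div_le_div_of_nonneg_right (norm_sub_le _ _) hbw0.le).trans ?_
  rw [add_div]
  refine add_le_add ?_ ?_
  · rw [hCA, Finset.sum_mul, rhsVal]
    refine (div_le_div_of_nonneg_right (norm_sum_le _ _) hbw0.le).trans ?_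
    rw [Finset.sum_div]
    refine Finset.sum_le_sum fun k hk => (hdiv _ _).trans ?_
    rw [← mul_assoc, mul_right_comm]
    refine mul_le_mul_of_nonneg_left ?_ (by positivity)
    rw [hG, ← pow_mul, ← zpow_natCast]
    refine zpow_le_zpow_right₀ hQ.le ?_
    push_cast
    have : (k : ℤ) ≤ A.natDegree := by exact_mod_cast le_natDegree_of_mem_supp k hk
    have h3 : (0 : ℤ) ≤ ℓ := by positivity
    nlinarith
  · rw [lowVal]
    refine (div_le_div_of_nonneg_right (norm_sum_le _ _) hbw0.le).trans ?_
    rw [Finset.sum_div]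
    refine Finset.sum_le_sum fun t ht => ?_
    obtain ⟨htS, htE⟩ := Finset.mem_filter.1 ht
    have e1 : Q ^ shiftExp K D t * w =
        Q ^ ((ℓ : ℤ) - (E - shiftExp K D t).toNat) * u := by
      rw [hw, ← mul_assoc, ← mul_assoc, ← zpow_add₀ hQ0, ← zpow_add₀ hQ0]
      congr 2; omega
    rw [norm_mul, mul_div_right_comm, e1]
    refine mul_le_mul_of_nonneg_right ((hdiv _ _).trans ?_) (norm_nonneg _)
    rw [← mul_assoc, mul_right_comm]
    refine mul_le_mul ?_ ?_ (by positivity) (Finset.sum_nonneg fun k _ => by positivity)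
    · exact Finset.single_le_sum (f := fun t : ℤ × ℕ => c₁⁻¹ * ‖S t * borelFactor Q D t.2‖ *
        (r₁ ^ ((t.2 : ℤ) - J) + r₂ ^ ((t.2 : ℤ) - J))) (fun k _ => by positivity) htS
    -- The quotient w^d / b(w) contributes |Q|^((d - J) ℓ). The slope condition bounds d - J by the
    -- lag divided by N, as the recursive estimate requires.
    · rw [← Real.rpow_intCast]
      refine Real.rpow_le_rpow_of_exponent_le hQ.le ?_
      have hNr : (0 : ℝ) < N := by exact_mod_cast Nat.pos_of_ne_zero hN
      rw [le_div_iff₀ hNr]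
      have h4 := hslope t htS
      have h5 : ((t.2 : ℤ) - J) * N ≤ ((E - shiftExp K D t).toNat : ℤ) := by omega
      have h6 : (((t.2 : ℤ) - J : ℤ) : ℝ) * N ≤ ((E - shiftExp K D t).toNat : ℝ) := by
        exact_mod_cast h5
      push_cast at h6 ⊢
      have h3 : (0 : ℝ) ≤ ℓ := by positivity
      nlinarith

end QDiff

end

/-! ### Local asymptotics, and global continuation with controlled growth -/

noncomputable section

namespace QDiff

variable {Q : ℂ} {K D N : ℕ} {S : ℤ × ℕ →₀ ℂ} {I : ℤ} {J : ℕ} {A : ℂ[X]} {s : Finset ℂ}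

/-! ### Local and global properties of the successive functions -/

/-- `f` is meromorphic near `0` with poles on `-lam Q ^ ℤ`, and away from this spiral it is
asymptotic to `∑ c i z ^ i`, with `q`-Gevrey estimates of weight `W`. -/
structure LocalData (Q lam : ℂ) (W : ℝ) (f : ℂ → ℂ) (c : ℕ → ℂ) : Prop where
  one_le_weight : 1 ≤ W
  coeff : ∃ L M : ℝ, 1 ≤ M ∧ ∀ i, ‖c i‖ ≤ L * M ^ i * W ^ (i.choose 2)
  local_bounds : ∃ R : ℝ, 0 < R ∧ (∀ z, z ≠ 0 → ‖z‖ < R → MeromorphicAt f z) ∧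
    (∀ z, z ≠ 0 → ‖z‖ < R → offSpiral Q lam z → AnalyticAt ℂ f z) ∧
    ∀ ε : ℝ, 0 < ε → ∃ L M : ℝ, 0 < L ∧ 1 ≤ M ∧ ∀ (m : ℕ) (z : ℂ), z ≠ 0 → ‖z‖ < R →
      (∀ ℓ : ℤ, ε * ‖Q ^ ℓ * lam‖ ≤ ‖z + Q ^ ℓ * lam‖) →
      ‖f z - ∑ i ∈ Finset.range m, c i * z ^ i‖ ≤ L * M ^ m * W ^ (m.choose 2) * ‖z‖ ^ m

/-- `F` is an analytic continuation of the germ `f`, with controlled growth on the orbit of `U`. -/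
structure GlobalData (Q : ℂ) (s : Finset ℂ) (lam : ℂ) (U : Set ℂ) (N : ℕ) (W : ℝ) (f F : ℂ → ℂ)
    (c : ℕ → ℂ) : Prop where
  agree : ∃ r : ℝ, 0 < r ∧ ∀ z, ‖z‖ < r → F z = f z
  analytic : AnalyticOnNhd ℂ F (regular Q s)
  growth : ∃ L M : ℝ, 0 < L ∧ 0 < M ∧ ∀ z ∈ orbit Q U,
    ‖F z‖ < L * ‖theta ((‖Q‖ ^ N : ℝ) : ℂ) ((M * ‖z‖ : ℝ) : ℂ)‖
  spiral : ∃ κ₀ : ℕ, ∀ κ ≥ κ₀, ∃ L M : ℝ, SpiralAsymptotic Q (Q ^ (-(κ : ℤ)) * lam) N W L M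
    (fun ℓ => F (Q ^ (ℓ + -(κ : ℤ)) * lam)) c

lemma offSpiral_of_mem_regular {lam z : ℂ} (hls : -lam ∈ s) (hz : z ∈ regular Q s) :
    offSpiral Q lam z := fun ℓ h => hz.2 ⟨-lam, hls, ℓ, by rw [h, mul_neg]⟩

lemma IsFundamental.shift {lam : ℂ} {U : Set ℂ} (hU : IsFundamental Q s lam U) (hQ : 1 < ‖Q‖)
    (k : ℤ) : IsFundamental Q s (Q ^ k * lam) ((fun u => Q ^ k * u) '' U) := by
  have hQ0 := ne_zero_of_one_lt_norm hQ
  have hk : 0 < ‖Q‖ ^ k := zpow_pos (by linarith) _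
  obtain ⟨m, M, hm, hb⟩ := hU.bounds
  obtain ⟨δ, hδ, hd⟩ := hU.dist_orbit hQ
  refine ⟨(Homeomorph.mulLeft₀ _ (zpow_ne_zero k hQ0)).isOpenMap _ hU.isOpen,
    hU.isConnected.image _ (by fun_prop), ⟨_, hU.mem, rfl⟩,
    ⟨_, hU.mul_mem, by ring⟩, ⟨‖Q‖ ^ k * m, ‖Q‖ ^ k * M, by positivity, ?_⟩, ⟨δ, hδ, ?_⟩⟩
  · rintro _ ⟨u, hu, rfl⟩
    simp only [norm_mul, norm_zpow]
    exact ⟨by gcongr; exact (hb u hu).1, by gcongr; exact (hb u hu).2⟩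
  · rintro _ ⟨u, hu, rfl⟩ b hb
    exact hd _ ⟨k, u, hu, rfl⟩ b hb

/-- Passes from a distance measured relative to |z| to one relative to the point of the spiral. The
two are comparable unless |b| > 2|z|, and then |z + b| ≥ |b|/2. -/
lemma spiral_dist_of_dist {δ : ℝ} (hδ : 0 < δ) {z b : ℂ} (h : δ * ‖z‖ ≤ ‖z + b‖) :
    min (δ / 2) (1 / 2) * ‖b‖ ≤ ‖z + b‖ := by
  have h1 : ‖b‖ - ‖z‖ ≤ ‖z + b‖ := by
    have := norm_sub_norm_le b (-z)
    rw [norm_neg, sub_neg_eq_add, add_comm b] at this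
    exact this
  have hb := norm_nonneg b
  rcases le_total ‖b‖ (2 * ‖z‖) with h2 | h2
  · calc min (δ / 2) (1 / 2) * ‖b‖ ≤ δ / 2 * (2 * ‖z‖) := by
          gcongr
          exact min_le_left _ _
      _ ≤ _ := by linarith
  · calc min (δ / 2) (1 / 2) * ‖b‖ ≤ 1 / 2 * ‖b‖ := by
          gcongr
          exact min_le_right _ _
      _ ≤ _ := by linarith

/-- Comparison of the growth on a spiral with the Theta function. -/
lemma lt_theta_of_growth (hQ : 1 < ‖Q‖) (hN : N ≠ 0) {L M m : ℝ} (hL : 1 ≤ L) (hM : 1 ≤ M)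
    (hm : 0 < m) : ∃ L' M' : ℝ, 0 < L' ∧ 0 < M' ∧ ∀ (y : ℝ) (t : ℝ) (ℓ : ℕ),
      y ≤ L * M ^ ℓ * ‖Q‖ ^ ((ℓ : ℝ) ^ 2 / (2 * N)) → ‖Q‖ ^ ℓ * m ≤ t →
      y < L' * ‖theta ((‖Q‖ ^ N : ℝ) : ℂ) ((M' * t : ℝ) : ℂ)‖ := by
  have hϖ0 : 0 < ‖Q‖ := by linarith
  set L₁ := L * (M ^ N * ‖Q‖ ^ N) with hL₁
  set M₁ := M ^ N * ‖Q‖ ^ (2 * N) with hM₁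
  have hL₁0 : 0 < L₁ := by positivity
  have hM₁0 : 0 < M₁ := by positivity
  refine ⟨L₁ + 1, M₁ / m, by positivity, by positivity, fun y t ℓ hy ht => ?_⟩
  have ht0 : 0 < t := lt_of_lt_of_le (by positivity) ht
  have hP : 1 < ‖Q‖ ^ N := one_lt_pow₀ hQ hN
  -- The single term of index k of the Theta series already dominates the Gaussian growth at ℓ. The
  -- growth constant is absorbed by rescaling the argument.
  set k := ℓ / N
  have hℓ : ℓ = k * N + ℓ % N := by rw [mul_comm]; exact (Nat.div_add_mod ℓ N).symm
  have h1 := growth_subsequence hQ hN (by linarith) hM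
    (b := fun ℓ => L * M ^ ℓ * ‖Q‖ ^ ((ℓ : ℝ) ^ 2 / (2 * N))) (fun _ => le_rfl)
    (Nat.mod_lt ℓ (Nat.pos_of_ne_zero hN)) k
  rw [← hℓ] at h1
  have h2 := le_norm_theta_ofReal hP (x := M₁ / m * t) (by positivity) k
  have h3 : M₁ ^ k * (‖Q‖ ^ N) ^ (k.choose 2) ≤
      (‖Q‖ ^ N) ^ (-tri k) * (M₁ / m * t) ^ (k : ℤ) := by
    have e1 : (‖Q‖ ^ N) ^ (-tri k) = ((‖Q‖ ^ N) ^ (k.choose 2))⁻¹ * ((‖Q‖ ^ N) ^ k)⁻¹ := by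
      have := tri_sub_one (k : ℤ)
      rw [tri_natCast_sub_one] at this
      rw [show tri (k : ℤ) = (k.choose 2 : ℤ) + k by linarith, neg_add, zpow_add₀ (by positivity),
        zpow_neg, zpow_neg, zpow_natCast, zpow_natCast]
    have e2 : (‖Q‖ ^ N) ^ k * m ≤ t := by
      refine le_trans ?_ ht
      rw [← pow_mul]
      gcongr
      · exact hQ.le
      · rw [hℓ]; nlinarith [Nat.zero_le (ℓ % N)]
    have e3 : (‖Q‖ ^ N) ^ (k * k) = (‖Q‖ ^ N) ^ (k.choose 2) * ((‖Q‖ ^ N) ^ (k.choose 2) *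
        (‖Q‖ ^ N) ^ k) := by
      rw [← pow_add, ← pow_add]
      congr 1
      have h1 := tri_sq (k : ℤ)
      have h2 := tri_sub_one (k : ℤ)
      rw [tri_natCast_sub_one] at h1 h2
      zify; linarith
    calc M₁ ^ k * (‖Q‖ ^ N) ^ (k.choose 2)
        = (‖Q‖ ^ N) ^ (-tri k) * (M₁ ^ k * (‖Q‖ ^ N) ^ (k * k)) := by
          rw [e1, e3]; field_simp
      _ = (‖Q‖ ^ N) ^ (-tri k) * (M₁ / m * ((‖Q‖ ^ N) ^ k * m)) ^ k := by
          rw [show M₁ / m * ((‖Q‖ ^ N) ^ k * m) = M₁ * (‖Q‖ ^ N) ^ k by field_simp,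
            mul_pow M₁, ← pow_mul (‖Q‖ ^ N)]
      _ ≤ _ := by
          rw [zpow_natCast]
          gcongr
  have h4 : 0 < ‖theta ((‖Q‖ ^ N : ℝ) : ℂ) ((M₁ / m * t : ℝ) : ℂ)‖ :=
    lt_of_lt_of_le (by positivity) h2
  calc y ≤ L₁ * (M₁ ^ k * (‖Q‖ ^ N) ^ (k.choose 2)) := by
        rw [← mul_assoc]; exact hy.trans h1
    _ ≤ L₁ * ‖theta ((‖Q‖ ^ N : ℝ) : ℂ) ((M₁ / m * t : ℝ) : ℂ)‖ := by
        gcongr; exact h3.trans h2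
    _ < _ := by nlinarith

/-- The continuation of a function with local data that solves a `q`-difference equation. -/
theorem LocalData.exists_globalData (hQ : 1 < ‖Q‖) (hs : (0 : ℂ) ∉ s) (hK : K ≠ 0) (hN : N ≠ 0)
    (htop : IsTop K D S I J)
    (hslope : ∀ t ∈ S.support,
      ((t.2 : ℤ) - J) * N ≤ shiftExp K D (I, J) - shiftExp K D t)
    (hroots : ∀ ρ : ℂ, ρ ≠ 0 → (topPoly Q K D S (shiftExp K D (I, J))).eval ρ = 0 → ρ ∈ s)
    {lam : ℂ} (hls : -lam ∈ s) {U : Set ℂ} (hU : IsFundamental Q s lam U)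
    {f : ℂ → ℂ} {W : ℝ} {c : ℕ → ℂ} (hf : LocalData Q lam W f c)
    {R₁ : ℝ} (hR₁ : 0 < R₁)
    (heq : ∀ z ∈ regular Q s, ‖z‖ < R₁ → opVal Q K D S f z = rhsVal Q D A z) :
    ∃ F : ℂ → ℂ, GlobalData Q s lam U N W f F c := by
  have hQ0 := ne_zero_of_one_lt_norm hQ
  have hϖ0 : 0 < ‖Q‖ := by linarith
  obtain ⟨R, hR, hmer, hana, hest⟩ := hf.local_bounds
  obtain ⟨F, r, hr, hF1, hF2, -, hF4⟩ := exists_extension hQ hs htop hroots hR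
    (fun z hz hzR => hana z hz.1 hzR (offSpiral_of_mem_regular hls hz)) hmer hR₁ heq
  obtain ⟨δ, hδ, hdist⟩ := hU.dist_orbit hQ
  obtain ⟨m, Mu, hm, hbd⟩ := hU.bounds
  have hreg := hU.orbit_subset_regular hQ
  obtain ⟨L₀, M₀, hL₀, hM₀, hest₀⟩ := hest (min (δ / 2) (1 / 2)) (by positivity)
  have hW := hf.one_le_weight
  -- asymptotics on the orbit
  have hnear : ∀ z ∈ orbit Q U, ‖z‖ < min r R → ∀ k : ℕ,
      ‖F z - ∑ i ∈ Finset.range k, c i * z ^ i‖ ≤ L₀ * M₀ ^ k * W ^ (k.choose 2) * ‖z‖ ^ k := by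
    intro z hz hzr k
    rw [hF1 z (hzr.trans_le (min_le_left _ _))]
    refine hest₀ k z (hreg hz).1 (hzr.trans_le (min_le_right _ _)) fun ℓ => ?_
    refine spiral_dist_of_dist hδ ?_
    have := hdist z hz (-(Q ^ ℓ * lam)) ⟨-lam, hls, ℓ, by ring⟩
    rwa [sub_neg_eq_add] at this
  -- The base point is moved to Q^(-κ) lam, deep enough for all translates of nonpositive index to
  -- lie where the local asymptotics hold. This provides the bounded initial data for the growth
  -- recursion.
  obtain ⟨κ₀, hκ₀⟩ : ∃ κ₀ : ℕ, Mu < min r R * ‖Q‖ ^ κ₀ := by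
    obtain ⟨n, hn⟩ := pow_unbounded_of_one_lt (Mu / min r R) hQ
    exact ⟨n, by rwa [div_lt_iff₀ (lt_min hr hR), mul_comm] at hn⟩
  have hsmall : ∀ κ ≥ κ₀, ∀ ℓ : ℤ, ℓ ≤ 0 → ∀ u ∈ U, ‖Q ^ ℓ * (Q ^ (-(κ : ℤ)) * u)‖ < min r R := by
    intro κ hκ ℓ hℓ u hu
    rw [norm_mul, norm_mul, norm_zpow, norm_zpow]
    have h1 : ‖Q‖ ^ ℓ ≤ 1 := zpow_le_one_of_nonpos₀ hQ.le hℓ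
    have h2 : ‖Q‖ ^ κ₀ ≤ ‖Q‖ ^ κ := pow_le_pow_right₀ hQ.le hκ
    have h3 := (hbd u hu).2
    calc ‖Q‖ ^ ℓ * (‖Q‖ ^ (-(κ : ℤ)) * ‖u‖) ≤ 1 * (‖Q‖ ^ (-(κ : ℤ)) * ‖u‖) := by gcongr
      _ ≤ (‖Q‖ ^ κ)⁻¹ * Mu := by rw [one_mul, zpow_neg, zpow_natCast]; gcongr
      _ < (‖Q‖ ^ κ)⁻¹ * (min r R * ‖Q‖ ^ κ₀) := by gcongr
      _ ≤ (‖Q‖ ^ κ)⁻¹ * (min r R * ‖Q‖ ^ κ) := by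
          have : 0 < min r R := lt_min hr hR
          gcongr
      _ = min r R := by field_simp
  -- growth
  have hgr : ∀ κ ≥ κ₀, ∃ L M : ℝ, L₀ ≤ L ∧ 1 ≤ L ∧ 1 ≤ M ∧ (∀ (ℓ : ℕ), ∀ u ∈ U,
      ‖F (Q ^ (ℓ : ℤ) * (Q ^ (-(κ : ℤ)) * u))‖ ≤
        L * M ^ ℓ * ‖Q‖ ^ ((ℓ : ℝ) ^ 2 / (2 * N))) ∧
      ∀ (ℓ : ℤ), ℓ ≤ 0 → ∀ u ∈ U, ‖F (Q ^ ℓ * (Q ^ (-(κ : ℤ)) * u))‖ ≤ L := by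
    intro κ hκ
    have h0 : ∀ ℓ : ℤ, ℓ ≤ 0 → ∀ u ∈ U, ‖F (Q ^ ℓ * (Q ^ (-(κ : ℤ)) * u))‖ ≤ L₀ := by
      intro ℓ hℓ u hu
      have := hnear (Q ^ ℓ * (Q ^ (-(κ : ℤ)) * u))
        ⟨ℓ + -(κ : ℤ), u, hu, by rw [zpow_add₀ hQ0, mul_assoc]⟩ (hsmall κ hκ ℓ hℓ u hu) 0
      simpa using this
    obtain ⟨L, M, h1, h2, h3, h4⟩ := exists_growth hQ hK hN htop hslope hroots
      (hU.shift hQ (-(κ : ℤ))) hF4 (C₀ := L₀) (by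
        rintro ℓ hℓ _ ⟨u, hu, rfl⟩
        exact h0 ℓ hℓ u hu)
    exact ⟨L, M, h1, h2, h3, fun ℓ u hu => h4 ℓ _ ⟨u, hu, rfl⟩,
      fun ℓ hℓ u hu => (h0 ℓ hℓ u hu).trans h1⟩
  refine ⟨F, ⟨r, hr, hF1⟩, hF2, ?_, κ₀, fun κ hκ => ?_⟩
  · obtain ⟨L, M, h1, h2, h3, h4, h5⟩ := hgr κ₀ le_rfl
    obtain ⟨L', M', hL', hM', hθ⟩ := lt_theta_of_growth hQ hN h2 h3
      (m := ‖Q‖ ^ (-(κ₀ : ℤ)) * m) (by positivity)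
    refine ⟨L' + L, M', by linarith, hM', ?_⟩
    rintro z ⟨ℓ, u, hu, rfl⟩
    have hu0 : 0 < ‖u‖ := hm.trans_le (hbd u hu).1
    have e : Q ^ ℓ * u = Q ^ (ℓ + κ₀) * (Q ^ (-(κ₀ : ℤ)) * u) := by
      rw [← mul_assoc, ← zpow_add₀ hQ0]; simp
    have hPN : 1 < ‖Q‖ ^ N := one_lt_pow₀ hQ hN
    rcases le_total 0 (ℓ + κ₀) with h | h
    · obtain ⟨n, hn⟩ := Int.eq_ofNat_of_zero_le h
      refine (hθ _ ‖Q ^ ℓ * u‖ n (e ▸ hn ▸ h4 n u hu) ?_).trans_le ?_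
      · rw [e, hn, norm_mul, norm_mul, norm_zpow, norm_zpow, zpow_natCast]
        gcongr
        exact (hbd u hu).1
      · gcongr
        linarith
    · have h6 := h5 _ h u hu
      rw [← e] at h6
      have h7 := le_norm_theta_ofReal hPN (x := M' * ‖Q ^ ℓ * u‖) (by
        rw [norm_mul, norm_zpow]; positivity) 0
      simp only [tri_zero, neg_zero, zpow_zero, mul_one] at h7
      refine h6.trans_lt ?_
      nlinarith
  · obtain ⟨Lc, Mc, hMc, hc⟩ := hf.coeff
    obtain ⟨L, M, h1, h2, h3, h4, h5⟩ := hgr κ hκ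
    have hLc : 0 ≤ Lc := (norm_nonneg _).trans (by simpa using hc 0)
    have e : ∀ ℓ : ℤ, Q ^ (ℓ + -(κ : ℤ)) * lam = Q ^ ℓ * (Q ^ (-(κ : ℤ)) * lam) := fun ℓ => by
      rw [zpow_add₀ hQ0, mul_assoc]
    have hM1 : M ≤ max M (max M₀ Mc) := le_max_left _ _
    have hM2 : M₀ ≤ max M (max M₀ Mc) := (le_max_left _ _).trans (le_max_right _ _)
    have hM3 : Mc ≤ max M (max M₀ Mc) := (le_max_right _ _).trans (le_max_right _ _)
    refine ⟨L + Lc, max M (max M₀ Mc), h3.trans hM1, hW, fun i => (hc i).trans ?_,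
      fun ℓ hℓ k => ?_, fun ℓ => ?_⟩
    · gcongr
      linarith
    · simp only [e]
      refine (hnear _ ⟨ℓ + -(κ : ℤ), lam, hU.mem, (e ℓ).symm⟩
        (hsmall κ hκ ℓ hℓ.le lam hU.mem) k).trans ?_
      gcongr
      linarith
    · simp only [e]
      refine (h4 ℓ lam hU.mem).trans ?_
      gcongr
      linarith

end QDiff

end

/-! ### Laplace transforms of continued functions and transfer of relations -/

noncomputable section

namespace QDiff

variable {Q lam : ℂ} {K D N g : ℕ} {s : Finset ℂ} {W L M : ℝ} {U : Set ℂ} {f F : ℂ → ℂ}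
  {c : ℕ → ℂ}

/-! ### The `q`-Laplace transform of a function with global data -/

/-- Keeping every g-th point preserves the Gaussian rate: (gℓ)²/(2gN) for Q is ℓ²/(2N) for Q^g. -/
lemma SpiralAsymptotic.pow {a : ℤ → ℂ} (h : SpiralAsymptotic Q lam (g * N) W L M a c)
    (hg : g ≠ 0) (hN : N ≠ 0) :
    SpiralAsymptotic (Q ^ g) lam N W L (M ^ g) (fun ℓ => a (g * ℓ)) c := by
  have hM := h.one_le
  have hW := h.one_le_weight
  have hL : 0 ≤ L := (norm_nonneg _).trans (by simpa using h.coeff 0)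
  have hMg : M ≤ M ^ g := le_self_pow₀ hM hg
  refine ⟨one_le_pow₀ hM, hW, fun i => (h.coeff i).trans (by gcongr), fun ℓ hℓ m => ?_,
    fun ℓ => ?_⟩
  · have hneg : (g : ℤ) * ℓ < 0 := mul_neg_of_pos_of_neg (by positivity) hℓ
    have := h.neg _ hneg m
    rw [zpow_mul, zpow_natCast] at this
    exact this.trans (by gcongr)
  · have := h.nonneg (g * ℓ)
    push_cast at this
    refine this.trans (le_of_eq ?_)
    rw [pow_mul, norm_pow, ← Real.rpow_natCast ‖Q‖ g, ← Real.rpow_mul (norm_nonneg _)]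
    congr 2
    have : (g : ℝ) ≠ 0 := by exact_mod_cast hg
    have : (N : ℝ) ≠ 0 := by exact_mod_cast hN
    field_simp

lemma GlobalData.exists_subspiral (h : GlobalData Q s lam U (g * N) W f F c) (hQ : 1 < ‖Q‖)
    (hg : g ≠ 0) (hN : N ≠ 0) : ∃ (k : ℤ) (L M : ℝ), 1 ≤ M ∧ ∀ j < N,
      SeqAsymptotic ‖(Q ^ g) ^ N‖ W L M
        (fun i => ((Q ^ g) ^ N) ^ i * ((Q ^ g) ^ j * ((Q ^ g) ^ k * lam)))
        (fun i => F ((Q ^ g) ^ (i * N + j + k) * lam)) c := by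
  obtain ⟨κ, hκ⟩ := h.spiral
  -- The shift of the base point must be a multiple of g for it to stay on the Q^g-spiral of lam,
  -- which is why the global data cover all large κ.
  obtain ⟨L, M, h1⟩ := hκ (g * κ) (Nat.le_mul_of_pos_left _ (Nat.pos_of_ne_zero hg))
  have h2 := h1.pow hg hN
  have e : ∀ ℓ : ℤ, Q ^ ((g : ℤ) * ℓ + -((g * κ : ℕ) : ℤ)) = (Q ^ g) ^ (ℓ + -(κ : ℤ)) := by
    intro ℓ
    rw [← zpow_natCast Q g, ← zpow_mul]
    congr 1
    push_cast; ring
  have e2 : Q ^ (-((g * κ : ℕ) : ℤ)) = (Q ^ g) ^ (-(κ : ℤ)) := by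
    simpa using e 0
  simp only [e, e2] at h2
  have hQg : 1 < ‖Q ^ g‖ := one_lt_norm_pow hQ hg
  obtain ⟨L', M', h3⟩ := h2.subspiral hQg hN
  exact ⟨-κ, L', M', (h3 0 (Nat.pos_of_ne_zero hN)).one_le, h3⟩

lemma GlobalData.summable_lapTerm (h : GlobalData Q s lam U (g * N) W f F c) (hQ : 1 < ‖Q‖)
    (hg : g ≠ 0) (hN : N ≠ 0) (hl : lam ≠ 0) : ∀ᶠ z in 𝓝[≠] (0 : ℂ),
      Summable (lapTerm ((Q ^ g) ^ N) (Q ^ g) lam (fun ℓ => F ((Q ^ g) ^ ℓ * lam)) z) := by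
  obtain ⟨k, L, M, hM, h1⟩ := h.exists_subspiral hQ hg hN
  have hQg : 1 < ‖Q ^ g‖ := one_lt_norm_pow hQ hg
  have hl' : (Q ^ g) ^ k * lam ≠ 0 :=
    mul_ne_zero (zpow_ne_zero _ (ne_zero_of_one_lt_norm hQg)) hl
  have hsmall : ∀ᶠ z in 𝓝[≠] (0 : ℂ), ‖z‖ * M < ‖(Q ^ g) ^ k * lam‖ := by
    refine nhdsWithin_le_nhds ?_
    have : Tendsto (fun z : ℂ => ‖z‖ * M) (𝓝 0) (𝓝 (‖(0 : ℂ)‖ * M)) :=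
      (continuous_norm.mul continuous_const).tendsto 0
    rw [norm_zero, zero_mul] at this
    exact this.eventually_lt_const (norm_pos_iff.2 hl')
  filter_upwards [hsmall, self_mem_nhdsWithin] with z hz hz0
  have := (hasSum_lapTerm hQg hN hl' (a := fun ℓ => F ((Q ^ g) ^ (ℓ + k) * lam))
    (by linarith) (fun j hj => (h1 j hj).seqGrowth) hz0 hz).summable
  exact (summable_lapTerm_shift (a := fun ℓ => F ((Q ^ g) ^ ℓ * lam)) hQg _ _ _ k).1 this

/-- The Laplace transform of a function with global data has local data. -/
theorem GlobalData.laplace (h : GlobalData Q s lam U (g * N) W f F c) (hQ : 1 < ‖Q‖)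
    (hg : g ≠ 0) (hN : N ≠ 0) (hl : lam ≠ 0) :
    LocalData (Q ^ g) lam (W * ‖(Q ^ g) ^ N‖)
      (lap ((Q ^ g) ^ N) (Q ^ g) lam N (fun ℓ => F ((Q ^ g) ^ ℓ * lam)))
      (fun i => c i * ((Q ^ g) ^ N) ^ (i.choose 2)) := by
  obtain ⟨k, L, M, hM, h1⟩ := h.exists_subspiral hQ hg hN
  have hQg : 1 < ‖Q ^ g‖ := one_lt_norm_pow hQ hg
  have hQgN : 1 < ‖(Q ^ g) ^ N‖ := one_lt_norm_pow hQg hN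
  have h10 := h1 0 (Nat.pos_of_ne_zero hN)
  have hl' : (Q ^ g) ^ k * lam ≠ 0 :=
    mul_ne_zero (zpow_ne_zero _ (ne_zero_of_one_lt_norm hQg)) hl
  have hlap : lap ((Q ^ g) ^ N) (Q ^ g) lam N (fun ℓ => F ((Q ^ g) ^ ℓ * lam)) =
      lap ((Q ^ g) ^ N) (Q ^ g) ((Q ^ g) ^ k * lam) N (fun ℓ => F ((Q ^ g) ^ (ℓ + k) * lam)) :=
    funext fun z => (lap_shift (a := fun ℓ => F ((Q ^ g) ^ ℓ * lam)) hQg _ _ _ k).symm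
  have hR : ∀ z : ℂ, ‖z‖ < min 1 (‖(Q ^ g) ^ k * lam‖ / (2 * M)) →
      ‖z‖ ≤ 1 ∧ ‖z‖ * M < ‖(Q ^ g) ^ k * lam‖ ∧ 2 * (‖z‖ * M) < ‖(Q ^ g) ^ k * lam‖ := by
    intro z hz
    have h2 := hz.trans_le (min_le_right _ _)
    rw [lt_div_iff₀ (by positivity)] at h2
    have h3 : 0 ≤ ‖z‖ * M := by positivity
    exact ⟨(hz.trans_le (min_le_left _ _)).le, by linarith, by linarith⟩
  have hgr := fun j hj => (h1 j hj).seqGrowth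
  rw [hlap]
  refine ⟨?_, ⟨L, M, hM, fun i => ?_⟩, min 1 (‖(Q ^ g) ^ k * lam‖ / (2 * M)),
    lt_min one_pos (div_pos (norm_pos_iff.2 hl') (by positivity)), fun z hz hzR => ?_,
    fun z hz hzR hoff => ?_, fun ε hε => ?_⟩
  · nlinarith [h10.one_le_weight]
  · rw [norm_mul, norm_pow, mul_pow, ← mul_assoc]
    gcongr
    exact h10.coeff i
  · exact meromorphicAt_lap hQg hN hl' (a := fun ℓ => F ((Q ^ g) ^ (ℓ + k) * lam))
      (by linarith) hgr hz (hR z hzR).2.1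
  · exact analyticAt_lap hQg hN hl' (a := fun ℓ => F ((Q ^ g) ^ (ℓ + k) * lam))
      (by linarith) hgr hz (hR z hzR).2.1 ((offSpiral_shift hQg k).2 hoff)
  · obtain ⟨L', M', hL', hM', h2⟩ := norm_lap_sub_sum_le hQg hN hl'
      (a := fun ℓ => F ((Q ^ g) ^ (ℓ + k) * lam)) h1 hε
    refine ⟨L', M', hL', hM', fun m z hz hzR hd => h2 m z hz (hR z hzR).1 (hR z hzR).2.2
      fun ℓ => ?_⟩
    have := hd (ℓ + k)
    rwa [zpow_add₀ (ne_zero_of_one_lt_norm hQg), mul_assoc] at this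

/-! ### Transfer of linear relations -/

/-- The case i = 0 of the monomial formula on each of the N spirals. Combined with the shift rule it
computes the transforms of the polynomial right-hand sides. -/
lemma hasSum_lapTerm_one (hQ : 1 < ‖Q‖) (hN : N ≠ 0) (hl : lam ≠ 0) {z : ℂ} (hz : z ≠ 0)
    (hzl : ‖z‖ < ‖lam‖) (h : offSpiral Q lam z) :
    HasSum (lapTerm (Q ^ N) Q lam (fun _ => 1) z) N := by
  have hQN := one_lt_norm_pow hQ hN
  have hgr : SeqGrowth ‖Q ^ N‖ 1 1 (fun _ => 1) := by
    refine ⟨fun k _ => by simp, fun k => ?_⟩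
    simpa using one_le_pow₀ hQN.le
  have hzl' : ‖z‖ * 1 < ‖lam‖ := by rwa [mul_one]
  have h1 := hasSum_lapTerm hQ hN hl one_pos (a := fun _ => 1) (fun _ _ => hgr) hz hzl'
  suffices e : (N : ℂ) = ∑ j ∈ Finset.range N, lapQuot Q lam N (fun _ => 1) z j by rwa [e]
  rw [Finset.sum_congr rfl (g := fun _ => (1 : ℂ)), Finset.sum_const, Finset.card_range,
    nsmul_eq_mul, mul_one]
  intro j _
  have hl' : Q ^ j * lam ≠ 0 := mul_ne_zero (pow_ne_zero _ (ne_zero_of_one_lt_norm hQ)) hl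
  have h2 := hasSum_lapTerm_self hQN hl' one_pos hgr hz
    (hzl'.trans_le (norm_le_norm_pow_mul hQ lam j))
  have h3 := hasSum_lapTerm_monomial hQN hl' hz (theta_ne_zero_of_offSpiral hQ hN hl hz h j) 0
  simp only [pow_zero, Nat.choose_zero_succ, mul_one] at h3
  exact h2.unique h3

lemma tendsto_const_mul_punctured {b : ℂ} (hb : b ≠ 0) :
    Tendsto (fun z => b * z) (𝓝[≠] (0 : ℂ)) (𝓝[≠] 0) := by
  refine tendsto_nhdsWithin_iff.2 ⟨?_, ?_⟩
  · have : Tendsto (fun z => b * z) (𝓝 (0 : ℂ)) (𝓝 (b * 0)) :=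
      (continuous_const.mul continuous_id).tendsto 0
    rw [mul_zero] at this
    exact this.mono_left nhdsWithin_le_nhds
  · filter_upwards [self_mem_nhdsWithin] with z hz
    exact mul_ne_zero hb hz

lemma offSpiral_zpow_mul (hQ : 1 < ‖Q‖) (k : ℤ) {z : ℂ} :
    offSpiral Q lam (Q ^ k * z) ↔ offSpiral Q lam z := by
  have hQ0 := ne_zero_of_one_lt_norm hQ
  constructor
  · intro h ℓ hz
    refine h (ℓ + k) ?_
    rw [hz, zpow_add₀ hQ0]; ring
  · intro h ℓ hz
    refine h (ℓ - k) ?_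
    rw [zpow_sub₀ hQ0]
    field_simp
    rw [mul_comm, hz]

/-- The Laplace transformation turns a linear relation of level `g * N + D` into one of level
`D`. -/
theorem lap_relation {ι : Type*} [Fintype ι] (hQ : 1 < ‖Q‖) (hg : g ≠ 0) (hN : N ≠ 0)
    (hl : lam ≠ 0) (hgK : g ∣ K) (hgD : g ∣ D) {F : ι → ℂ → ℂ}
    (hF : ∀ j, ∀ᶠ z in 𝓝[≠] (0 : ℂ),
      Summable (lapTerm ((Q ^ g) ^ N) (Q ^ g) lam (fun ℓ => F j ((Q ^ g) ^ ℓ * lam)) z))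
    {S : ι → ℤ × ℕ →₀ ℂ} {A : ℂ[X]}
    (hrel : ∀ ℓ : ℤ, ∑ j, opVal Q K (g * N + D) (S j) (F j) ((Q ^ g) ^ ℓ * lam) =
      rhsVal Q (g * N + D) A ((Q ^ g) ^ ℓ * lam)) :
    ∀ᶠ z in 𝓝[≠] (0 : ℂ), offSpiral (Q ^ g) lam z →
      ∑ j, opVal Q K D (S j)
        (lap ((Q ^ g) ^ N) (Q ^ g) lam N (fun ℓ => F j ((Q ^ g) ^ ℓ * lam))) z =
      rhsVal Q D A z := by
  have hQ0 := ne_zero_of_one_lt_norm hQ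
  have hQg : 1 < ‖Q ^ g‖ := one_lt_norm_pow hQ hg
  have hQg0 := ne_zero_of_one_lt_norm hQg
  have hNC : (N : ℂ) ≠ 0 := by exact_mod_cast hN
  obtain ⟨K', rfl⟩ := hgK
  obtain ⟨D', rfl⟩ := hgD
  have he1 : ∀ t : ℤ × ℕ, Q ^ shiftExp (g * K') (g * D') t = (Q ^ g) ^ shiftExp K' D' t := by
    intro t
    rw [← zpow_natCast Q g, ← zpow_mul, shiftExp, shiftExp]
    congr 1
    push_cast; ring
  have he2 : ∀ t : ℤ × ℕ, Q ^ shiftExp (g * K') (g * N + g * D') t =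
      (Q ^ g) ^ (shiftExp K' D' t - N * t.2) := by
    intro t
    rw [← zpow_natCast Q g, ← zpow_mul, shiftExp, shiftExp]
    congr 1
    push_cast; ring
  have hbf : ∀ d : ℕ, borelFactor Q (g * N + g * D') d * ((Q ^ g) ^ N) ^ (d.choose 2) =
      borelFactor Q (g * D') d := by
    intro d
    rw [borelFactor, borelFactor, pow_add Q, mul_pow, pow_mul Q g N]
    have : ((Q ^ g) ^ N) ^ (d.choose 2) ≠ 0 := pow_ne_zero _ (pow_ne_zero _ hQg0)
    field_simp
  have hsum : ∀ᶠ z in 𝓝[≠] (0 : ℂ), ∀ j, ∀ t ∈ (S j).support,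
      Summable (lapTerm ((Q ^ g) ^ N) (Q ^ g) lam (fun ℓ => F j ((Q ^ g) ^ ℓ * lam))
        ((Q ^ g) ^ shiftExp K' D' t * z)) :=
    eventually_all.2 fun j => (Finset.eventually_all _).2 fun t _ =>
      (tendsto_const_mul_punctured (zpow_ne_zero _ hQg0)).eventually (hF j)
  have hsmall : ∀ᶠ z in 𝓝[≠] (0 : ℂ), ∀ k ∈ A.support,
      ‖(Q ^ g) ^ ((N * k : ℕ) : ℤ) * z‖ < ‖lam‖ := by
    refine (Finset.eventually_all _).2 fun k _ =>
      (tendsto_const_mul_punctured (zpow_ne_zero _ hQg0)).eventually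
        (p := fun w => ‖w‖ < ‖lam‖) (nhdsWithin_le_nhds ?_)
    exact (continuous_norm.tendsto (0 : ℂ)).eventually_lt_const (by simpa using hl)
  filter_upwards [hsum, hsmall, self_mem_nhdsWithin] with z hz1 hz2 hz0 hoff
  have hz0 : z ≠ 0 := hz0
  -- The relation at each point of the spiral is divided by its Theta value and summed. The shift
  -- rule with exponent Ka - Dd converts every term from level gN + D to level D, and the leftover
  -- p^(d choose 2) is the quotient of the two Borel factors.
  have hleft : HasSum (fun ℓ : ℤ => (∑ j, opVal Q (g * K') (g * N + g * D') (S j) (F j)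
      ((Q ^ g) ^ ℓ * lam)) / theta ((Q ^ g) ^ N) ((Q ^ g) ^ N * (Q ^ g) ^ ℓ * lam / z))
      (∑ j, N * opVal Q (g * K') (g * D') (S j)
        (lap ((Q ^ g) ^ N) (Q ^ g) lam N (fun ℓ => F j ((Q ^ g) ^ ℓ * lam))) z) := by
    simp only [Finset.sum_div]
    refine hasSum_sum fun j _ => ?_
    simp only [opVal, Finset.sum_div, Finset.mul_sum]
    refine hasSum_sum fun t ht => ?_
    have h1 := (hasSum_lapTerm_shift hQg hl hz0 _ t.2 (hz1 j t ht).hasSum).mul_left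
      (S j t * borelFactor Q (g * N + g * D') t.2)
    refine Eq.mpr (congrArg₂ (fun (f : ℤ → ℂ) b => HasSum f b) (funext fun ℓ => ?_) ?_) h1
    · rw [he2, lapTerm, ← mul_assoc ((Q ^ g) ^ (shiftExp K' D' t - N * t.2)),
        ← zpow_add₀ hQg0, add_comm _ ℓ]
      ring
    · rw [he1, lap, ← hbf]
      generalize (∑' ℓ : ℤ, lapTerm ((Q ^ g) ^ N) _ _ _ _ ℓ) = X
      field_simp
  have hright : HasSum (fun ℓ : ℤ => rhsVal Q (g * N + g * D') A ((Q ^ g) ^ ℓ * lam) /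
      theta ((Q ^ g) ^ N) ((Q ^ g) ^ N * (Q ^ g) ^ ℓ * lam / z))
      (N * rhsVal Q (g * D') A z) := by
    simp only [rhsVal, Finset.sum_div, Finset.mul_sum]
    refine hasSum_sum fun k hk => ?_
    have h0 := hasSum_lapTerm_one hQg hN hl
      (mul_ne_zero (zpow_ne_zero _ hQg0) hz0) (hz2 k hk) ((offSpiral_zpow_mul hQg _).2 hoff)
    have h1 := (hasSum_lapTerm_shift hQg hl hz0 _ k h0).mul_left
      (A.coeff k * borelFactor Q (g * N + g * D') k)
    refine Eq.mpr (congrArg₂ (fun (f : ℤ → ℂ) b => HasSum f b) (funext fun ℓ => ?_) ?_) h1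
    · rw [lapTerm]; ring
    · rw [← hbf]; ring
  simp only [hrel] at hleft
  have := hleft.unique hright
  rw [← Finset.mul_sum] at this
  exact mul_left_cancel₀ hNC this

end QDiff

end

/-! ### The transforms of the statement expressed through Q = q^(1/K) -/

noncomputable section

namespace QDiff

/-! ### The powers of `q` -/

section qPow

variable {τ : ℂ} {n : ℕ}

lemma qPow_div (τ : ℂ) (n : ℕ) (ℓ : ℤ) : qPow τ ((ℓ : ℂ) / (n : ℂ)) = qPow τ (1 / (n : ℂ)) ^ ℓ := by
  rw [qPow, qPow, ← Complex.exp_int_mul]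
  congr 1
  ring

lemma qPow_pow_self (τ : ℂ) (hn : n ≠ 0) : qPow τ (1 / (n : ℂ)) ^ n = Complex.exp τ := by
  have : (n : ℂ) ≠ 0 := by exact_mod_cast hn
  rw [qPow, ← Complex.exp_nat_mul]
  congr 1
  field_simp

lemma one_lt_norm_qPow (hτ : 1 < ‖Complex.exp τ‖) (hn : n ≠ 0) : 1 < ‖qPow τ (1 / (n : ℂ))‖ := by
  rw [← qPow_pow_self τ hn, norm_pow] at hτ
  exact (one_lt_pow_iff_of_nonneg (norm_nonneg _) hn).1 hτ

lemma qPow_mul_pow (τ : ℂ) {g : ℕ} (hg : g ≠ 0) (n : ℕ) :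
    qPow τ (1 / ((g * n : ℕ) : ℂ)) ^ g = qPow τ (1 / (n : ℂ)) := by
  have : (g : ℂ) ≠ 0 := by exact_mod_cast hg
  rw [qPow, qPow, ← Complex.exp_nat_mul]
  congr 1
  push_cast
  field_simp

variable {κ : ℚ} {N : ℕ}

lemma inv_eq_div_of_div_eq (hn : n ≠ 0) (h : (n : ℚ) / κ = N) : κ⁻¹ = N / n := by
  have : (n : ℚ) ≠ 0 := by exact_mod_cast hn
  rw [← h]
  field_simp

lemma qPow_inv (τ : ℂ) (hn : n ≠ 0) (h : (n : ℚ) / κ = N) :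
    qPow τ (1 / (κ : ℂ)) = qPow τ (1 / (n : ℂ)) ^ N := by
  have h1 := congrArg (fun x : ℚ => (x : ℂ)) (inv_eq_div_of_div_eq hn h)
  push_cast at h1
  have := qPow_div τ n N
  rw [zpow_natCast, Int.cast_natCast] at this
  rw [← this, one_div, h1]

lemma norm_exp_rpow (τ : ℂ) (hn : n ≠ 0) (h : (n : ℚ) / κ = N) :
    ‖Complex.exp τ‖ ^ (1 / (κ : ℝ)) = ‖qPow τ (1 / (n : ℂ))‖ ^ N := by
  have h1 := congrArg (fun x : ℚ => (x : ℝ)) (inv_eq_div_of_div_eq hn h)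
  push_cast at h1
  have : (n : ℝ) ≠ 0 := by exact_mod_cast hn
  rw [← qPow_pow_self τ hn, norm_pow, ← Real.rpow_natCast, ← Real.rpow_mul (norm_nonneg _),
    one_div (κ : ℝ), h1, ← Real.rpow_natCast]
  congr 1
  field_simp

end qPow

/-! ### The analytic continuation and the `q`-Laplace transform in terms of global data -/

variable {Q τ : ℂ} {n N g : ℕ} {κ : ℚ} {s : Finset ℂ} {lam : ℂˣ} {W : ℝ} {U : Set ℂ}
  {f F : ℂ → ℂ} {c : ℕ → ℂ}

lemma LocalData.meromorphicNearZero {lam : ℂ} (h : LocalData Q lam W f c) :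
    MeromorphicNearZero f := by
  obtain ⟨R, hR, h1, -⟩ := h.local_bounds
  filter_upwards [self_mem_nhdsWithin,
    mem_nhdsWithin_of_mem_nhds (Metric.ball_mem_nhds (0 : ℂ) hR)] with z hz hzR
  exact h1 z hz (by simpa using hzR)

lemma zpow_mul_tendsto_zero (hQ : 1 < ‖Q‖) (lam : ℂˣ) :
    Tendsto (fun k : ℕ => Q ^ (-(k : ℤ)) * (lam : ℂ)) atTop (𝓝[≠] 0) := by
  have hQ0 := ne_zero_of_one_lt_norm hQ
  refine tendsto_nhdsWithin_iff.2 ⟨?_, Eventually.of_forall fun k =>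
    mul_ne_zero (zpow_ne_zero _ hQ0) lam.ne_zero⟩
  have h1 : Tendsto (fun k : ℕ => (Q⁻¹) ^ k) atTop (𝓝 0) :=
    tendsto_pow_atTop_nhds_zero_of_norm_lt_one (by rw [norm_inv]; exact inv_lt_one_of_one_lt₀ hQ)
  have h2 := h1.mul_const (lam : ℂ)
  rw [zero_mul] at h2
  refine h2.congr fun k => ?_
  rw [zpow_neg, zpow_natCast, inv_pow]

theorem GlobalData.isContinuationOn (h : GlobalData Q s lam U (g * N) W f F c) (hQ : 1 < ‖Q‖)
    (hU : IsFundamental Q s lam U) (hn : n ≠ 0) (hQn : Q ^ g = qPow τ (1 / (n : ℂ)))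
    (hκ : (n : ℚ) / κ = N) : IsContinuationOn τ κ n lam f F (orbit Q U) := by
  refine ⟨hU.isOpen_orbit hQ, hU.isConnected_orbit hQ, ?_,
    fun z hz => h.analytic z (hU.orbit_subset_regular hQ hz), ?_, ?_⟩
  · obtain ⟨ε, hε, h1⟩ := hU.exists_discs hQ
    refine ⟨ε, hε, fun ℓ z hz => h1 (g * ℓ) z ?_⟩
    rwa [qPow_div, ← hQn, ← zpow_natCast Q g, ← zpow_mul] at hz
  · obtain ⟨r, hr, h1⟩ := h.agree
    filter_upwards [mem_nhdsWithin_of_mem_nhds (Metric.ball_mem_nhds (0 : ℂ) hr)] with z hz _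
    filter_upwards [mem_nhdsWithin_of_mem_nhds (Metric.isOpen_ball.mem_nhds hz)] with w hw
    exact (h1 w (by simpa using hw)).symm
  · obtain ⟨L, M, hL, hM, h1⟩ := h.growth
    refine ⟨L, M, hL, hM, fun z hz _ => ?_⟩
    rw [norm_exp_rpow τ hn hκ, ← hQn, norm_pow, ← pow_mul]
    exact h1 z hz

/-- Any continuation agrees near 0 with F, hence on the whole regular part of its connected domain.
This yields independence of the domain, and identifies the values of the chosen `continuation`. -/
theorem GlobalData.eq_of_isContinuation (h : GlobalData Q s lam U (g * N) W f F c) (hQ : 1 < ‖Q‖)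
    (hs : (0 : ℂ) ∉ s) (hlam : (lam : ℂ) ∈ regular Q s) (hg : g ≠ 0)
    (hQn : Q ^ g = qPow τ (1 / (n : ℂ))) {G : ℂ → ℂ} (hG : IsContinuation τ κ n lam f G) (ℓ : ℤ) :
    G ((Q ^ g) ^ ℓ * lam) = F ((Q ^ g) ^ ℓ * lam) := by
  obtain ⟨Ω, hΩ⟩ := hG
  have hQg : 1 < ‖Q ^ g‖ := one_lt_norm_pow hQ hg
  have hmem : ∀ k : ℤ, (Q ^ g) ^ k * (lam : ℂ) ∈ Ω := by
    obtain ⟨ε, hε, h1⟩ := hΩ.discs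
    intro k
    refine h1 k _ ?_
    rw [qPow_div, ← hQn, sub_self, norm_zero]
    have := norm_pos_iff.2 (mul_ne_zero (zpow_ne_zero k (ne_zero_of_one_lt_norm hQg)) lam.ne_zero)
    positivity
  have hreg : ∀ k : ℤ, (Q ^ g) ^ k * (lam : ℂ) ∈ regular Q s := by
    intro k
    rw [← zpow_natCast Q g, ← zpow_mul]
    exact (zpow_mul_mem_regular hQ _ _).2 hlam
  refine (eqOn_of_agree_near_zero hQ hs hΩ.isOpen hΩ.isConnected.isPreconnected h.analytic
    hΩ.analytic ?_ ?_ _ (hmem ℓ) (hreg ℓ)).symm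
  · obtain ⟨r, hr, h1⟩ := h.agree
    filter_upwards [hΩ.agree, mem_nhdsWithin_of_mem_nhds (Metric.ball_mem_nhds (0 : ℂ) hr)]
      with z hz hzr hzΩ hzreg
    have h2 : F =ᶠ[𝓝[≠] z] G := by
      filter_upwards [hz hzΩ, mem_nhdsWithin_of_mem_nhds (Metric.isOpen_ball.mem_nhds hzr)]
        with w hw hwr
      rw [h1 w (by simpa using hwr), hw]
    have h3 : Tendsto F (𝓝[≠] z) (𝓝 (F z)) :=
      (h.analytic z hzreg).continuousAt.tendsto.mono_left nhdsWithin_le_nhds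
    have h4 : Tendsto G (𝓝[≠] z) (𝓝 (G z)) :=
      (hΩ.analytic z hzΩ).continuousAt.tendsto.mono_left nhdsWithin_le_nhds
    -- The germ matches a continuation only on punctured neighbourhoods. Continuity of F and G at z
    -- recovers the value at z itself.
    exact tendsto_nhds_unique (h3.congr' h2) h4
  -- The centres of the required discs tend to 0, so Ω does reach the region where the germs are
  -- compared.
  · exact (zpow_mul_tendsto_zero hQg lam).frequently
      (Frequently.of_forall fun k => ⟨hmem _, hreg _⟩)

lemma GlobalData.continuation_eq (h : GlobalData Q s lam U (g * N) W f F c) (hQ : 1 < ‖Q‖)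
    (hs : (0 : ℂ) ∉ s) (hlam : (lam : ℂ) ∈ regular Q s) (hU : IsFundamental Q s lam U)
    (hg : g ≠ 0) (hn : n ≠ 0) (hQn : Q ^ g = qPow τ (1 / (n : ℂ))) (hκ : (n : ℚ) / κ = N) (ℓ : ℤ) :
    continuation τ κ n lam f ((Q ^ g) ^ ℓ * lam) = F ((Q ^ g) ^ ℓ * lam) := by
  have hex : ∃ G, IsContinuation τ κ n lam f G :=
    ⟨F, _, h.isContinuationOn hQ hU hn hQn hκ⟩
  rw [continuation, dif_pos hex]
  exact h.eq_of_isContinuation hQ hs hlam hg hQn hex.choose_spec ℓ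

lemma GlobalData.qLaplaceTerm_eq (h : GlobalData Q s lam U (g * N) W f F c) (hQ : 1 < ‖Q‖)
    (hs : (0 : ℂ) ∉ s) (hlam : (lam : ℂ) ∈ regular Q s) (hU : IsFundamental Q s lam U)
    (hg : g ≠ 0) (hn : n ≠ 0) (hQn : Q ^ g = qPow τ (1 / (n : ℂ))) (hκ : (n : ℚ) / κ = N) (z : ℂ) :
    qLaplaceTerm τ κ n lam f z =
      lapTerm ((Q ^ g) ^ N) (Q ^ g) lam (fun ℓ => F ((Q ^ g) ^ ℓ * lam)) z := by
  funext ℓ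
  have hadd : qPow τ (1 / (κ : ℂ) + (ℓ : ℂ) / (n : ℂ)) = (Q ^ g) ^ N * (Q ^ g) ^ ℓ := by
    rw [hQn, ← qPow_inv τ hn hκ, ← qPow_div, qPow, qPow, qPow, ← Complex.exp_add]
    congr 1
    ring
  rw [qLaplaceTerm, lapTerm, hadd, qPow_div, ← hQn,
    h.continuation_eq hQ hs hlam hU hg hn hQn hκ, qPow_inv τ hn hκ, ← hQn]

/-- The `q`-Laplace transform is the average of the Laplace sums over the spirals. -/
theorem GlobalData.qLaplace_eq (h : GlobalData Q s lam U (g * N) W f F c) (hQ : 1 < ‖Q‖)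
    (hs : (0 : ℂ) ∉ s) (hlam : (lam : ℂ) ∈ regular Q s) (hU : IsFundamental Q s lam U)
    (hg : g ≠ 0) (hn : n ≠ 0) (hQn : Q ^ g = qPow τ (1 / (n : ℂ))) (hκ : (n : ℚ) / κ = N) :
    qLaplace τ κ n lam f =
      lap ((Q ^ g) ^ N) (Q ^ g) lam N (fun ℓ => F ((Q ^ g) ^ ℓ * lam)) := by
  funext z
  rw [qLaplace, lap, h.qLaplaceTerm_eq hQ hs hlam hU hg hn hQn hκ]
  congr 1
  -- The prefactor κ/n is 1/N, the normalisation of an average over N spirals.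
  have h1 := congrArg (fun x : ℚ => (x : ℂ)) hκ
  push_cast at h1
  rw [← h1, one_div_div]

lemma GlobalData.inH (h : GlobalData Q s lam U (g * N) W f F c) (hQ : 1 < ‖Q‖)
    (hU : IsFundamental Q s lam U) (hn : n ≠ 0) (hQn : Q ^ g = qPow τ (1 / (n : ℂ)))
    (hκ : (n : ℚ) / κ = N) (hf : MeromorphicNearZero f) : InH τ κ n lam f :=
  ⟨hf, F, _, h.isContinuationOn hQ hU hn hQn hκ⟩

theorem GlobalData.qLaplaceDefined (h : GlobalData Q s lam U (g * N) W f F c) (hQ : 1 < ‖Q‖)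
    (hs : (0 : ℂ) ∉ s) (hlam : (lam : ℂ) ∈ regular Q s) (hU : IsFundamental Q s lam U)
    (hg : g ≠ 0) (hN : N ≠ 0) (hn : n ≠ 0) (hQn : Q ^ g = qPow τ (1 / (n : ℂ)))
    (hκ : (n : ℚ) / κ = N) (hf : MeromorphicNearZero f) : QLaplaceDefined τ κ n lam f := by
  refine ⟨h.inH hQ hU hn hQn hκ hf, fun g₁ g₂ h₁ h₂ ℓ => ?_, ?_, ?_⟩
  · rw [qPow_div, ← hQn, h.eq_of_isContinuation hQ hs hlam hg hQn h₁,
      h.eq_of_isContinuation hQ hs hlam hg hQn h₂]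
  · filter_upwards [h.summable_lapTerm hQ hg hN lam.ne_zero] with z hz _
    rwa [h.qLaplaceTerm_eq hQ hs hlam hU hg hn hQn hκ]
  · rw [h.qLaplace_eq hQ hs hlam hU hg hn hQn hκ]
    exact (h.laplace hQ hg hN lam.ne_zero).meromorphicNearZero

end QDiff

end

/-! ### Newton polygons, dominant monomials, and operators on formal series -/

noncomputable section

namespace QDiff

/-! ### Newton polygons -/

/-- `a` is the abscissa of the right end of the part of the boundary of slope `s`. -/
structure IsRightmostMin (P : ℤ →₀ ℂ[X]) (s : ℚ) (a : ℤ) : Prop where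
  mem : a ∈ P.support
  le : ∀ b ∈ P.support,
    ((P a).natTrailingDegree : ℚ) - s * a ≤ (P b).natTrailingDegree - s * b
  lt : ∀ b ∈ P.support, a < b →
    ((P a).natTrailingDegree : ℚ) - s * a < (P b).natTrailingDegree - s * b

lemma exists_isRightmostMin {P : ℤ →₀ ℂ[X]} (hP : P ≠ 0) (s : ℚ) : ∃ a, IsRightmostMin P s a := by
  -- A lexicographic minimum: lowest for the direction s, and rightmost among ties.
  obtain ⟨a, ha, h⟩ := Finset.exists_min_image P.support
    (fun a => toLex (((P a).natTrailingDegree : ℚ) - s * a, -a)) (Finsupp.support_nonempty_iff.2 hP)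
  simp only [Prod.Lex.toLex_le_toLex] at h
  refine ⟨a, ha, fun b hb => ?_, fun b hb hab => ?_⟩
  · rcases h b hb with h | h
    · exact h.le
    · exact h.1.le
  · rcases h b hb with h | h
    · exact h
    · have := h.2; omega

lemma mem_newtonPolygon {P : ℤ →₀ ℂ[X]} {a : ℤ} (ha : a ∈ P.support) :
    ((a : ℝ), ((P a).natTrailingDegree : ℝ)) ∈ newtonPolygon P :=
  subset_convexHull ℝ _ ⟨a, ha, rfl, le_rfl⟩

/-- The half-plane above the line is convex, so it suffices to test the vertices. -/
lemma isSlope_of_forall_le {P : ℤ →₀ ℂ[X]} {s : ℚ} {a b : ℤ} (ha : a ∈ P.support)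
    (hb : b ∈ P.support) (hab : a < b)
    (h : ((P b).natTrailingDegree : ℚ) - (P a).natTrailingDegree = s * (b - a))
    (hle : ∀ i ∈ P.support,
      ((P a).natTrailingDegree : ℚ) + s * (i - a) ≤ (P i).natTrailingDegree) : IsSlope P s := by
  refine ⟨_, mem_newtonPolygon ha, _, mem_newtonPolygon hb, by simpa using hab, ?_,
    fun c hc => ?_⟩
  · have := congrArg (fun x : ℚ => (x : ℝ)) h
    push_cast at this
    exact this
  have hconv : Convex ℝ {c : ℝ × ℝ | ((P a).natTrailingDegree : ℝ) + (s : ℝ) * (c.1 - a) ≤ c.2} := by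
    intro x hx y hy u v hu hv huv
    simp only [Set.mem_ofPred_eq, Prod.fst_add, Prod.smul_fst, Prod.snd_add, Prod.smul_snd,
      smul_eq_mul] at *
    have hv' : v = 1 - u := by linarith
    subst hv'
    nlinarith [mul_le_mul_of_nonneg_left hx hu, mul_le_mul_of_nonneg_left hy hv]
  refine convexHull_min ?_ hconv hc
  rintro ⟨x, y⟩ ⟨i, hi, hx, hy⟩
  simp only at hx hy
  subst hx
  refine le_trans ?_ hy
  have := (Rat.cast_le (K := ℝ)).2 (hle i hi)
  push_cast at this
  exact this

/-- To the right of the face of slope `s` there is a face of larger slope. -/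
lemma IsRightmostMin.exists_isSlope {P : ℤ →₀ ℂ[X]} {s : ℚ} {a : ℤ} (h : IsRightmostMin P s a)
    {b : ℤ} (hb : b ∈ P.support) (hab : a < b) : ∃ t : ℚ, s < t ∧ IsSlope P t ∧
      t * (b - a) ≤ ((P b).natTrailingDegree : ℚ) - (P a).natTrailingDegree := by
  -- The chord of least slope from a to a point on its right is an edge, and the rightmost choice of
  -- a makes its slope exceed s.
  obtain ⟨b₀, hb₀, hmin⟩ := Finset.exists_min_image (P.support.filter (a < ·))
    (fun b => (((P b).natTrailingDegree : ℚ) - (P a).natTrailingDegree) / (b - a))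
    ⟨b, Finset.mem_filter.2 ⟨hb, hab⟩⟩
  obtain ⟨hb₀, hab₀⟩ := Finset.mem_filter.1 hb₀
  have hpos : ∀ i : ℤ, a < i → (0 : ℚ) < i - a := fun i hi => by
    have : (a : ℚ) < i := by exact_mod_cast hi
    linarith
  have h0 := hpos b₀ hab₀
  have hst : s < (((P b₀).natTrailingDegree : ℚ) - (P a).natTrailingDegree) / (b₀ - a) := by
    rw [lt_div_iff₀ h0]
    have := h.lt b₀ hb₀ hab₀
    linarith
  refine ⟨_, hst, isSlope_of_forall_le h.mem hb₀ hab₀ (by field_simp) fun i hi => ?_, ?_⟩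
  · rcases lt_or_ge a i with hai | hai
    · have := hmin i (Finset.mem_filter.2 ⟨hi, hai⟩)
      rw [le_div_iff₀ (hpos i hai)] at this
      linarith
    · have h1 := h.le i hi
      have h2 : (i : ℚ) - a ≤ 0 := by
        have : (i : ℚ) ≤ a := by exact_mod_cast hai
        linarith
      nlinarith [mul_le_mul_of_nonpos_right hst.le h2]
  · have := hmin b (Finset.mem_filter.2 ⟨hb, hab⟩)
    rwa [le_div_iff₀ (hpos b hab)] at this

/-- The monomials `z ^ d σ_q ^ a` of an operator, with their coefficients. -/
def monomials (P : ℤ →₀ ℂ[X]) : ℤ × ℕ →₀ ℂ :=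
  Finsupp.onFinset (P.support ×ˢ Finset.range (P.support.sup (fun a => (P a).natDegree) + 1))
    (fun t => (P t.1).coeff t.2) (by
      rintro ⟨a, d⟩ h
      have ha : a ∈ P.support := by
        rw [Finsupp.mem_support_iff]
        rintro h0
        simp [h0] at h
      refine Finset.mem_product.2 ⟨ha, Finset.mem_range_succ_iff.2 ?_⟩
      exact (le_natDegree_of_ne_zero h).trans
        (Finset.le_sup (f := fun a => (P a).natDegree) ha))

lemma mem_support_monomials {P : ℤ →₀ ℂ[X]} {t : ℤ × ℕ} :
    t ∈ (monomials P).support ↔ (P t.1).coeff t.2 ≠ 0 := by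
  rw [Finsupp.mem_support_iff]; rfl

lemma natTrailingDegree_le_of_mem_support {P : ℤ →₀ ℂ[X]} {t : ℤ × ℕ}
    (h : t ∈ (monomials P).support) :
    t.1 ∈ P.support ∧ (P t.1).natTrailingDegree ≤ t.2 := by
  rw [mem_support_monomials] at h
  refine ⟨?_, natTrailingDegree_le_of_ne_zero h⟩
  rw [Finsupp.mem_support_iff]
  rintro h0
  simp [h0] at h

/-- If there is no slope between `s` and `K / D`, then the monomial at the right end of the face of
slope `s` has maximal shift exponent at level `D`. -/
lemma exists_isTop {P : ℤ →₀ ℂ[X]} (hP : P ≠ 0) {K D : ℕ} {s : ℚ} (hs : D * s ≤ K)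
    (hno : ∀ t : ℚ, s < t → D * t < K → ¬ IsSlope P t) :
    ∃ (I : ℤ) (J : ℕ), IsTop K D (monomials P) I J ∧
      ∀ t ∈ (monomials P).support, (J : ℚ) - s * I ≤ t.2 - s * t.1 := by
  obtain ⟨a, ha⟩ := exists_isRightmostMin hP s
  have hle : ∀ t ∈ (monomials P).support,
      ((P a).natTrailingDegree : ℚ) - s * a ≤ t.2 - s * t.1 := fun t ht => by
    obtain ⟨h1, h2⟩ := natTrailingDegree_le_of_mem_support ht
    have h3 := ha.le _ h1
    have h4 : ((P t.1).natTrailingDegree : ℚ) ≤ t.2 := by exact_mod_cast h2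
    linarith
  refine ⟨a, (P a).natTrailingDegree, ⟨?_, fun t ht => ?_⟩, hle⟩
  · rw [mem_support_monomials]
    have := Finsupp.mem_support_iff.1 ha.mem
    rwa [← trailingCoeff, ne_eq, trailingCoeff_eq_zero]
  · obtain ⟨h1, h2⟩ := natTrailingDegree_le_of_mem_support ht
    have h4 : ((P t.1).natTrailingDegree : ℚ) ≤ t.2 := by exact_mod_cast h2
    have hD : (0 : ℚ) ≤ D := by positivity
    suffices (K : ℚ) * t.1 - D * t.2 ≤ K * a - D * (P a).natTrailingDegree by
      rw [shiftExp, shiftExp]; exact_mod_cast this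
    by_contra! hlt
    -- A larger shift on the right of a would force an edge whose slope u satisfies s < u and D u <
    -- K, which is excluded. On the left, minimality for the direction s and D s ≤ K already
    -- contradict it.
    rcases lt_or_ge a t.1 with hat | hat
    · obtain ⟨u, hu1, hu2, hu3⟩ := ha.exists_isSlope h1 hat
      refine hno u hu1 ?_ hu2
      have h5 : (0 : ℚ) < t.1 - a := by
        have : (a : ℚ) < t.1 := by exact_mod_cast hat
        linarith
      refine lt_of_mul_lt_mul_right ?_ h5.le
      nlinarith [mul_le_mul_of_nonneg_left hu3 hD, mul_le_mul_of_nonneg_left h4 hD]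
    · have h5 : (0 : ℚ) ≤ a - t.1 := by
        have : (t.1 : ℚ) ≤ a := by exact_mod_cast hat
        linarith
      nlinarith [mul_le_mul_of_nonneg_left (hle t ht) hD, mul_le_mul_of_nonneg_right hs h5]

/-! ### Action of operators on formal series -/

lemma coeff_polynomial_mul (b : ℂ[X]) {n : ℕ} (hn : b.natDegree < n) (g : PowerSeries ℂ) (k : ℕ) :
    PowerSeries.coeff k ((b : PowerSeries ℂ) * g) =
      ∑ d ∈ Finset.range n, b.coeff d * if d ≤ k then PowerSeries.coeff (k - d) g else 0 := by
  conv_lhs => rw [b.as_sum_range_C_mul_X_pow' hn]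
  rw [← Polynomial.coeToPowerSeries.ringHom_apply, map_sum, Finset.sum_mul, map_sum]
  refine Finset.sum_congr rfl fun d _ => ?_
  rw [Polynomial.coeToPowerSeries.ringHom_apply, Polynomial.coe_mul, Polynomial.coe_C,
    Polynomial.coe_pow, Polynomial.coe_X, mul_assoc, PowerSeries.coeff_C_mul,
    PowerSeries.coeff_X_pow_mul']

lemma coeff_applyOp (q : ℂ) (P : ℤ →₀ ℂ[X]) (h : PowerSeries ℂ) (k : ℕ) :
    PowerSeries.coeff k (applyOp q P h) = ∑ t ∈ (monomials P).support, monomials P t *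
      if t.2 ≤ k then (q ^ t.1) ^ (k - t.2) * PowerSeries.coeff (k - t.2) h else 0 := by
  have h1 : ∑ t ∈ (monomials P).support, monomials P t *
      (if t.2 ≤ k then (q ^ t.1) ^ (k - t.2) * PowerSeries.coeff (k - t.2) h else 0) =
      ∑ t ∈ P.support ×ˢ Finset.range (P.support.sup (fun a => (P a).natDegree) + 1),
        (P t.1).coeff t.2 *
        (if t.2 ≤ k then (q ^ t.1) ^ (k - t.2) * PowerSeries.coeff (k - t.2) h else 0) :=
    Finsupp.onFinset_sum (g := fun (t : ℤ × ℕ) (x : ℂ) => x *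
      (if t.2 ≤ k then (q ^ t.1) ^ (k - t.2) * PowerSeries.coeff (k - t.2) h else 0)) _
      fun _ => zero_mul _
  rw [h1, Finset.sum_product, applyOp, Finsupp.sum, map_sum]
  refine Finset.sum_congr rfl fun a ha => ?_
  rw [coeff_polynomial_mul _ (Nat.lt_succ_of_le
    (Finset.le_sup (f := fun a => (P a).natDegree) ha))]
  simp only [PowerSeries.coeff_rescale]

end QDiff

end

/-! ### Convergence of Borel transforms and their sums near 0 -/

noncomputable section

namespace QDiff

variable {Q : ℂ} {K D : ℕ} {S : ℤ × ℕ →₀ ℂ} {I : ℤ} {J : ℕ}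

/-! ### Convergence of the Borel transform of a formal solution -/

/-- M exceeds the sum of the coefficients and every lag is at least 1, so one factor M pays for one
application of the recursion. L covers the values before n₀. -/
lemma geometric_of_recursion {ι : Type*} (T : Finset ι) {B : ι → ℝ} (hB : ∀ t ∈ T, 0 ≤ B t)
    {δ : ι → ℕ} (hδ : ∀ t ∈ T, 1 ≤ δ t) {b : ℕ → ℝ} (hb : ∀ n, 0 ≤ b n) {n₀ : ℕ}
    (h : ∀ n ≥ n₀, b n ≤ ∑ t ∈ T, B t * if δ t ≤ n then b (n - δ t) else 0) :
    ∃ L M : ℝ, 1 ≤ M ∧ ∀ n, b n ≤ L * M ^ n := by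
  have hM1 : 0 ≤ ∑ t ∈ T, B t := Finset.sum_nonneg hB
  set M := 1 + ∑ t ∈ T, B t with hM
  have hL0 : 0 ≤ ∑ n ∈ Finset.range n₀, b n := Finset.sum_nonneg fun n _ => hb n
  refine ⟨∑ n ∈ Finset.range n₀, b n, M, by linarith, fun n => ?_⟩
  set L := ∑ n ∈ Finset.range n₀, b n
  induction n using Nat.strong_induction_on with
  | _ n ih =>
    rcases lt_or_ge n n₀ with hn | hn
    · calc b n ≤ L := Finset.single_le_sum (fun i _ => hb i) (Finset.mem_range.2 hn)
        _ ≤ L * M ^ n := le_mul_of_one_le_right hL0 (one_le_pow₀ (by linarith))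
    · refine le_of_mul_le_mul_right ?_ (show 0 < M by linarith)
      calc b n * M ≤ (∑ t ∈ T, B t * if δ t ≤ n then b (n - δ t) else 0) * M := by
            gcongr
            exact h n hn
        _ = ∑ t ∈ T, B t * ((if δ t ≤ n then b (n - δ t) else 0) * M) := by
            rw [Finset.sum_mul]
            exact Finset.sum_congr rfl fun t _ => mul_assoc _ _ _
        _ ≤ ∑ t ∈ T, B t * (L * M ^ n) := by
            refine Finset.sum_le_sum fun t ht => mul_le_mul_of_nonneg_left ?_ (hB t ht)
            split_ifs with hle
            · have h1 := hδ t ht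
              calc b (n - δ t) * M ≤ L * M ^ (n - δ t) * M := by
                    gcongr
                    exact ih _ (by omega)
                _ = L * M ^ (n - δ t + 1) := by ring
                _ ≤ L * M ^ n := by
                    gcongr
                    · linarith
                    · omega
            · rw [zero_mul]; positivity
        _ = (∑ t ∈ T, B t) * (L * M ^ n) := (Finset.sum_mul _ _ _).symm
        _ ≤ L * M ^ n * M := by
            have : 0 ≤ L * M ^ n := by positivity
            nlinarith

/-- The coefficients of the image of the series `∑ c k z ^ k` by an operator of level `D`. -/
def opCoeff (Q : ℂ) (K D : ℕ) (S : ℤ × ℕ →₀ ℂ) (c : ℕ → ℂ) (k : ℕ) : ℂ :=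
  ∑ t ∈ S.support, S t * borelFactor Q D t.2 *
    if t.2 ≤ k then (Q ^ shiftExp K D t) ^ (k - t.2) * c (k - t.2) else 0

/-- The formal Borel transformation conjugates P into its operator of level D. For coefficients this
is the expansion of (d + j choose 2). -/
lemma opCoeff_monomials (hQ0 : Q ≠ 0) (P : ℤ →₀ ℂ[X]) (h : PowerSeries ℂ) (k : ℕ) :
    opCoeff Q K D (monomials P) (fun k => PowerSeries.coeff k h * borelFactor Q D k) k =
      PowerSeries.coeff k (applyOp (Q ^ K) P h) * borelFactor Q D k := by
  rw [coeff_applyOp, Finset.sum_mul, opCoeff]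
  refine Finset.sum_congr rfl fun t _ => ?_
  split_ifs with hle
  · obtain ⟨j, rfl⟩ := Nat.exists_eq_add_of_le hle
    rw [Nat.add_sub_cancel_left]
    have : borelFactor Q D t.2 * (Q ^ shiftExp K D t) ^ j * borelFactor Q D j =
        ((Q ^ K) ^ t.1) ^ j * borelFactor Q D (t.2 + j) := by
      rw [borelFactor, borelFactor, borelFactor, choose_two_add]
      simp only [← zpow_natCast, ← zpow_mul, ← zpow_neg, ← zpow_add₀ hQ0]
      congr 1
      rw [shiftExp]
      push_cast
      ring
    calc _ = monomials P t * (borelFactor Q D t.2 * (Q ^ shiftExp K D t) ^ j * borelFactor Q D j) *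
          PowerSeries.coeff j h := by ring
      _ = _ := by rw [this]; ring
  · simp

/-- Among monomials of the same degree J the shift determines the exponent of σ_q, so (I, J) is the
only one of maximal shift and dominates as n → ∞. -/
lemma exists_le_norm_leading (hQ : 1 < ‖Q‖) (hK : K ≠ 0) (htop : IsTop K D S I J) :
    ∃ C₀ : ℝ, 0 < C₀ ∧ ∀ᶠ n : ℕ in atTop, C₀ * ‖Q ^ shiftExp K D (I, J)‖ ^ n ≤
      ‖∑ t ∈ S.support with t.2 = J, S t * borelFactor Q D J * (Q ^ shiftExp K D t) ^ n‖ := by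
  have hQ0 := ne_zero_of_one_lt_norm hQ
  set E := shiftExp K D (I, J)
  have hlim : Tendsto (fun n : ℕ => ∑ t ∈ S.support with t.2 = J,
      S t * borelFactor Q D J * (Q ^ (shiftExp K D t - E)) ^ n) atTop
      (𝓝 (∑ t ∈ S.support with t.2 = J, if t = (I, J) then S t * borelFactor Q D J else 0)) := by
    refine tendsto_finsetSum _ fun t ht => ?_
    obtain ⟨ht, htJ⟩ := Finset.mem_filter.1 ht
    split_ifs with h
    · subst h
      simp [E]
    · rw [← mul_zero (S t * borelFactor Q D J)]
      refine Tendsto.const_mul _ (tendsto_pow_atTop_nhds_zero_of_norm_lt_one ?_)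
      rw [norm_zpow]
      refine zpow_lt_one_of_neg₀ hQ (sub_neg.2 (lt_of_le_of_ne (htop.le t ht) fun he => h ?_))
      have h2 : (K : ℤ) * t.1 = K * I := by
        simp only [E, shiftExp, htJ] at he
        linarith
      exact Prod.ext (mul_left_cancel₀ (by exact_mod_cast hK) h2) htJ
  have hmem : (I, J) ∈ S.support.filter fun t => t.2 = J := Finset.mem_filter.2 ⟨htop.mem, rfl⟩
  rw [Finset.sum_ite_eq' _ (I, J), if_pos hmem] at hlim
  have hne : 0 < ‖S (I, J) * borelFactor Q D J‖ := norm_pos_iff.2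
    (mul_ne_zero (Finsupp.mem_support_iff.1 htop.mem) (borelFactor_ne_zero hQ0 _ _))
  refine ⟨_, half_pos hne, ?_⟩
  filter_upwards [hlim.norm.eventually_const_lt (half_lt_self hne)] with n hn
  have : ∑ t ∈ S.support with t.2 = J, S t * borelFactor Q D J * (Q ^ shiftExp K D t) ^ n =
      (∑ t ∈ S.support with t.2 = J, S t * borelFactor Q D J * (Q ^ (shiftExp K D t - E)) ^ n) *
        (Q ^ E) ^ n := by
    rw [Finset.sum_mul]
    refine Finset.sum_congr rfl fun t _ => ?_
    rw [mul_assoc _ (_ ^ n), ← mul_pow, ← zpow_add₀ hQ0, sub_add_cancel]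
  rw [this, norm_mul (∑ t ∈ _, _), norm_pow]
  gcongr

/-- A series solution of a `q`-difference equation whose dominant monomial has minimal degree is
convergent. -/
theorem exists_geometric_bound (hQ : 1 < ‖Q‖) (hK : K ≠ 0) (htop : IsTop K D S I J)
    (hJ : ∀ t ∈ S.support, J ≤ t.2) {c : ℕ → ℂ}
    (hc : ∀ᶠ k in atTop, opCoeff Q K D S c k = 0) :
    ∃ L M : ℝ, 1 ≤ M ∧ ∀ n, ‖c n‖ ≤ L * M ^ n := by
  have hQ0 := ne_zero_of_one_lt_norm hQ
  obtain ⟨C₀, hC₀, hlead⟩ := exists_le_norm_leading hQ hK htop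
  set E := shiftExp K D (I, J)
  have hE : 0 < ‖Q ^ E‖ := norm_pos_iff.2 (zpow_ne_zero _ hQ0)
  obtain ⟨n₀, hn₀⟩ := eventually_atTop.1 (((tendsto_add_atTop_nat J).eventually hc).and hlead)
  refine geometric_of_recursion (S.support.filter fun t => ¬ t.2 = J)
    (B := fun t => C₀⁻¹ * (‖S t * borelFactor Q D t.2‖ * (‖Q ^ E‖ ^ (t.2 - J))⁻¹))
    (fun t _ => by positivity) (δ := fun t => t.2 - J) (fun t ht => ?_) (fun n => norm_nonneg _)
    (n₀ := n₀) fun n hn => ?_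
  · obtain ⟨ht, h1⟩ := Finset.mem_filter.1 ht
    have := hJ t ht
    omega
  · obtain ⟨h1, h2⟩ := hn₀ n hn
    -- In the coefficient of index n + J, monomials of degree J involve c n and all others involve
    -- earlier coefficients. Their shifts are at most E, so division by the leading factor leaves
    -- coefficients bounded independently of n.
    rw [opCoeff, ← Finset.sum_filter_add_sum_filter_not S.support (fun t => t.2 = J)] at h1
    have h3 : ∑ t ∈ S.support with t.2 = J, S t * borelFactor Q D t.2 *
        (if t.2 ≤ n + J then (Q ^ shiftExp K D t) ^ (n + J - t.2) * c (n + J - t.2) else 0) =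
        (∑ t ∈ S.support with t.2 = J, S t * borelFactor Q D J * (Q ^ shiftExp K D t) ^ n) *
          c n := by
      rw [Finset.sum_mul]
      refine Finset.sum_congr rfl fun t ht => ?_
      rw [(Finset.mem_filter.1 ht).2, if_pos (Nat.le_add_left _ _), Nat.add_sub_cancel]
      ring
    rw [h3] at h1
    have h4 := congrArg norm (eq_neg_of_add_eq_zero_left h1)
    rw [norm_neg, norm_mul] at h4
    have h5 : C₀ * ‖Q ^ E‖ ^ n * ‖c n‖ ≤ ∑ t ∈ S.support with ¬ t.2 = J,
        ‖S t * borelFactor Q D t.2‖ * ((‖Q ^ E‖ ^ (t.2 - J))⁻¹ * ‖Q ^ E‖ ^ n) *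
          if t.2 - J ≤ n then ‖c (n - (t.2 - J))‖ else 0 := by
      calc C₀ * ‖Q ^ E‖ ^ n * ‖c n‖ ≤ _ := mul_le_mul_of_nonneg_right h2 (norm_nonneg _)
        _ = _ := h4
        _ ≤ _ := (norm_sum_le _ _).trans (Finset.sum_le_sum fun t ht => ?_)
      obtain ⟨ht, -⟩ := Finset.mem_filter.1 ht
      have hJt := hJ t ht
      rw [norm_mul, mul_assoc]
      refine mul_le_mul_of_nonneg_left ?_ (norm_nonneg _)
      by_cases hle : t.2 ≤ n + J
      · rw [if_pos hle, if_pos (by omega), norm_mul, norm_pow,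
          show n + J - t.2 = n - (t.2 - J) by omega]
        refine mul_le_mul_of_nonneg_right ?_ (norm_nonneg _)
        calc ‖Q ^ shiftExp K D t‖ ^ (n - (t.2 - J)) ≤ ‖Q ^ E‖ ^ (n - (t.2 - J)) := by
              rw [norm_zpow, norm_zpow]
              gcongr
              · exact hQ.le
              · exact htop.le t ht
          _ = _ := by
              rw [eq_inv_mul_iff_mul_eq₀ (by positivity), ← pow_add]
              congr 1
              omega
      · rw [if_neg hle, if_neg (by omega)]
        simp
    have hpos : 0 < C₀ * ‖Q ^ E‖ ^ n := by positivity
    refine le_of_mul_le_mul_left (h5.trans (le_of_eq ?_)) hpos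
    rw [Finset.mul_sum]
    refine Finset.sum_congr rfl fun t _ => ?_
    field_simp

/-! ### The sum of a convergent series -/

variable {H : PowerSeries ℂ} {L M : ℝ}

lemma hasSum_seriesSum (hM : 1 ≤ M) (h : ∀ k, ‖PowerSeries.coeff k H‖ ≤ L * M ^ k) {z : ℂ}
    (hz : M * ‖z‖ < 1) : HasSum (fun k => PowerSeries.coeff k H * z ^ k) (seriesSum H z) := by
  refine Summable.hasSum (Summable.of_norm_bounded
    ((summable_geometric_of_lt_one (by positivity) hz).mul_left L) fun k => ?_)
  rw [norm_mul, norm_pow, mul_pow, ← mul_assoc]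
  gcongr
  exact h k

lemma convergent_of_bound (hM : 1 ≤ M) (h : ∀ k, ‖PowerSeries.coeff k H‖ ≤ L * M ^ k) :
    Convergent H := by
  refine ⟨(2 * M)⁻¹, by positivity, Summable.of_nonneg_of_le (fun k => by positivity) (fun k => ?_)
    ((summable_geometric_of_lt_one (r := 1 / 2) (by norm_num) (by norm_num)).mul_left L)⟩
  calc ‖PowerSeries.coeff k H‖ * (2 * M)⁻¹ ^ k ≤ L * M ^ k * (2 * M)⁻¹ ^ k := by
        gcongr
        exact h k
    _ = L * (1 / 2) ^ k := by
        rw [mul_assoc, ← mul_pow]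
        congr 2
        field_simp

lemma analyticAt_seriesSum (hM : 1 ≤ M) (h : ∀ k, ‖PowerSeries.coeff k H‖ ≤ L * M ^ k) {z : ℂ}
    (hz : M * ‖z‖ < 1) : AnalyticAt ℂ (seriesSum H) z := by
  obtain ⟨r, hr1, hr2⟩ := exists_between hz
  have hr0 : 0 ≤ r := (by positivity : 0 ≤ M * ‖z‖).trans hr1.le
  have hopen : IsOpen {w : ℂ | M * ‖w‖ < r} := isOpen_lt (by fun_prop) continuous_const
  have hd : DifferentiableOn ℂ (fun w => ∑' k : ℕ, PowerSeries.coeff k H * w ^ k)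
      {w : ℂ | M * ‖w‖ < r} := by
    refine Complex.differentiableOn_tsum_of_summable_norm
      ((summable_geometric_of_lt_one hr0 hr2).mul_left L) (fun k => by fun_prop) hopen
      fun k w hw => ?_
    have hw : M * ‖w‖ < r := hw
    have hL : 0 ≤ L := (norm_nonneg _).trans (by simpa using h 0)
    calc ‖PowerSeries.coeff k H * w ^ k‖ ≤ L * M ^ k * ‖w‖ ^ k := by
          rw [norm_mul, norm_pow]
          gcongr
          exact h k
      _ = L * (M * ‖w‖) ^ k := by ring
      _ ≤ _ := by gcongr
  exact hd.analyticAt (hopen.mem_nhds hr1)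

lemma norm_seriesSum_sub_le (hM : 1 ≤ M) (h : ∀ k, ‖PowerSeries.coeff k H‖ ≤ L * M ^ k) (m : ℕ)
    {z : ℂ} (hz : 2 * (M * ‖z‖) < 1) :
    ‖seriesSum H z - ∑ i ∈ Finset.range m, PowerSeries.coeff i H * z ^ i‖ ≤
      2 * L * M ^ m * ‖z‖ ^ m := by
  have h0 : 0 ≤ M * ‖z‖ := by positivity
  have hz1 : M * ‖z‖ < 1 := by linarith
  have hL : 0 ≤ L := (norm_nonneg _).trans (by simpa using h 0)
  have hs := (hasSum_nat_add_iff' m).2 (hasSum_seriesSum hM h hz1)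
  have hg := (hasSum_geometric_of_lt_one h0 hz1).mul_left (L * (M * ‖z‖) ^ m)
  rw [← hs.tsum_eq]
  refine (tsum_of_norm_bounded hg fun i => ?_).trans ?_
  · rw [norm_mul, norm_pow, mul_assoc, ← pow_add, mul_pow, ← mul_assoc, add_comm m i]
    gcongr
    exact h _
  · have h1 : (1 - M * ‖z‖)⁻¹ ≤ 2 := by
      rw [inv_le_comm₀ (by linarith) two_pos]
      linarith
    calc L * (M * ‖z‖) ^ m * (1 - M * ‖z‖)⁻¹ ≤ L * (M * ‖z‖) ^ m * 2 := by gcongr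
      _ = _ := by rw [mul_pow]; ring

theorem localData_seriesSum (lam : ℂ) (hM : 1 ≤ M) (h : ∀ k, ‖PowerSeries.coeff k H‖ ≤ L * M ^ k) :
    LocalData Q lam 1 (seriesSum H) (fun k => PowerSeries.coeff k H) := by
  have hR : ∀ z : ℂ, ‖z‖ < (2 * M)⁻¹ → 2 * (M * ‖z‖) < 1 := by
    intro z hz
    calc 2 * (M * ‖z‖) < 2 * (M * (2 * M)⁻¹) := by gcongr
      _ = 1 := by field_simp
  refine ⟨le_rfl, ⟨L, M, hM, by simpa using h⟩, (2 * M)⁻¹, by positivity, fun z _ hz => ?_,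
    fun z _ hz _ => ?_, fun ε _ => ⟨2 * L + 1, M, ?_, hM, fun m z _ hz _ => ?_⟩⟩
  · exact (analyticAt_seriesSum hM h (by have := hR z hz; linarith [norm_nonneg z])).meromorphicAt
  · exact analyticAt_seriesSum hM h (by have := hR z hz; linarith [norm_nonneg z])
  · have hL : 0 ≤ L := (norm_nonneg _).trans (by simpa using h 0)
    linarith
  · refine (norm_seriesSum_sub_le hM h m (hR z hz)).trans ?_
    rw [one_pow, mul_one]
    gcongr
    linarith

/-- Linear relations between formal series give linear relations between the sums of their Borel
transforms. -/
theorem seriesSum_relation {ι : Type*} [Fintype ι] (hQ0 : Q ≠ 0) {h H : ι → PowerSeries ℂ}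
    {P : ι → ℤ →₀ ℂ[X]} {A : ℂ[X]}
    (hA : ∑ j, applyOp (Q ^ K) (P j) (h j) = (A : PowerSeries ℂ))
    (hH : ∀ j k, PowerSeries.coeff k (H j) = PowerSeries.coeff k (h j) * borelFactor Q D k)
    (hbd : ∀ j, ∃ L M : ℝ, 1 ≤ M ∧ ∀ k, ‖PowerSeries.coeff k (H j)‖ ≤ L * M ^ k) :
    ∀ᶠ z in 𝓝[≠] (0 : ℂ),
      ∑ j, opVal Q K D (monomials (P j)) (seriesSum (H j)) z = rhsVal Q D A z := by
  have hnear : ∀ j, ∀ᶠ z in 𝓝[≠] (0 : ℂ),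
      HasSum (fun k => PowerSeries.coeff k (H j) * z ^ k) (seriesSum (H j) z) := by
    intro j
    obtain ⟨L, M, hM, hb⟩ := hbd j
    have : ∀ᶠ z in 𝓝 (0 : ℂ), M * ‖z‖ < 1 := by
      have : Tendsto (fun z : ℂ => M * ‖z‖) (𝓝 0) (𝓝 (M * ‖(0 : ℂ)‖)) :=
        (continuous_const.mul continuous_norm).tendsto 0
      rw [norm_zero, mul_zero] at this
      exact this.eventually_lt_const one_pos
    filter_upwards [nhdsWithin_le_nhds this] with z hz
    exact hasSum_seriesSum hM hb hz
  have hall : ∀ᶠ z in 𝓝[≠] (0 : ℂ), ∀ j, ∀ t ∈ (monomials (P j)).support,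
      HasSum (fun k => PowerSeries.coeff k (H j) * (Q ^ shiftExp K D t * z) ^ k)
        (seriesSum (H j) (Q ^ shiftExp K D t * z)) :=
    eventually_all.2 fun j => (Finset.eventually_all _).2 fun t _ =>
      (tendsto_const_mul_punctured (zpow_ne_zero _ hQ0)).eventually (hnear j)
  filter_upwards [hall] with z hz
  have h1 : HasSum (fun k => ∑ j, opCoeff Q K D (monomials (P j))
      (fun k => PowerSeries.coeff k (H j)) k * z ^ k)
      (∑ j, opVal Q K D (monomials (P j)) (seriesSum (H j)) z) := by
    refine hasSum_sum fun j _ => ?_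
    simp only [opCoeff, Finset.sum_mul]
    refine hasSum_sum fun t ht => ?_
    have h2 := (hz j t ht).mul_left (monomials (P j) t * borelFactor Q D t.2 * z ^ t.2)
    refine ((add_left_injective t.2).hasSum_iff fun k hk => ?_).1
      (Eq.mpr (congrArg (fun f : ℕ → ℂ => HasSum f _) (funext fun k => ?_)) h2)
    · rw [if_neg fun hle => hk ⟨k - t.2, Nat.sub_add_cancel hle⟩]
      simp
    · simp only [Function.comp_apply]
      rw [if_pos (Nat.le_add_left _ _), Nat.add_sub_cancel, mul_pow, pow_add]
      ring
  have h3 : ∀ k, ∑ j, opCoeff Q K D (monomials (P j)) (fun k => PowerSeries.coeff k (H j)) k *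
      z ^ k = A.coeff k * borelFactor Q D k * z ^ k := by
    intro k
    simp only [hH]
    simp only [opCoeff_monomials hQ0]
    rw [← Finset.sum_mul, ← Finset.sum_mul, ← map_sum, hA, Polynomial.coeff_coe]
  simp only [h3] at h1
  refine h1.unique (hasSum_sum_of_ne_finset_zero fun k hk => ?_)
  rw [notMem_support_iff.1 hk, zero_mul, zero_mul]

end QDiff

end

/-! ### Stages of the summation: estimates together with all linear relations -/

noncomputable section

namespace QDiff

variable {Q : ℂ} {K D N : ℕ} {s : Finset ℂ} {ι : Type*} [Fintype ι]

/-! ### Linear relations and operators on functions -/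

lemma analyticOnNhd_opVal (hQ : 1 < ‖Q‖) {S : ℤ × ℕ →₀ ℂ} {F : ℂ → ℂ}
    (hF : AnalyticOnNhd ℂ F (regular Q s)) : AnalyticOnNhd ℂ (opVal Q K D S F) (regular Q s) := by
  intro z hz
  refine Finset.analyticAt_fun_sum _ fun t _ => AnalyticAt.mul (by fun_prop) ?_
  exact (hF _ ((zpow_mul_mem_regular hQ _ _).2 hz)).comp_of_eq (analyticAt_const_mul' _ z) rfl

lemma analyticAt_rhsVal (A : ℂ[X]) (z : ℂ) : AnalyticAt ℂ (rhsVal Q D A) z :=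
  Finset.analyticAt_fun_sum _ fun t _ => by fun_prop

lemma eventually_opVal_congr (hQ0 : Q ≠ 0) {S : ι → ℤ × ℕ →₀ ℂ} {F φ : ι → ℂ → ℂ}
    (h : ∀ j, ∃ r : ℝ, 0 < r ∧ ∀ z, ‖z‖ < r → F j z = φ j z) :
    ∀ᶠ z in 𝓝[≠] (0 : ℂ), ∑ j, opVal Q K D (S j) (F j) z = ∑ j, opVal Q K D (S j) (φ j) z := by
  have h1 : ∀ j, ∀ᶠ z in 𝓝[≠] (0 : ℂ), F j z = φ j z := by
    intro j
    obtain ⟨r, hr, h⟩ := h j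
    filter_upwards [mem_nhdsWithin_of_mem_nhds (Metric.ball_mem_nhds (0 : ℂ) hr)] with z hz
    exact h z (by simpa using hz)
  have h2 : ∀ᶠ z in 𝓝[≠] (0 : ℂ), ∀ j, ∀ t ∈ (S j).support,
      F j (Q ^ shiftExp K D t * z) = φ j (Q ^ shiftExp K D t * z) :=
    eventually_all.2 fun j => (Finset.eventually_all _).2 fun t _ =>
      (tendsto_const_mul_punctured (zpow_ne_zero _ hQ0)).eventually (h1 j)
  filter_upwards [h2] with z hz
  refine Finset.sum_congr rfl fun j _ => Finset.sum_congr rfl fun t ht => ?_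
  rw [hz j t ht]

lemma exists_radius_of_eventually {p : ℂ → Prop} (h : ∀ᶠ z in 𝓝[≠] (0 : ℂ), p z) :
    ∃ R : ℝ, 0 < R ∧ ∀ z, z ≠ 0 → ‖z‖ < R → p z := by
  rw [eventually_nhdsWithin_iff, Metric.eventually_nhds_iff] at h
  obtain ⟨R, hR, h⟩ := h
  exact ⟨R, hR, fun z hz hzR => h (by simpa using hzR) hz⟩

/-- A linear relation that holds near the origin is preserved by analytic continuation. -/
lemma relation_of_agree (hQ : 1 < ‖Q‖) (hs : (0 : ℂ) ∉ s) {S : ι → ℤ × ℕ →₀ ℂ} {A : ℂ[X]}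
    {F φ : ι → ℂ → ℂ} (hF : ∀ j, AnalyticOnNhd ℂ (F j) (regular Q s))
    (hFφ : ∀ j, ∃ r : ℝ, 0 < r ∧ ∀ z, ‖z‖ < r → F j z = φ j z)
    (h : ∀ᶠ z in 𝓝[≠] (0 : ℂ), z ∈ regular Q s →
      ∑ j, opVal Q K D (S j) (φ j) z = rhsVal Q D A z) :
    ∀ z ∈ regular Q s, ∑ j, opVal Q K D (S j) (F j) z = rhsVal Q D A z := by
  obtain ⟨R, hR, h1⟩ := exists_radius_of_eventually
    (h.and (eventually_opVal_congr (K := K) (D := D) (S := S) (ne_zero_of_one_lt_norm hQ) hFφ))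
  have h2 := eq_zero_of_eq_zero_near_zero hQ hs
    (F := fun z => ∑ j, opVal Q K D (S j) (F j) z - rhsVal Q D A z)
    (fun z hz => (Finset.analyticAt_fun_sum _ fun j _ => analyticOnNhd_opVal hQ (hF j) z hz).sub
      (analyticAt_rhsVal A z)) hR (fun z hz hzR => by
        obtain ⟨h3, h4⟩ := h1 z hz.1 hzR
        rw [h4, h3 hz, sub_self])
  exact fun z hz => sub_eq_zero.1 (h2 z hz)

/-! ### Stages of the summation process -/

/-- The functions `φ j`, obtained from the formal series `h j` at the level `D` of the summation
process, have local data and satisfy all the linear relations satisfied by the `h j`. -/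
structure StageData (Q Q₁ : ℂ) (K D : ℕ) (lam : ℂ) (W : ℝ) (h : ι → PowerSeries ℂ)
    (φ : ι → ℂ → ℂ) : Prop where
  localData : ∀ j, LocalData Q₁ lam W (φ j) (fun k => PowerSeries.coeff k (h j) * borelFactor Q D k)
  relation : ∀ (P : ι → ℤ →₀ ℂ[X]) (A : ℂ[X]),
    ∑ j, applyOp (Q ^ K) (P j) (h j) = (A : PowerSeries ℂ) →
      ∀ᶠ z in 𝓝[≠] (0 : ℂ), offSpiral Q₁ lam z →
        ∑ j, opVal Q K D (monomials (P j)) (φ j) z = rhsVal Q D A z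

lemma opVal_monomials_zero (f : ℂ → ℂ) (z : ℂ) : opVal Q K D (monomials 0) f z = 0 := by
  have : (monomials 0).support = ∅ := by
    ext t
    exact iff_of_false (fun h => mem_support_monomials.1 h (by simp)) (Finset.notMem_empty _)
  rw [opVal, this, Finset.sum_empty]

variable {Q₁ lam : ℂ} {W : ℝ} {h : ι → PowerSeries ℂ} {φ : ι → ℂ → ℂ}

lemma StageData.relation_single (hS : StageData Q Q₁ K D lam W h φ) (j : ι) {P : ℤ →₀ ℂ[X]}
    {A : ℂ[X]} (hP : applyOp (Q ^ K) P (h j) = (A : PowerSeries ℂ)) :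
    ∀ᶠ z in 𝓝[≠] (0 : ℂ), offSpiral Q₁ lam z →
      opVal Q K D (monomials P) (φ j) z = rhsVal Q D A z := by
  classical
  have h1 := hS.relation (Pi.single j P) A (by
    rw [Finset.sum_eq_single j (fun k _ hk => ?_) (by simp), Pi.single_eq_same, hP]
    rw [Pi.single_eq_of_ne hk, applyOp, Finsupp.sum_zero_index])
  filter_upwards [h1] with z hz hoff
  rw [← hz hoff, Finset.sum_eq_single j (fun k _ hk => ?_) (by simp), Pi.single_eq_same]
  rw [Pi.single_eq_of_ne hk, opVal_monomials_zero]

/-- Maximality at level D', rewritten with shifts at level D = N + D', is exactly the condition that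
bounds the growth. -/
lemma IsTop.slope_le {D' : ℕ} {S : ℤ × ℕ →₀ ℂ} {I : ℤ} {J : ℕ} (h : IsTop K D' S I J)
    (hD : D = N + D') : ∀ t ∈ S.support,
      ((t.2 : ℤ) - J) * N ≤ shiftExp K D (I, J) - shiftExp K D t := by
  intro t ht
  have := h.le t ht
  simp only [shiftExp, hD] at *
  push_cast
  linarith

/-- The functions of a stage have analytic continuations, which satisfy the same relations. -/
theorem StageData.exists_globalData (hS : StageData Q Q K D lam W h φ) (hQ : 1 < ‖Q‖)
    (hs : (0 : ℂ) ∉ s) (hK : K ≠ 0) (hN : N ≠ 0) {D' : ℕ} (hD : D = N + D')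
    {P : ι → ℤ →₀ ℂ[X]} {A : ι → ℂ[X]}
    (hP : ∀ j, applyOp (Q ^ K) (P j) (h j) = (A j : PowerSeries ℂ)) {I : ι → ℤ} {J : ι → ℕ}
    (htop : ∀ j, IsTop K D (monomials (P j)) (I j) (J j))
    (htop' : ∀ j, IsTop K D' (monomials (P j)) (I j) (J j))
    (hroots : ∀ j, ∀ ρ : ℂ, ρ ≠ 0 →
      (topPoly Q K D (monomials (P j)) (shiftExp K D (I j, J j))).eval ρ = 0 → ρ ∈ s)
    (hls : -lam ∈ s) {U : Set ℂ} (hU : IsFundamental Q s lam U) :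
    ∃ F : ι → ℂ → ℂ,
      (∀ j, GlobalData Q s lam U N W (φ j) (F j)
        (fun k => PowerSeries.coeff k (h j) * borelFactor Q D k)) ∧
      ∀ (P : ι → ℤ →₀ ℂ[X]) (A : ℂ[X]),
        ∑ j, applyOp (Q ^ K) (P j) (h j) = (A : PowerSeries ℂ) →
          ∀ z ∈ regular Q s, ∑ j, opVal Q K D (monomials (P j)) (F j) z = rhsVal Q D A z := by
  have h1 : ∀ j, ∃ F : ℂ → ℂ, GlobalData Q s lam U N W (φ j) F
      (fun k => PowerSeries.coeff k (h j) * borelFactor Q D k) := by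
    intro j
    obtain ⟨R, hR, h2⟩ := exists_radius_of_eventually (hS.relation_single j (hP j))
    exact (hS.localData j).exists_globalData hQ hs hK hN (htop j) ((htop' j).slope_le hD)
      (hroots j) hls hU hR fun z hz hzR => h2 z hz.1 hzR (offSpiral_of_mem_regular hls hz)
  choose F hF using h1
  refine ⟨F, hF, fun P A hPA => relation_of_agree hQ hs (fun j => (hF j).analytic)
    (fun j => (hF j).agree) ?_⟩
  filter_upwards [hS.relation P A hPA] with z hz hzr
  exact hz (offSpiral_of_mem_regular hls hzr)

lemma borelFactor_add (hQ0 : Q ≠ 0) (D D' d : ℕ) :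
    borelFactor Q (D + D') d * (Q ^ D) ^ (d.choose 2) = borelFactor Q D' d := by
  rw [borelFactor, borelFactor, pow_add Q, mul_pow]
  have : (Q ^ D) ^ (d.choose 2) ≠ 0 := pow_ne_zero _ (pow_ne_zero _ hQ0)
  field_simp

/-- The Laplace transforms of the functions of a stage form the next stage. -/
theorem stageData_lap {g D' : ℕ} (hQ : 1 < ‖Q‖) (hg : g ≠ 0) (hN : N ≠ 0) (hgK : g ∣ K)
    (hgD : g ∣ D') (hD : D = g * N + D') (hlam : lam ∈ regular Q s) {U : Set ℂ} {F : ι → ℂ → ℂ}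
    (hF : ∀ j, GlobalData Q s lam U (g * N) W (φ j) (F j)
      (fun k => PowerSeries.coeff k (h j) * borelFactor Q D k))
    (hrel : ∀ (P : ι → ℤ →₀ ℂ[X]) (A : ℂ[X]),
      ∑ j, applyOp (Q ^ K) (P j) (h j) = (A : PowerSeries ℂ) →
        ∀ z ∈ regular Q s, ∑ j, opVal Q K D (monomials (P j)) (F j) z = rhsVal Q D A z) :
    StageData Q (Q ^ g) K D' lam (W * ‖Q‖ ^ (g * N)) h
      (fun j => lap ((Q ^ g) ^ N) (Q ^ g) lam N (fun ℓ => F j ((Q ^ g) ^ ℓ * lam))) := by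
  have hQ0 := ne_zero_of_one_lt_norm hQ
  subst hD
  refine ⟨fun j => ?_, fun P A hPA => lap_relation hQ hg hN hlam.1 hgK hgD
    (fun j => (hF j).summable_lapTerm hQ hg hN hlam.1) fun ℓ => hrel P A hPA _ ?_⟩
  · have h1 := (hF j).laplace hQ hg hN hlam.1
    simp only [mul_assoc, ← pow_mul Q g N, borelFactor_add hQ0, norm_pow] at h1
    simpa only [pow_mul Q g N] using h1
  · rw [← zpow_natCast Q g, ← zpow_mul]
    exact (zpow_mul_mem_regular hQ _ _).2 hlam

end QDiff

end

/-! ### Meromorphic extension, recovery of the system, final asymptotics -/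

noncomputable section

namespace QDiff

variable {Q : ℂ} {K : ℕ} {s : Finset ℂ} {ι : Type*} [Fintype ι]

/-! ### Extension of the sums to `ℂ*` -/

lemma offSpiral.pow {lam z : ℂ} (h : offSpiral Q lam z) (g : ℕ) : offSpiral (Q ^ g) lam z := by
  intro ℓ hz
  rw [← zpow_natCast Q g, ← zpow_mul] at hz
  exact h _ hz

/-- At the end of the summation process, the functions extend meromorphically to `ℂ*`. -/
theorem StageData.exists_meromorphic {g : ℕ} {lam : ℂ} {W : ℝ} {h : ι → PowerSeries ℂ}
    {φ : ι → ℂ → ℂ} (hS : StageData Q (Q ^ g) K 0 lam W h φ) (hQ : 1 < ‖Q‖) (hs : (0 : ℂ) ∉ s)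
    {P : ι → ℤ →₀ ℂ[X]} {A : ι → ℂ[X]}
    (hP : ∀ j, applyOp (Q ^ K) (P j) (h j) = (A j : PowerSeries ℂ)) {I : ι → ℤ} {J : ι → ℕ}
    (htop : ∀ j, IsTop K 0 (monomials (P j)) (I j) (J j))
    (hroots : ∀ j, ∀ ρ : ℂ, ρ ≠ 0 →
      (topPoly Q K 0 (monomials (P j)) (shiftExp K 0 (I j, J j))).eval ρ = 0 → ρ ∈ s)
    (hls : -lam ∈ s) :
    ∃ F : ι → ℂ → ℂ, (∀ j, ∃ r : ℝ, 0 < r ∧ ∀ z, ‖z‖ < r → F j z = φ j z) ∧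
      (∀ j, ∀ z, z ≠ 0 → MeromorphicAt (F j) z) ∧
      ∀ (P : ι → ℤ →₀ ℂ[X]) (A : ℂ[X]),
        ∑ j, applyOp (Q ^ K) (P j) (h j) = (A : PowerSeries ℂ) →
          ∀ z ∈ regular Q s, ∑ j, opVal Q K 0 (monomials (P j)) (F j) z = rhsVal Q 0 A z := by
  have h1 : ∀ j, ∃ F : ℂ → ℂ, (∃ r : ℝ, 0 < r ∧ ∀ z, ‖z‖ < r → F z = φ j z) ∧
      AnalyticOnNhd ℂ F (regular Q s) ∧ ∀ z, z ≠ 0 → MeromorphicAt F z := by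
    intro j
    obtain ⟨R, hR, h2⟩ := exists_radius_of_eventually (hS.relation_single j (hP j))
    obtain ⟨R', hR', hm, ha, -⟩ := (hS.localData j).local_bounds
    obtain ⟨F, r, hr, hF1, hF2, hF3, -⟩ := exists_extension hQ hs (htop j) (hroots j) hR'
      (fun z hz hzR => ha z hz.1 hzR ((offSpiral_of_mem_regular hls hz).pow g)) hm hR
      fun z hz hzR => h2 z hz.1 hzR ((offSpiral_of_mem_regular hls hz).pow g)
    exact ⟨F, ⟨r, hr, hF1⟩, hF2, hF3⟩
  choose F hF1 hF2 hF3 using h1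
  refine ⟨F, hF1, hF3, fun P A hPA => relation_of_agree hQ hs hF2 hF1 ?_⟩
  filter_upwards [hS.relation P A hPA] with z hz hzr
  exact hz ((offSpiral_of_mem_regular hls hzr).pow g)

/-! ### Linear systems -/

lemma exists_common_denom (a : ι → RatFunc ℂ) : ∃ d : ℂ[X], d ≠ 0 ∧ ∃ b : ι → ℂ[X], ∀ j,
    algebraMap ℂ[X] (RatFunc ℂ) d * a j = algebraMap ℂ[X] (RatFunc ℂ) (b j) ∧
      ∀ z, d.eval z ≠ 0 → (a j).eval (RingHom.id ℂ) z = (b j).eval z / d.eval z := by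
  refine ⟨∏ j, (a j).denom, Finset.prod_ne_zero_iff.2 fun j _ => (a j).denom_ne_zero, ?_⟩
  choose e he using fun j : ι => Finset.dvd_prod_of_mem (fun j => (a j).denom) (Finset.mem_univ j)
  refine ⟨fun j => (a j).num * e j, fun j => ⟨?_, fun z hz => ?_⟩⟩
  · have h0 : algebraMap ℂ[X] (RatFunc ℂ) (a j).denom ≠ 0 :=
      (map_ne_zero_iff _ (RatFunc.algebraMap_injective ℂ)).2 (a j).denom_ne_zero
    have h1 := (eq_div_iff h0).1 (RatFunc.num_div_denom (a j)).symm
    rw [he j, map_mul, map_mul, ← h1]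
    ring
  · rw [he j, eval_mul] at hz ⊢
    rw [RatFunc.eval, eval₂_id, eval₂_id, eval_mul, mul_div_mul_right _ _ (right_ne_zero_of_mul hz)]

lemma applyOp_add (q : ℂ) (P P' : ℤ →₀ ℂ[X]) (h : PowerSeries ℂ) :
    applyOp q (P + P') h = applyOp q P h + applyOp q P' h :=
  Finsupp.sum_add_index' (fun _ => by simp) fun _ _ _ => by rw [Polynomial.coe_add, add_mul]

lemma applyOp_single (q : ℂ) (a : ℤ) (b : ℂ[X]) (h : PowerSeries ℂ) :
    applyOp q (Finsupp.single a b) h = (b : PowerSeries ℂ) * PowerSeries.rescale (q ^ a) h :=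
  Finsupp.sum_single_index (by simp)

/-- At level 0 the Borel factors are 1 and the shifts are powers of q, so the original q-difference
operator is recovered. -/
lemma opVal_level_zero (P : ℤ →₀ ℂ[X]) (f : ℂ → ℂ) (z : ℂ) :
    opVal Q K 0 (monomials P) f z = P.sum fun a b => b.eval z * f ((Q ^ K) ^ a * z) := by
  have h1 : opVal Q K 0 (monomials P) f z =
      ∑ t ∈ P.support ×ˢ Finset.range (P.support.sup (fun a => (P a).natDegree) + 1),
        (P t.1).coeff t.2 * borelFactor Q 0 t.2 * z ^ t.2 * f (Q ^ shiftExp K 0 t * z) :=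
    Finsupp.onFinset_sum (g := fun (t : ℤ × ℕ) (x : ℂ) =>
      x * borelFactor Q 0 t.2 * z ^ t.2 * f (Q ^ shiftExp K 0 t * z)) _ fun _ => by simp
  rw [h1, Finset.sum_product, Finsupp.sum]
  refine Finset.sum_congr rfl fun a ha => ?_
  rw [eval_eq_sum_range' (Nat.lt_succ_of_le
    (Finset.le_sup (f := fun a => (P a).natDegree) ha)), Finset.sum_mul]
  refine Finset.sum_congr rfl fun d _ => ?_
  rw [shiftExp, borelFactor, ← zpow_natCast Q K, ← zpow_mul]
  simp

lemma eventually_eval_ne_zero {d : ℂ[X]} (hd : d ≠ 0) (z₀ : ℂ) :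
    ∀ᶠ z in 𝓝[≠] z₀, d.eval z ≠ 0 := by
  have hfin : ((d.roots.toFinset : Set ℂ) \ {z₀}).Finite :=
    d.roots.toFinset.finite_toSet.subset Set.sdiff_subset
  filter_upwards [mem_nhdsWithin_of_mem_nhds (hfin.isClosed.isOpen_compl.mem_nhds (x := z₀)
    (by simp)), self_mem_nhdsWithin] with z hz hz0 h
  exact hz ⟨by simpa [hd] using h, hz0⟩

open scoped RatFunc in
/-- Functions that satisfy all the linear relations between the series `Y j` satisfy the same
linear systems. -/
theorem eventuallyEq_of_relations [DecidableEq ι] (hQ : 1 < ‖Q‖) (hs : (0 : ℂ) ∉ s)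
    {Y : ι → PowerSeries ℂ} {F : ι → ℂ → ℂ}
    (hF : ∀ (P : ι → ℤ →₀ ℂ[X]) (A : ℂ[X]),
      ∑ j, applyOp (Q ^ K) (P j) (Y j) = (A : PowerSeries ℂ) →
        ∀ z ∈ regular Q s, ∑ j, opVal Q K 0 (monomials (P j)) (F j) z = rhsVal Q 0 A z)
    {a : ι → RatFunc ℂ} {i : ι}
    (hY : ((PowerSeries.rescale (Q ^ K) (Y i) : PowerSeries ℂ) : LaurentSeries ℂ) =
      ∑ j, ((a j : RatFunc ℂ) : LaurentSeries ℂ) * ((Y j : PowerSeries ℂ) : LaurentSeries ℂ))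
    {z₀ : ℂ} (hz₀ : z₀ ≠ 0) :
    (fun z => F i (Q ^ K * z)) =ᶠ[𝓝[≠] z₀]
      fun z => ∑ j, (a j).eval (RingHom.id ℂ) z * F j z := by
  obtain ⟨d, hd, b, hb⟩ := exists_common_denom a
  -- Clearing denominators in the row turns it into a relation with polynomial coefficients, of the
  -- kind carried through the stages.
  have hPS : (d : PowerSeries ℂ) * PowerSeries.rescale (Q ^ K) (Y i) =
      ∑ j, (b j : PowerSeries ℂ) * Y j := by
    apply HahnSeries.ofPowerSeries_injective (Γ := ℤ)
    rw [map_mul, map_sum]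
    simp only [map_mul]
    have h1 := congrArg (fun x => ((d : PowerSeries ℂ) : LaurentSeries ℂ) * x) hY
    simp only [Finset.mul_sum, ← mul_assoc] at h1
    refine h1.trans (Finset.sum_congr rfl fun j _ => ?_)
    congr 1
    have h2 := congrArg (algebraMap (RatFunc ℂ) (LaurentSeries ℂ)) (hb j).1
    rw [map_mul] at h2
    have e1 : ((d : PowerSeries ℂ) : LaurentSeries ℂ) = _ := RatFunc.coe_coe d
    have e2 : ((b j : PowerSeries ℂ) : LaurentSeries ℂ) = _ := RatFunc.coe_coe (b j)
    rw [e1]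
    exact h2.trans e2.symm
  have hrel := hF (fun j => (if j = i then Finsupp.single 1 d else 0) + Finsupp.single 0 (-(b j))) 0
    (by
      simp only [applyOp_add, applyOp_single, Finset.sum_add_distrib, zpow_zero]
      rw [Finset.sum_eq_single i (fun j _ hj => by rw [if_neg hj, applyOp, Finsupp.sum_zero_index])
        (by simp), if_pos rfl, applyOp_single, zpow_one, hPS, ← Finset.sum_add_distrib]
      simp)
  filter_upwards [eventually_mem_regular hQ hs hz₀, eventually_eval_ne_zero hd z₀] with z hz hdz
  have h1 := hrel z hz
  simp only [opVal_level_zero, rhsVal, support_zero, Finset.sum_empty] at h1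
  have h2 : ∀ j, ((if j = i then Finsupp.single 1 d else 0) + Finsupp.single 0 (-(b j)) :
      ℤ →₀ ℂ[X]).sum (fun a b => b.eval z * F j ((Q ^ K) ^ a * z)) =
      (if j = i then d.eval z * F i (Q ^ K * z) else 0) - (b j).eval z * F j z := by
    intro j
    rw [Finsupp.sum_add_index' (fun _ => by simp) fun _ _ _ => by rw [eval_add, add_mul],
      Finsupp.sum_single_index (by simp)]
    split_ifs with h
    · subst h
      rw [Finsupp.sum_single_index (by simp)]
      simp [sub_eq_add_neg]
    · simp
  simp only [h2, Finset.sum_sub_distrib, Finset.sum_ite_eq', Finset.mem_univ, if_true] at h1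
  simp only [fun j => (hb j).2 z hdz, div_mul_eq_mul_div, ← Finset.sum_div]
  rw [eq_div_iff hdz, mul_comm]
  exact sub_eq_zero.1 h1

/-! ### `q`-Gevrey asymptotics of the sums -/

theorem qGevreyAsymptotic_of_localData {τ : ℂ} {n D : ℕ} {μ : ℚ} {lam : ℂˣ} {h : PowerSeries ℂ}
    {f F : ℂ → ℂ} (hK : K ≠ 0) (hQK : Q = qPow τ (1 / (K : ℂ))) (hμ : (K : ℚ) / μ = D)
    (hf : LocalData (qPow τ (1 / (n : ℂ))) lam (‖Q‖ ^ D) f (fun k => PowerSeries.coeff k h))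
    (hF : ∃ r : ℝ, 0 < r ∧ ∀ z, ‖z‖ < r → F z = f z) : QGevreyAsymptotic τ μ n lam F h := by
  obtain ⟨R, hR, -, -, h1⟩ := hf.local_bounds
  obtain ⟨r, hr, hF⟩ := hF
  refine ⟨1, min R r, one_pos, lt_min hR hr, fun ε R' hε _ _ hR'r => ?_⟩
  obtain ⟨L, M, hL, hM, h2⟩ := h1 ε hε
  refine ⟨L + 1, M, by linarith, by linarith, fun k z hz hzR hd => ?_⟩
  have hzR := hzR.trans hR'r
  simp only [qPow_div] at hd
  rw [hF z (hzR.trans_le (min_le_right _ _))]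
  -- Since D = K/μ, the weight |Q|^D equals |q|^(1/μ).
  have hexp : ‖Complex.exp τ‖ ^ ((k : ℝ) * ((k : ℝ) - 1) / (2 * (μ : ℝ))) =
      (‖Q‖ ^ D) ^ (k.choose 2) := by
    rw [hQK, ← norm_exp_rpow τ hK hμ, ← Real.rpow_natCast, ← Real.rpow_mul (norm_nonneg _),
      Nat.cast_choose_two]
    congr 1
    rw [div_mul_div_comm, one_mul, mul_comm 2]
  rw [hexp]
  refine (h2 k z hz (hzR.trans_le (min_le_left _ _)) hd).trans_lt ?_
  have hz' := norm_pos_iff.2 hz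
  have hW := hf.one_le_weight
  gcongr
  linarith

end QDiff

end

/-! ### Arithmetic of the levels, vertices, and exceptional classes -/

noncomputable section

namespace QDiff

variable {τ Q : ℂ} {K r : ℕ} {μ κ : ℕ → ℚ} {N : ℕ → ℕ}

/-! ### Arithmetic of the levels -/

/-- The sum of the `N j` for `i ≤ j < r`. -/
def tailSum (N : ℕ → ℕ) (r i : ℕ) : ℕ := ∑ j ∈ Finset.Ico i r, N j

lemma tailSum_self (N : ℕ → ℕ) (r : ℕ) : tailSum N r r = 0 := by simp [tailSum]

lemma tailSum_zero (N : ℕ → ℕ) (r : ℕ) : tailSum N r 0 = ∑ j ∈ Finset.range r, N j := by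
  rw [tailSum, Finset.range_eq_Ico]

lemma tailSum_of_lt (N : ℕ → ℕ) {r i : ℕ} (hi : i < r) :
    tailSum N r i = N i + tailSum N r (i + 1) :=
  Finset.sum_eq_sum_Ico_succ_bot hi N

/-- The inverses of the κ_j telescope to 1/μ_i, the last one being 1/μ_{r-1} itself. -/
lemma div_slope_eq_tailSum (hN : ∀ i < r, (K : ℚ) / kappa r μ i = N i) {i : ℕ} (hi : i < r) :
    (K : ℚ) / μ i = tailSum N r i := by
  obtain ⟨k, hk⟩ := Nat.exists_eq_add_of_lt hi
  induction k generalizing i with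
  | zero =>
    rw [tailSum_of_lt N hi]
    have h1 := hN i hi
    rw [kappa, if_neg (by omega)] at h1
    rw [h1, show i + 1 = r by omega, tailSum_self, add_zero]
  | succ k ih =>
    have h1 := hN i hi
    have h2 := ih (i := i + 1) (by omega) (by omega)
    rw [kappa, if_pos (by omega), div_inv_eq_mul, mul_sub, ← div_eq_mul_inv, ← div_eq_mul_inv,
      h2] at h1
    rw [tailSum_of_lt N hi]
    push_cast
    linarith

lemma qPow_borel (hK : K ≠ 0) (hQ : Q = qPow τ (1 / (K : ℂ))) {κ : ℚ} {N : ℕ}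
    (h : (K : ℚ) / κ = N) (k : ℕ) :
    qPow τ (-((k : ℂ) * ((k : ℂ) - 1) / (2 * (κ : ℂ)))) = borelFactor Q N k := by
  rw [borelFactor, hQ, ← qPow_inv τ hK h, qPow, qPow, ← Complex.exp_nat_mul, ← Complex.exp_neg,
    Nat.cast_choose_two]
  congr 1
  ring

lemma coeff_qBorelIter (hK : K ≠ 0) (hQ : Q = qPow τ (1 / (K : ℂ)))
    (i : ℕ) (hN : ∀ j < i, (K : ℚ) / κ j = N j) (h : PowerSeries ℂ) (k : ℕ) :
    PowerSeries.coeff k (qBorelIter τ κ i h) =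
      PowerSeries.coeff k h * borelFactor Q (∑ j ∈ Finset.range i, N j) k := by
  induction i generalizing h with
  | zero => simp [qBorelIter, borelFactor]
  | succ i ih =>
    rw [qBorelIter, ih (fun j hj => hN j (by omega)), qBorel, PowerSeries.coeff_mk,
      qPow_borel hK hQ (hN i (by omega)), Finset.sum_range_succ, borelFactor, borelFactor,
      borelFactor, pow_add, mul_pow, mul_inv]
    ring

/-- The vertices of the Newton polygon give dominant monomials at all levels. -/
lemma exists_vertices {D : ℕ → ℕ} (hr : 0 < r) (hμ : ∀ i < r, 0 < μ i)
    (hmono : StrictMonoOn μ (Set.Iio r)) (hD : ∀ i < r, (K : ℚ) / μ i = D i)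
    (hDanti : ∀ i < r, D (i + 1) ≤ D i) {P : ℤ →₀ ℂ[X]} (hP : P ≠ 0)
    (hslopes : ∀ s : ℚ, 0 < s → IsSlope P s → s ∈ (Finset.range r).image μ) :
    (∃ (I : ℤ) (J : ℕ), IsTop K (D 0) (monomials P) I J ∧ ∀ t ∈ (monomials P).support, J ≤ t.2) ∧
      ∀ i < r, ∃ v : ℤ × ℕ, IsTop K (D i) (monomials P) v.1 v.2 ∧
        IsTop K (D (i + 1)) (monomials P) v.1 v.2 := by
  have hDμ : ∀ i < r, (D i : ℚ) * μ i = K := fun i hi => by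
    rw [← hD i hi, div_mul_cancel₀ _ (hμ i hi).ne']
  have hno : ∀ i k, i ≤ k → i < r → k < r → ¬ (D i : ℚ) * μ k < K := by
    intro i k hik hi hk
    rw [not_lt, ← hDμ i hi]
    gcongr
    exact hmono.monotoneOn hi hk hik
  constructor
  -- Direction s = 0 selects the right end of the lowest face. No slope lies strictly between 0 and
  -- μ 0, so it is dominant at level D 0.
  · obtain ⟨I, J, h1, h2⟩ := exists_isTop hP (K := K) (D := D 0) (s := 0) (by simp)
      fun t ht hlt hsl => by
        obtain ⟨k, hk, rfl⟩ := Finset.mem_image.1 (hslopes t ht hsl)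
        exact hno 0 k (Nat.zero_le _) hr (Finset.mem_range.1 hk) hlt
    refine ⟨I, J, h1, fun t ht => ?_⟩
    have := h2 t ht
    rw [zero_mul, zero_mul, sub_zero, sub_zero] at this
    exact_mod_cast this
  · intro i hi
    -- The right end of the face in direction μ i, a single vertex when μ i is not a slope of this
    -- P. No slope lies strictly between μ i and the next value. At the last step D is 0 and no
    -- larger slope exists at all.
    obtain ⟨I, J, h1, h2⟩ := exists_isTop hP (K := K) (D := D (i + 1)) (s := μ i) (by
        rw [← hDμ i hi]
        have := (hμ i hi).le
        gcongr
        exact hDanti i hi) fun t ht hlt hsl => by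
        obtain ⟨k, hk, rfl⟩ := Finset.mem_image.1 (hslopes t ((hμ i hi).trans ht) hsl)
        have hk := Finset.mem_range.1 hk
        have hik : i < k := (hmono.lt_iff_lt hi hk).1 ht
        exact hno (i + 1) k hik (by omega) hk hlt
    refine ⟨(I, J), ⟨h1.mem, fun t ht => ?_⟩, h1⟩
    have h3 := mul_le_mul_of_nonneg_left (h2 t ht) (Nat.cast_nonneg (α := ℚ) (D i))
    have h4 := hDμ i hi
    suffices (K : ℚ) * t.1 - D i * t.2 ≤ K * I - D i * J by
      rw [shiftExp, shiftExp]; exact_mod_cast this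
    rw [← h4]
    linarith

/-- The remainder of K modulo n would be a smaller admissible positive integer. -/
lemma dvd_of_isLeast {n N' : ℕ} {κ : ℚ} {N : ℕ}
    (hn : IsLeast {n : ℕ | 0 < n ∧ ∃ N : ℕ, 0 < N ∧ (n : ℚ) / κ = N} n) (hκ : 0 < κ)
    (hK : (K : ℚ) / κ = N) (hn' : (n : ℚ) / κ = N') : n ∣ K := by
  by_contra hdvd
  have hpos : 0 < K % n := Nat.pos_of_ne_zero fun h => hdvd (Nat.dvd_of_mod_eq_zero h)
  have hlt : K % n < n := Nat.mod_lt _ hn.1.1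
  have h1 : ((K % n : ℕ) : ℚ) / κ = ((N : ℤ) - (K / n : ℕ) * N' : ℤ) := by
    have h2 : (K : ℚ) = n * (K / n : ℕ) + (K % n : ℕ) := by exact_mod_cast (Nat.div_add_mod K n).symm
    generalize K / n = a at h2 ⊢
    push_cast
    rw [← hK, ← hn', h2]
    ring
  have h3 : (0 : ℚ) < ((K % n : ℕ) : ℚ) / κ := div_pos (by exact_mod_cast hpos) hκ
  rw [h1] at h3
  obtain ⟨M, hM⟩ := Int.eq_ofNat_of_zero_le (a := (N : ℤ) - (K / n : ℕ) * N')
    (by exact_mod_cast h3.le)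
  rw [hM] at h1 h3
  have := hn.2 ⟨hpos, M, by exact_mod_cast h3, by exact_mod_cast h1⟩
  omega

/-! ### Exceptional classes -/

lemma finite_classes (τ Q : ℂ) (n g : ℕ) (s : Finset ℂ) :
    {x : SpiralSpace τ n | ∃ u : ℂˣ, (∃ ρ ∈ s, ∃ e < g, (u : ℂ) = Q ^ e * ρ) ∧
      x = QuotientGroup.mk u}.Finite := by
  have h1 : {u : ℂˣ | ∃ ρ ∈ s, ∃ e < g, (u : ℂ) = Q ^ e * ρ}.Finite := by
    have : ((fun p : ℂ × ℕ => Q ^ p.2 * p.1) '' (s ×ˢ Finset.range g : Finset (ℂ × ℕ))).Finite :=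
      (Finset.finite_toSet _).image _
    refine (this.preimage (Units.val_injective.injOn)).subset ?_
    rintro u ⟨ρ, hρ, e, he, hu⟩
    exact ⟨(ρ, e), by simp [hρ, he], hu.symm⟩
  refine (h1.image QuotientGroup.mk).subset ?_
  rintro x ⟨u, hu, rfl⟩
  exact ⟨u, hu, rfl⟩

/-- Each Q-spiral splits into g spirals of ratio Q^g = q^(1/n), represented by Q^e ρ with e < g.
Excluding these finitely many classes therefore excludes the full Q-spirals. -/
lemma notMem_spirals_of_mk_notMem {n g : ℕ} {s : Finset ℂ} {lam : ℂˣ} (hg : 0 < g)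
    (hQ0 : Q ≠ 0) (hQn : Q ^ g = qPow τ (1 / (n : ℂ)))
    (h : (QuotientGroup.mk lam : SpiralSpace τ n) ∉
      {x : SpiralSpace τ n | ∃ u : ℂˣ, (∃ ρ ∈ s, ∃ e < g, (u : ℂ) = Q ^ e * ρ) ∧
        x = QuotientGroup.mk u}) : (lam : ℂ) ∉ spirals Q s := by
  rintro ⟨ρ, hρ, ℓ, hl⟩
  have hg' : (0 : ℤ) < g := by exact_mod_cast hg
  obtain ⟨e, he⟩ := Int.eq_ofNat_of_zero_le (Int.emod_nonneg ℓ hg'.ne')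
  have hlt : e < g := by
    have := Int.emod_lt_of_pos ℓ hg'
    omega
  have hℓ : ℓ = g * (ℓ / g) + e := by rw [← he]; exact (Int.mul_ediv_add_emod ℓ g).symm
  refine h ⟨lam * (qPowUnit τ (1 / (n : ℂ)) ^ (ℓ / g))⁻¹, ⟨ρ, hρ, e, hlt, ?_⟩, ?_⟩
  · have h1 : (qPowUnit τ (1 / (n : ℂ)) : ℂ) = Q ^ g := hQn.symm
    rw [Units.val_mul, Units.val_inv_eq_inv_val, Units.val_zpow_eq_zpow_val, h1, hl, hℓ,
      zpow_add₀ hQ0, zpow_mul, zpow_natCast, zpow_natCast, ← hℓ]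
    have : (Q ^ g) ^ (ℓ / (g : ℤ)) ≠ 0 := zpow_ne_zero _ (pow_ne_zero _ hQ0)
    field_simp
  · rw [QuotientGroup.eq, ← mul_assoc, inv_mul_cancel, one_mul]
    exact Subgroup.inv_mem _ (Subgroup.zpow_mem _ (Subgroup.mem_zpowers _) _)

/-- Adjoining -lam is harmless: Q^ℓ = -1 is impossible for |Q| > 1. -/
lemma mem_regular_insert (hQ : 1 < ‖Q‖) {s : Finset ℂ} {lam : ℂ} (hl : lam ≠ 0)
    (h : lam ∉ spirals Q s) : lam ∈ regular Q (insert (-lam) s) := by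
  refine ⟨hl, ?_⟩
  rintro ⟨ρ, hρ, ℓ, hlρ⟩
  rcases Finset.mem_insert.1 hρ with rfl | hρ
  · have h1 : Q ^ ℓ = -1 := by
      have : (Q ^ ℓ + 1) * lam = 0 := by linear_combination hlρ
      rcases mul_eq_zero.1 this with h | h
      · exact eq_neg_of_add_eq_zero_left h
      · exact absurd h hl
    have h2 : ‖Q‖ ^ ℓ = 1 := by rw [← norm_zpow, h1, norm_neg, norm_one]
    have h3 : ℓ = 0 := (zpow_eq_one_iff_right₀ (by linarith) hQ.ne').1 h2
    rw [h3, zpow_zero] at h1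
    norm_num at h1
  · exact h ⟨ρ, hρ, ℓ, hlρ⟩

end QDiff

end

/-! ### Induction over the successive Laplace transformations -/

noncomputable section

namespace QDiff

variable {τ Q : ℂ} {K r : ℕ} {κ : ℕ → ℚ} {N : ℕ → ℕ} {s : Finset ℂ} {ι : Type*} [Fintype ι]
  {lam : ℂˣ} {Y : ι → PowerSeries ℂ} {P : ι → ℤ →₀ ℂ[X]} {A : ι → ℂ[X]} {v : ι → ℕ → ℤ × ℕ}

/-! ### The sequence of stages -/

theorem exists_geometric_bound_borel (hQ : 1 < ‖Q‖) (hK : K ≠ 0) {D : ℕ} {P : ℤ →₀ ℂ[X]}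
    {A : ℂ[X]} {h : PowerSeries ℂ} (hP : applyOp (Q ^ K) P h = (A : PowerSeries ℂ)) {I : ℤ} {J : ℕ}
    (htop : IsTop K D (monomials P) I J) (hJ : ∀ t ∈ (monomials P).support, J ≤ t.2) :
    ∃ L M : ℝ, 1 ≤ M ∧ ∀ k, ‖PowerSeries.coeff k h * borelFactor Q D k‖ ≤ L * M ^ k := by
  refine exists_geometric_bound hQ hK htop hJ ?_
  filter_upwards [eventually_gt_atTop A.natDegree] with k hk
  rw [opCoeff_monomials (ne_zero_of_one_lt_norm hQ), hP, Polynomial.coeff_coe,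
    coeff_eq_zero_of_natDegree_lt hk, zero_mul]

theorem stageData_zero (hQ : 1 < ‖Q‖) {D : ℕ} {H : ι → PowerSeries ℂ}
    (hH : ∀ j k, PowerSeries.coeff k (H j) = PowerSeries.coeff k (Y j) * borelFactor Q D k)
    (hb : ∀ j, ∃ L M : ℝ, 1 ≤ M ∧ ∀ k, ‖PowerSeries.coeff k (H j)‖ ≤ L * M ^ k) (lam : ℂ) :
    StageData Q Q K D lam 1 Y (fun j => seriesSum (H j)) := by
  refine ⟨fun j => ?_, fun P A hPA => ?_⟩
  · obtain ⟨L, M, hM, h⟩ := hb j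
    simpa only [hH] using localData_seriesSum (Q := Q) lam hM h
  · filter_upwards [seriesSum_relation (ne_zero_of_one_lt_norm hQ) hPA hH hb] with z hz _
    exact hz

/-- The successive functions satisfy the hypotheses of the Laplace transformations. -/
theorem stageData_stage (hQ : 1 < ‖Q‖) (hK : K ≠ 0) (hQK : Q = qPow τ (1 / (K : ℂ)))
    (hN : ∀ i < r, N i ≠ 0 ∧ (K : ℚ) / κ i = N i) (hs : (0 : ℂ) ∉ s)
    (hlam : (lam : ℂ) ∈ regular Q s) (hls : -(lam : ℂ) ∈ s)
    (hP : ∀ j, applyOp (Q ^ K) (P j) (Y j) = (A j : PowerSeries ℂ))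
    (htop : ∀ j, ∀ i < r, IsTop K (tailSum N r i) (monomials (P j)) (v j i).1 (v j i).2 ∧
      IsTop K (tailSum N r (i + 1)) (monomials (P j)) (v j i).1 (v j i).2)
    (hroots : ∀ j, ∀ i < r, ∀ ρ : ℂ, ρ ≠ 0 → (topPoly Q K (tailSum N r i) (monomials (P j))
      (shiftExp K (tailSum N r i) (v j i))).eval ρ = 0 → ρ ∈ s)
    {U : Set ℂ} (hU : IsFundamental Q s lam U)
    (h0 : StageData Q Q K (tailSum N r 0) lam 1 Y
      (fun j => seriesSum (qBorelIter τ κ r (Y j)))) :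
    ∀ i < r, StageData Q Q K (tailSum N r i) lam (‖Q‖ ^ (∑ k ∈ Finset.range i, N k)) Y
      (fun j => stage τ κ r K lam (Y j) i) := by
  intro i hi
  induction i with
  | zero => simpa [stage, qLaplaceIter] using h0
  | succ i ih =>
    have hi' : i < r := by omega
    obtain ⟨F, hF, hrel⟩ := (ih hi').exists_globalData hQ hs hK (hN i hi').1 (tailSum_of_lt N hi') hP
      (fun j => (htop j i hi').1) (fun j => (htop j i hi').2) (fun j => hroots j i hi') hls hU
    -- The intermediate transforms run along the full Q-spiral, the case g = 1 of the general
    -- statements.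
    have hF' := hF
    rw [← one_mul (N i)] at hF'
    have h1 := stageData_lap hQ one_ne_zero (hN i hi').1 (one_dvd K) (one_dvd _)
      (by rw [one_mul]; exact tailSum_of_lt N hi') hlam hF' hrel
    have h2 : ∀ j, stage τ κ r K lam (Y j) (i + 1) = lap ((Q ^ 1) ^ N i) (Q ^ 1) lam (N i)
        (fun ℓ => F j ((Q ^ 1) ^ ℓ * lam)) := fun j =>
      (hF' j).qLaplace_eq hQ hs hlam hU one_ne_zero hK (by rw [pow_one, hQK]) (hN i hi').2
    simp only [← h2] at h1
    rwa [pow_one, one_mul, ← pow_add, ← Finset.sum_range_succ] at h1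

end QDiff

end

/-! ### Assembly of the main theorem -/

theorem theorem1p16
    (q τ : ℂ) (hq : 1 < ‖q‖) (hτ : Complex.exp τ = q)
    (m : ℕ) (A : Matrix.GeneralLinearGroup (Fin m) (RatFunc ℂ))
    (Y : Fin m → PowerSeries ℂ)
    (hY : ∀ i, ((PowerSeries.rescale q (Y i) : PowerSeries ℂ) : LaurentSeries ℂ) =
      ∑ j, ((A.val i j : RatFunc ℂ) : LaurentSeries ℂ) * ((Y j : PowerSeries ℂ) : LaurentSeries ℂ))
    (r : ℕ) (hr : 0 < r) (μ : ℕ → ℚ)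
    (hμmono : StrictMonoOn μ (Set.Iio r))
    (hμ : Minimal (QDiff.SlopesCovered q Y) ((Finset.range r).image μ))
    (K n : ℕ)
    (hK : IsLeast {K : ℕ | 0 < K ∧ ∀ i < r, ∃ N : ℕ, 0 < N ∧ (K : ℚ) / QDiff.kappa r μ i = N} K)
    (hn : IsLeast {n : ℕ | 0 < n ∧ ∃ N : ℕ, 0 < N ∧ (n : ℚ) / QDiff.kappa r μ (r - 1) = N} n) :
    ∃ S : Set (QDiff.SpiralSpace τ n), S.Finite ∧
      ∀ lam : ℂˣ, (QuotientGroup.mk lam : QDiff.SpiralSpace τ n) ∉ S →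
        -- the iterated Borel transforms converge
        (∀ j, QDiff.Convergent (QDiff.qBorelIter τ (QDiff.kappa r μ) r (Y j))) ∧
        -- all the intermediate functions are in the required spaces
        (∀ j, ∀ i < r, QDiff.InH τ (QDiff.kappa r μ i) K lam
          (QDiff.stage τ (QDiff.kappa r μ) r K lam (Y j) i)) ∧
        -- all the Laplace transformations that are applied make sense
        (∀ j, ∀ i < r - 1, QDiff.QLaplaceDefined τ (QDiff.kappa r μ i) K lam
          (QDiff.stage τ (QDiff.kappa r μ) r K lam (Y j) i)) ∧
        (∀ j, QDiff.QLaplaceDefined τ (QDiff.kappa r μ (r - 1)) n lam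
          (QDiff.stage τ (QDiff.kappa r μ) r K lam (Y j) (r - 1))) ∧
        -- the resulting vector extends meromorphically, solves the system, and is asymptotic to Y
        ∃ F : Fin m → ℂ → ℂ,
          (∀ j, MeromorphicOn (F j) {0}ᶜ) ∧
          (∀ j, ∀ᶠ z in 𝓝[≠] (0 : ℂ), ¬ QDiff.OnSpiral τ n lam z →
            F j z = QDiff.borelLaplaceSum τ (QDiff.kappa r μ) r K n lam (Y j) z) ∧
          (∀ i, ∀ z₀ : ℂ, z₀ ≠ 0 → (fun z => F i (q * z)) =ᶠ[𝓝[≠] z₀]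
            fun z => ∑ j, (A.val i j : RatFunc ℂ).eval (RingHom.id ℂ) z * F j z) ∧
          (∀ j, QDiff.QGevreyAsymptotic τ (μ 0) n lam (F j) (Y j)) := by
  classical
  subst hτ
  have hμpos : ∀ i < r, 0 < μ i := fun i hi =>
    hμ.prop.1 _ (Finset.mem_image_of_mem _ (Finset.mem_range.2 hi))
  have hK0 : K ≠ 0 := hK.1.1.ne'
  have hn0 : n ≠ 0 := hn.1.1.ne'
  have hr1 : r - 1 < r := by omega
  have hNex : ∀ i, ∃ N : ℕ, i < r → N ≠ 0 ∧ (K : ℚ) / QDiff.kappa r μ i = N := by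
    intro i
    by_cases hi : i < r
    · obtain ⟨N, h1, h2⟩ := hK.1.2 i hi
      exact ⟨N, fun _ => ⟨h1.ne', h2⟩⟩
    · exact ⟨0, fun h => absurd h hi⟩
  choose N hN using hNex
  obtain ⟨N', hN'pos, hN'⟩ := hn.1.2
  have hκpos : 0 < QDiff.kappa r μ (r - 1) := by
    rw [QDiff.kappa, if_neg (by omega)]
    exact hμpos _ hr1
  obtain ⟨g, hgK⟩ : n ∣ K := QDiff.dvd_of_isLeast hn hκpos (hN _ hr1).2 hN'
  rw [mul_comm] at hgK
  have hg0 : g ≠ 0 := by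
    rintro rfl
    exact hK0 (by rw [hgK, zero_mul])
  -- The last transform runs along the coarser spiral of ratio q^(1/n) = Q^g, but with the same base
  -- p = Q^(g N') of Theta.
  have hNg : N (r - 1) = g * N' := by
    have h1 := (hN _ hr1).2
    rw [hgK, Nat.cast_mul, mul_div_assoc, hN'] at h1
    exact_mod_cast h1.symm
  obtain ⟨Q, hQK⟩ : ∃ Q, Q = QDiff.qPow τ (1 / (K : ℂ)) := ⟨_, rfl⟩
  have hQ : 1 < ‖Q‖ := hQK ▸ QDiff.one_lt_norm_qPow hq hK0
  have hQ0 : Q ≠ 0 := QDiff.ne_zero_of_one_lt_norm hQ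
  have hQq : Q ^ K = Complex.exp τ := hQK ▸ QDiff.qPow_pow_self τ hK0
  have hQn : Q ^ g = QDiff.qPow τ (1 / (n : ℂ)) := by
    rw [hQK, hgK, QDiff.qPow_mul_pow τ hg0 n]
  rw [← hQq] at hY hμ
  choose P A hP0 hP hslopes using hμ.prop.2
  have hDμ : ∀ i < r, (K : ℚ) / μ i = QDiff.tailSum N r i := fun i hi =>
    QDiff.div_slope_eq_tailSum (fun i hi => (hN i hi).2) hi
  have hvert := fun j => QDiff.exists_vertices (K := K) (D := QDiff.tailSum N r) hr hμpos hμmono hDμ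
    (fun i hi => by rw [QDiff.tailSum_of_lt N hi]; omega) (hP0 j) (hslopes j)
  have hvex : ∀ j i, ∃ v : ℤ × ℕ, i < r →
      QDiff.IsTop K (QDiff.tailSum N r i) (QDiff.monomials (P j)) v.1 v.2 ∧
        QDiff.IsTop K (QDiff.tailSum N r (i + 1)) (QDiff.monomials (P j)) v.1 v.2 := by
    intro j i
    by_cases hi : i < r
    · obtain ⟨v, hv⟩ := (hvert j).2 i hi
      exact ⟨v, fun _ => hv⟩
    · exact ⟨(0, 0), fun h => absurd h hi⟩
  choose v hv using hvex
  -- the singular directions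
  set s₀ : Finset ℂ := (Finset.univ.biUnion fun j => (Finset.range r).biUnion fun i =>
    (QDiff.topPoly Q K (QDiff.tailSum N r i) (QDiff.monomials (P j))
      (QDiff.shiftExp K (QDiff.tailSum N r i) (v j i))).roots.toFinset ∪
    (QDiff.topPoly Q K (QDiff.tailSum N r (i + 1)) (QDiff.monomials (P j))
      (QDiff.shiftExp K (QDiff.tailSum N r (i + 1)) (v j i))).roots.toFinset).erase 0
  have hroots : ∀ j, ∀ i < r, ∀ ρ : ℂ, ρ ≠ 0 →
      ((QDiff.topPoly Q K (QDiff.tailSum N r i) (QDiff.monomials (P j))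
        (QDiff.shiftExp K (QDiff.tailSum N r i) (v j i))).eval ρ = 0 → ρ ∈ s₀) ∧
      ((QDiff.topPoly Q K (QDiff.tailSum N r (i + 1)) (QDiff.monomials (P j))
        (QDiff.shiftExp K (QDiff.tailSum N r (i + 1)) (v j i))).eval ρ = 0 → ρ ∈ s₀) := by
    intro j i hi ρ hρ
    have hmem : ∀ x, x ∈ (QDiff.topPoly Q K (QDiff.tailSum N r i) (QDiff.monomials (P j))
        (QDiff.shiftExp K (QDiff.tailSum N r i) (v j i))).roots.toFinset ∪
      (QDiff.topPoly Q K (QDiff.tailSum N r (i + 1)) (QDiff.monomials (P j))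
        (QDiff.shiftExp K (QDiff.tailSum N r (i + 1)) (v j i))).roots.toFinset → x ≠ 0 →
        x ∈ s₀ := fun x hx hx0 =>
      Finset.mem_erase.2 ⟨hx0, Finset.mem_biUnion.2 ⟨j, Finset.mem_univ _,
        Finset.mem_biUnion.2 ⟨i, Finset.mem_range.2 hi, hx⟩⟩⟩
    refine ⟨fun h => hmem ρ (Finset.mem_union_left _ ?_) hρ,
      fun h => hmem ρ (Finset.mem_union_right _ ?_) hρ⟩
    · rw [Multiset.mem_toFinset, mem_roots (QDiff.topPoly_ne_zero hK0 hQ0 (hv j i hi).1)]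
      exact h
    · rw [Multiset.mem_toFinset, mem_roots (QDiff.topPoly_ne_zero hK0 hQ0 (hv j i hi).2)]
      exact h
  refine ⟨_, QDiff.finite_classes τ Q n g s₀, fun lam hlamS => ?_⟩
  have hlam := QDiff.mem_regular_insert hQ lam.ne_zero
    (QDiff.notMem_spirals_of_mk_notMem (Nat.pos_of_ne_zero hg0) hQ0 hQn hlamS)
  -- The Laplace transforms have their possible poles on the spiral of -lam, which must be removed
  -- too. The exceptional classes depend only on s₀.
  set s := insert (-(lam : ℂ)) s₀
  have hs : (0 : ℂ) ∉ s := by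
    rw [Finset.mem_insert, not_or]
    exact ⟨fun h => lam.ne_zero (neg_eq_zero.1 h.symm), Finset.notMem_erase _ _⟩
  have hls : -(lam : ℂ) ∈ s := Finset.mem_insert_self _ _
  have hs₀s : ∀ ρ ∈ s₀, ρ ∈ s := fun ρ hρ => Finset.mem_insert_of_mem hρ
  obtain ⟨U, hU⟩ := QDiff.exists_isFundamental hQ hs hlam
  -- convergence of the Borel transforms
  have hcoeff : ∀ j k, PowerSeries.coeff k (QDiff.qBorelIter τ (QDiff.kappa r μ) r (Y j)) =
      PowerSeries.coeff k (Y j) * QDiff.borelFactor Q (QDiff.tailSum N r 0) k := fun j k => by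
    rw [QDiff.tailSum_zero]
    exact QDiff.coeff_qBorelIter hK0 hQK r (fun i hi => (hN i hi).2) _ k
  have hbound : ∀ j, ∃ L M : ℝ, 1 ≤ M ∧ ∀ k,
      ‖PowerSeries.coeff k (QDiff.qBorelIter τ (QDiff.kappa r μ) r (Y j))‖ ≤ L * M ^ k := by
    intro j
    obtain ⟨I, J, h1, h2⟩ := (hvert j).1
    simp only [hcoeff]
    exact QDiff.exists_geometric_bound_borel hQ hK0 (hP j) h1 h2
  -- the stages
  have hstage := QDiff.stageData_stage hQ hK0 hQK hN hs hlam hls hP (fun j i hi => hv j i hi)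
    (fun j i hi ρ hρ h => hs₀s _ ((hroots j i hi ρ hρ).1 h)) hU
    (QDiff.stageData_zero hQ hcoeff hbound lam)
  have hglobal := fun i (hi : i < r) => (hstage i hi).exists_globalData hQ hs hK0 (hN i hi).1
    (QDiff.tailSum_of_lt N hi) hP (fun j => (hv j i hi).1) (fun j => (hv j i hi).2)
    (fun j ρ hρ h => hs₀s _ ((hroots j i hi ρ hρ).1 h)) hls hU
  have hmer : ∀ j, ∀ i < r, QDiff.MeromorphicNearZero
      (QDiff.stage τ (QDiff.kappa r μ) r K lam (Y j) i) := fun j i hi =>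
    ((hstage i hi).localData j).meromorphicNearZero
  have hQ1 : Q ^ 1 = QDiff.qPow τ (1 / (K : ℂ)) := by rw [pow_one, hQK]
  -- the last Laplace transformation
  obtain ⟨F₁, hF₁, hrel₁⟩ := hglobal (r - 1) hr1
  rw [hNg] at hF₁
  have hr' : r - 1 + 1 = r := by omega
  have hD : QDiff.tailSum N r (r - 1) = g * N' + 0 := by
    rw [QDiff.tailSum_of_lt N hr1, hr', QDiff.tailSum_self, hNg]
  -- Passing to the Q^g-spiral requires g to divide K and the next level. The next level is 0, so
  -- this is satisfied.
  have hlast := QDiff.stageData_lap hQ hg0 hN'pos.ne' (hgK ▸ dvd_mul_right g n) (dvd_zero g) hD hlam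
    hF₁ hrel₁
  have hsum : ∀ j, QDiff.borelLaplaceSum τ (QDiff.kappa r μ) r K n lam (Y j) = _ := fun j =>
    (hF₁ j).qLaplace_eq hQ hs hlam hU hg0 hn0 hQn hN'
  simp only [← hsum] at hlast
  -- The accumulated weight becomes |Q| to the power of the sum of all N_i, which is K/μ 0.
  rw [← hNg, ← pow_add, ← Finset.sum_range_succ, hr', ← QDiff.tailSum_zero] at hlast
  have htopr : ∀ j, QDiff.IsTop K 0 (QDiff.monomials (P j)) (v j (r - 1)).1 (v j (r - 1)).2 := by
    intro j
    have := (hv j (r - 1) hr1).2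
    rwa [hr', QDiff.tailSum_self] at this
  obtain ⟨F, hFagree, hFmer, hFrel⟩ := hlast.exists_meromorphic hQ hs hP htopr
    (fun j ρ hρ h => hs₀s _ ((hroots j (r - 1) hr1 ρ hρ).2
      (by rwa [hr', QDiff.tailSum_self]))) hls
  refine ⟨fun j => ?_, fun j i hi => ?_, fun j i hi => ?_, fun j => ?_, F, fun j z hz => hFmer j z hz,
    fun j => ?_, fun i z₀ hz₀ => ?_, fun j => ?_⟩
  · obtain ⟨L, M, hM, h⟩ := hbound j
    exact QDiff.convergent_of_bound hM h
  · obtain ⟨G, hG, -⟩ := hglobal i hi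
    rw [← one_mul (N i)] at hG
    exact (hG j).inH hQ hU hK0 hQ1 (hN i hi).2 (hmer j i hi)
  · have hi : i < r := by omega
    obtain ⟨G, hG, -⟩ := hglobal i hi
    rw [← one_mul (N i)] at hG
    exact (hG j).qLaplaceDefined hQ hs hlam hU one_ne_zero (hN i hi).1 hK0 hQ1 (hN i hi).2
      (hmer j i hi)
  · exact (hF₁ j).qLaplaceDefined hQ hs hlam hU hg0 hN'pos.ne' hn0 hQn hN' (hmer j _ hr1)
  · obtain ⟨ρ, hρ, h⟩ := hFagree j
    filter_upwards [mem_nhdsWithin_of_mem_nhds (Metric.ball_mem_nhds (0 : ℂ) hρ)] with z hz _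
    exact h z (by simpa using hz)
  · rw [← hQq]
    exact QDiff.eventuallyEq_of_relations hQ hs hFrel (hY i) hz₀
  · refine QDiff.qGevreyAsymptotic_of_localData hK0 hQK (hDμ 0 hr) ?_ (hFagree j)
    have h1 := hlast.localData j
    rw [hQn] at h1
    simpa [QDiff.borelFactor] using h1
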